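/- Let $p\ge 0$ and $q\in\{1,2\}$. Let $\mu$ be a nonzero finite measure on $\mathbb R$ whose support is contained in $[a,b]$ for some $0<a\le b<\infty$, and let $h(u)=\int e^{-tu}\,\mu(dt)$. Let $\mathbb Q$ be a probability distribution of $(X,Y)\in\mathbb R^p\times\{\pm1\}$ such that $\mathbb E_{\mathbb Q}[Y]=0$, $\|X\|_\infty\le M_X<\infty$ almost surely, $\mathrm{Var}_{\mathbb Q}(X_l)>0$ for every $l\in[p]$, and $\mathbb E_{\mathbb Q}[\mathrm{Var}_{\mathbb Q}(Y|X)]>0$. Let $S\subseteq[p]$ be the signal set: the minimal (for inclusion) subset with $\mathbb E_{\mathbb Q}[Y|X]=\mathbb E_{\mathbb Q}[Y|X_S]$ a.s. and $X_S\perp X_{S^c}$ under $\mathbb Q$. For a distribution $R$ of $(X,Y)$ put $F(\beta;R)=-\mathbb E_R\big[YY'\,h\big(\sum_i\beta_i|X_i-X_i'|^q\big)\big]$, with $(X,Y),(X',Y')$ independent copies from $R$. Let $(X^{(i)},Y^{(i)})_{i\le n}$ be i.i.d. from $\mathbb Q$ with empirical distribution $\mathbb Q_n$. For $A\subseteq[p]$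 let $\mathbb Q_n^A$ be the probability distribution with $\frac{d\mathbb Q_n^A}{d\mathbb Q_n}(x,y)\propto \mathbb Q(Y=-y\mid X_A=x_A)$ (the zero measure if all these weights vanish on the sample). Fix $M>0$, $\mathcal B=\{\beta\in\mathbb R^p:0\le\beta_i\le M\ \text{for all } i\}$, and an initializer $\beta^{(0)}\in\mathcal B$ of full support, $\mathrm{supp}(\beta^{(0)})=[p]$. Given a threshold $\epsilon_n$ and a step-size bound $\alpha_0>0$, the algorithm starts from $\hat S=\emptyset$ and repeats the following pass until a pass leaves $\hat S$ unchanged; it then outputs $\hat S$. In each pass, let $\hat\beta$ be a point found by projected gradient descent for $\min_{\beta\in\mathcal B}F(\beta;\mathbb Q_n^{\hat S})$ started at $\beta^{(0)}$, that is, any limit point of the iterates $\beta(k+1)=\Pi_{\mathcal B}\big(\beta(k)-\alpha\nabla F(\beta(k);\mathbb Q_n^{\hat S})\big)$ for some constant step size $\alpha\in(0,\alpha_0]$, or any limit point as $t\to\infty$ of a trajectory of the projected gradient flow $\dot\beta(t)\in-\nabla F(\beta(t);\mathbb Q_n^{\hat S})-\mathcal N_{\mathcal B}(\beta(t))$, where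 $\mathcal N_{\mathcal B}$ is the normal cone; if $F(\hat\beta;\mathbb Q_n^{\hat S})<-\epsilon_n$, replace $\hat S$ by $\hat S\cup\mathrm{supp}(\hat\beta)$. **Proposition.** There exist constants $C,c,\epsilon_0,\alpha_0>0$, independent of $n$ and of the threshold, such that for every $n\ge1$ and every threshold $\epsilon_n\ge C/\sqrt n$, with probability at least $1-2^{|S|}e^{-cn\epsilon_n^2}$, the algorithm has an output, and every possible output $\hat S$ satisfies (i) $\hat S\subseteq S$, and (ii) if in addition $\epsilon_n\le\epsilon_0$, then $\mathbb E_{\mathbb Q}[Y|X]=\mathbb E_{\mathbb Q}[Y|X_{\hat S}]$ almost surely, where $(X,Y)\sim\mathbb Q$ is independent of the sample and $\hat S$ is treated as fixed. -/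

import Mathlib

open MeasureTheory ProbabilityTheory Filter Topology

/-! ### Data points and conditioning -/

/-- A data point `z = (x, y)`: features `x = z.1 ∈ ℝ^p` and response `y = z.2 ∈ ℝ`. -/
abbrev DataPoint (p : ℕ) : Type := (Fin p → ℝ) × ℝ

/-- The subvector `x_A` of the feature vector of a data point. -/
def subfeatures {p : ℕ} (A : Finset (Fin p)) (z : DataPoint p) : A → ℝ := fun i => z.1 i

/-- `E_Q[Y | X] = E_Q[Y | X_A]`, `Q`-almost surely. -/
def IsSufficient {p : ℕ} (Q : Measure (DataPoint p)) (A : Finset (Fin p)) : Prop :=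
  Q[(Prod.snd : DataPoint p → ℝ) |
      MeasurableSpace.comap (Prod.fst : DataPoint p → (Fin p → ℝ)) inferInstance]
    =ᵐ[Q]
  Q[(Prod.snd : DataPoint p → ℝ) | MeasurableSpace.comap (subfeatures A) inferInstance]

/-- `S` is the signal set of `Q`: it is minimal (for inclusion) among the subsets `T ⊆ [p]` with
`E_Q[Y | X] = E_Q[Y | X_T]` and `X_T ⊥ X_{T^c}` under `Q`. -/
def IsSignalSet {p : ℕ} (Q : Measure (DataPoint p)) (S : Finset (Fin p)) : Prop :=
  Minimal (fun T : Finset (Fin p) =>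
    IsSufficient Q T ∧ IndepFun (subfeatures T) (subfeatures Tᶜ) Q) S

/-! ### The metric learning objective -/

/-- `h(u) = ∫ e^{-tu} μ(dt)`. -/
noncomputable def kernelProfile (μ : Measure ℝ) (u : ℝ) : ℝ := ∫ t, Real.exp (-(t * u)) ∂μ

/-- `‖x - x'‖_{q,β}^q = ∑ i, β i * |x i - x' i| ^ q`. -/
noncomputable def weightedDist {p : ℕ} (q : ℕ) (β : EuclideanSpace ℝ (Fin p))
    (x x' : Fin p → ℝ) : ℝ := ∑ i, β i * |x i - x' i| ^ q

/-- `F^ML(β; R) = - E_R[Y Y' h(‖X - X'‖_{q,β}^q)]` with `(X, Y)`, `(X', Y')` independent copies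
from `R`. -/
noncomputable def mlObjective {p : ℕ} (μ : Measure ℝ) (q : ℕ) (R : Measure (DataPoint p))
    (β : EuclideanSpace ℝ (Fin p)) : ℝ :=
  -∫ w : DataPoint p × DataPoint p,
    w.1.2 * w.2.2 * kernelProfile μ (weightedDist q β w.1.1 w.2.1) ∂(R.prod R)

/-- The weight `Q(Y = -y | X_A = x_A)` of a data point `(x, y)`. -/
noncomputable def flipWeight {p : ℕ} (Q : Measure (DataPoint p)) [IsFiniteMeasure Q]
    (A : Finset (Fin p)) (z : DataPoint p) : ℝ :=
  (condDistrib (Prod.snd : DataPoint p → ℝ) (subfeatures A) Q (subfeatures A z)).real {-z.2}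

/-- The reweighted empirical distribution `Q_n^A` of the sample `D`: the probability measure whose
density with respect to the empirical distribution is proportional to `Q(Y = -y | X_A = x_A)`.
(If all the weights vanish there is no such probability measure; then it is the zero measure.) -/
noncomputable def reweightedEmpirical {p n : ℕ} (Q : Measure (DataPoint p)) [IsFiniteMeasure Q]
    (A : Finset (Fin p)) (D : Fin n → DataPoint p) : Measure (DataPoint p) :=
  ∑ i, ENNReal.ofReal (flipWeight Q A (D i) / ∑ j, flipWeight Q A (D j)) • Measure.dirac (D i)

/-! ### Projected gradient descent and its continuous-time version -/

/-- The feasible set `{β : β ≥ 0, ‖β‖_∞ ≤ M}`. -/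
def feasibleBox (p : ℕ) (M : ℝ) : Set (EuclideanSpace ℝ (Fin p)) :=
  {β | ∀ i, 0 ≤ β i ∧ β i ≤ M}

/-- `y` is the Euclidean projection of `z` on `B`. -/
def IsProjection {p : ℕ} (B : Set (EuclideanSpace ℝ (Fin p)))
    (z y : EuclideanSpace ℝ (Fin p)) : Prop :=
  y ∈ B ∧ ∀ b ∈ B, ‖y - z‖ ≤ ‖b - z‖

/-- `x 0, x 1, …` are the iterates `x (k+1) = Π_B (x k - α ∇F(x k))` of projected gradient descent
with step size `α`, started at `β₀`. -/
def IsProjGradDescent {p : ℕ} (F : EuclideanSpace ℝ (Fin p) → ℝ)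
    (B : Set (EuclideanSpace ℝ (Fin p))) (β₀ : EuclideanSpace ℝ (Fin p)) (α : ℝ)
    (x : ℕ → EuclideanSpace ℝ (Fin p)) : Prop :=
  x 0 = β₀ ∧ ∀ k, IsProjection B (x k - α • gradient F (x k)) (x (k + 1))

/-- The normal cone of `B` at `x` (empty when `x ∉ B`). -/
def normalCone {p : ℕ} (B : Set (EuclideanSpace ℝ (Fin p)))
    (x : EuclideanSpace ℝ (Fin p)) : Set (EuclideanSpace ℝ (Fin p)) :=
  {ν | x ∈ B ∧ ∀ b ∈ B, inner ℝ ν (b - x) ≤ 0}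

/-- `x` is, on `[0, ∞)`, a solution of the projected gradient inclusion
`x'(t) ∈ -∇F(x(t)) - N_B(x(t))`, `x(0) = β₀`. -/
def IsProjGradFlow {p : ℕ} (F : EuclideanSpace ℝ (Fin p) → ℝ)
    (B : Set (EuclideanSpace ℝ (Fin p))) (β₀ : EuclideanSpace ℝ (Fin p))
    (x : ℝ → EuclideanSpace ℝ (Fin p)) : Prop :=
  ∃ v : ℝ → EuclideanSpace ℝ (Fin p), Measurable v ∧
    ∀ t, 0 ≤ t →
      IntervalIntegrable v volume 0 t ∧
      x t = β₀ + ∫ s in (0 : ℝ)..t, v s ∧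
      ∃ ν ∈ normalCone B (x t), v t = -gradient F (x t) - ν

/-- `βhat` is a point found by projected gradient descent on `F` over `B` from `β₀`: a limit point
of the iterates for some step size `α ∈ (0, α₀]`, or a limit point as `t → ∞` of a trajectory of
the projected gradient inclusion (the idealization `α → 0⁺`). In particular every limit of such a
sequence or trajectory is covered. -/
def IsFoundPoint {p : ℕ} (F : EuclideanSpace ℝ (Fin p) → ℝ)
    (B : Set (EuclideanSpace ℝ (Fin p))) (β₀ : EuclideanSpace ℝ (Fin p)) (α₀ : ℝ)
    (βhat : EuclideanSpace ℝ (Fin p)) : Prop :=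
  (∃ α x, 0 < α ∧ α ≤ α₀ ∧ IsProjGradDescent F B β₀ α x ∧ MapClusterPt βhat atTop x) ∨
  (∃ x, IsProjGradFlow F B β₀ x ∧ MapClusterPt βhat atTop x)

/-! ### The selection algorithm -/

open Classical in
/-- The support of a vector. -/
noncomputable def vecSupport {p : ℕ} (β : EuclideanSpace ℝ (Fin p)) : Finset (Fin p) :=
  Finset.univ.filter fun i => β i ≠ 0

open Classical in
/-- One pass through the body of the loop, from the current selection `A` to the updated one `A'`:
minimize `F^ML(·; Q_n^A)` by projected gradient descent started at `β₀`, and add the support of the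
point `βhat` that was found if `F^ML(βhat; Q_n^A) < -ε`. -/
def LoopBody {p n : ℕ} (μ : Measure ℝ) (q : ℕ) (Q : Measure (DataPoint p)) [IsFiniteMeasure Q]
    (M : ℝ) (β₀ : EuclideanSpace ℝ (Fin p)) (α₀ ε : ℝ) (D : Fin n → DataPoint p)
    (A A' : Finset (Fin p)) : Prop :=
  ∃ βhat, IsFoundPoint (mlObjective μ q (reweightedEmpirical Q A D)) (feasibleBox p M) β₀ α₀ βhat ∧
    A' = if mlObjective μ q (reweightedEmpirical Q A D) βhat < -ε then A ∪ vecSupport βhat else A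

/-- `LoopReturns … A T`: the loop, entered with the selection `A`, can return `T`. The loop ends as
soon as a pass leaves the selection unchanged. -/
inductive LoopReturns {p n : ℕ} (μ : Measure ℝ) (q : ℕ) (Q : Measure (DataPoint p))
    [IsFiniteMeasure Q] (M : ℝ) (β₀ : EuclideanSpace ℝ (Fin p)) (α₀ ε : ℝ)
    (D : Fin n → DataPoint p) : Finset (Fin p) → Finset (Fin p) → Prop
  | halt (A : Finset (Fin p)) : LoopBody μ q Q M β₀ α₀ ε D A A →
      LoopReturns μ q Q M β₀ α₀ ε D A A
  | next (A A' T : Finset (Fin p)) : LoopBody μ q Q M β₀ α₀ ε D A A' → A' ≠ A →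
      LoopReturns μ q Q M β₀ α₀ ε D A' T → LoopReturns μ q Q M β₀ α₀ ε D A T

/-- `T` is an output of the metric learning algorithm on the sample `D` with initializer `β₀`, box
size `M`, threshold `ε` and step sizes at most `α₀`: the loop, entered with the empty selection,
can return `T`. -/
def IsAlgorithmOutput {p n : ℕ} (μ : Measure ℝ) (q : ℕ) (Q : Measure (DataPoint p))
    [IsFiniteMeasure Q] (M : ℝ) (β₀ : EuclideanSpace ℝ (Fin p)) (α₀ ε : ℝ)
    (D : Fin n → DataPoint p) (T : Finset (Fin p)) : Prop :=
  LoopReturns μ q Q M β₀ α₀ ε D ∅ T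

/-!
The proof rests on the self-penalization of the metric learning objective.

Write `a = (Y - E[Y | X_A]) / 2` for the half residual of the current selection `A ⊆ S`. For a
response in `{1, -1}`, the weight `Q(Y = -y | X_A = x_A)` times `y` equals `a`
(`flipWeight_mul_response`), so reweighting recentres the response, and the objective at `Q_n^A` is,
up to the squared mean weight, minus the `μ(dt)`-integral of the empirical quadratic forms of the
kernels `exp (-t ‖x - x'‖_{q,β}^q)` at `a` (`discreteObjective_eq_pairAvg`); its partial derivatives
are quadratic forms of `t |x_l - x'_l|^q exp (-t ‖x - x'‖_{q,β}^q)` (`discreteGradient_eq_pairAvg`).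

For the population forms three facts hold.
* The residual only involves the features in `S`, which are independent of the others, so the
  form factors into a signal part, nonnegative because the kernel is positive definite, and a noise
  part. Hence, for a noise coordinate `l`, the form of the `l`-th derivative is at least a constant
  times the form itself (`exists_mul_pairMean_le_pairMean_gradKernel`).
* The form vanishes when `β` is supported in `A` (`pairMean_expKernel_eq_zero`).
* If all weights are positive and `X_A` is not sufficient, the form is positive: the kernel is the
  autocorrelation of a function whose Fourier transform has no zeros
  (`integral_mul_cexp_eq_zero`), so a vanishing form kills the Fourier transform of `a Q`
  (`pairMean_expKernel_pos`).

The empirical forms are uniformly close to the population forms. For arguments in a cube, each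
section of a kernel is a bounded signed mixture of indicators of orthants
(`exists_isOrthantMixture_kernel`); one average over random orthants (`orthantDev`) therefore
controls all forms at once (`abs_pairAvg_sub_pairMean_le`), and convexity of the exponential gives
this average the sub-Gaussian tail of a single bounded mean (`measure_le_orthantDev`), without any
covering argument.

On the optimization side, a limit point of projected gradient descent or of the projected gradient
flow is a stationary point at which the objective does not exceed its initial value
(`IsFoundPoint.stationary`). If its value is below `-ε`, all derivatives along noise coordinates are
positive, so stationarity forces these coordinates to vanish, and its support is not contained in
`A`. If `X_A` is not sufficient, the initial value is already below `-ε` for small `ε`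
(`exists_pass_constants`). The loop therefore stays inside `S`, terminates, and stops
only at a sufficient selection. A union bound over `A ⊆ S` gives the factor `2 ^ |S|`.
-/

/-! ### Limit points of projected gradient descent and of the projected gradient flow -/

/-- `F` is a smooth objective on `B`: it is `C¹` on the whole space, and on `B` it satisfies the
quadratic upper bound `F y ≤ F x + ⟪∇F x, y - x⟫ + L ‖y - x‖²`. -/
structure QuadUpperBound {p : ℕ} (F : EuclideanSpace ℝ (Fin p) → ℝ)
    (B : Set (EuclideanSpace ℝ (Fin p))) (L : ℝ) : Prop where
  diff : Differentiable ℝ F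
  cont : Continuous (gradient F)
  upper : ∀ x ∈ B, ∀ y ∈ B, F y ≤ F x + inner ℝ (gradient F x) (y - x) + L * ‖y - x‖ ^ 2

section Descent

variable {p : ℕ} {F : EuclideanSpace ℝ (Fin p) → ℝ} {B : Set (EuclideanSpace ℝ (Fin p))} {L : ℝ}
  {β₀ : EuclideanSpace ℝ (Fin p)}

theorem IsProjection.inner_le_zero (hB : Convex ℝ B) {z y b : EuclideanSpace ℝ (Fin p)}
    (h : IsProjection B z y) (hb : b ∈ B) : inner ℝ (z - y) (b - y) ≤ 0 := by
  have hy : ‖z - y‖ = ⨅ w : B, ‖z - w‖ := by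
    have : Nonempty B := ⟨⟨y, h.1⟩⟩
    apply le_antisymm
    · exact le_ciInf fun w => by
        simpa [norm_sub_rev] using h.2 w w.2
    · exact ciInf_le ⟨0, by rintro _ ⟨w, rfl⟩; positivity⟩ (⟨y, h.1⟩ : B)
  exact (norm_eq_iInf_iff_real_inner_le_zero hB h.1).1 hy b hb

theorem exists_isProjection (hB : IsCompact B) (hne : B.Nonempty)
    (z : EuclideanSpace ℝ (Fin p)) : ∃ y, IsProjection B z y := by
  obtain ⟨y, hy, hmin⟩ := hB.exists_isMinOn hne
    (f := fun b => ‖b - z‖) (by fun_prop)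
  exact ⟨y, hy, fun b hb => hmin hb⟩

theorem IsProjGradDescent.mem {α : ℝ} {x : ℕ → EuclideanSpace ℝ (Fin p)} (hβ₀ : β₀ ∈ B)
    (hx : IsProjGradDescent F B β₀ α x) (k : ℕ) : x k ∈ B := by
  cases k with
  | zero => rw [hx.1]; exact hβ₀
  | succ k => exact (hx.2 k).1

theorem exists_isFoundPoint (hB : IsCompact B) (hβ₀ : β₀ ∈ B) {α₀ : ℝ} (hα₀ : 0 < α₀) :
    ∃ βhat, IsFoundPoint F B β₀ α₀ βhat := by
  choose P hP using fun z => exists_isProjection hB ⟨β₀, hβ₀⟩ z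
  let x : ℕ → EuclideanSpace ℝ (Fin p) :=
    fun k => Nat.rec β₀ (fun _ y => P (y - α₀ • gradient F y)) k
  have hx : IsProjGradDescent F B β₀ α₀ x := ⟨rfl, fun k => hP _⟩
  obtain ⟨y, -, hy⟩ := hB.exists_mapClusterPt (u := x) (f := atTop)
    (tendsto_principal.2 (Eventually.of_forall fun k => hx.mem hβ₀ k))
  exact ⟨y, Or.inl ⟨α₀, x, hα₀, le_rfl, hx, hy⟩⟩

/-- One step of projected gradient descent decreases the objective by a multiple of the squared
step length, as soon as the step size is at most `1 / (2 L)`. -/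
theorem IsProjGradDescent.step_le (hB : Convex ℝ B) (hF : QuadUpperBound F B L)
    (hβ₀ : β₀ ∈ B) {α : ℝ} (hα : 0 < α) (hαL : α * (2 * L) ≤ 1)
    {x : ℕ → EuclideanSpace ℝ (Fin p)} (hx : IsProjGradDescent F B β₀ α x) (k : ℕ) :
    F (x (k + 1)) ≤ F (x k) - 1 / (2 * α) * ‖x (k + 1) - x k‖ ^ 2 := by
  have h1 := (hx.2 k).inner_le_zero hB (hx.mem hβ₀ k)
  have h2 := hF.upper _ (hx.mem hβ₀ k) _ (hx.mem hβ₀ (k + 1))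
  set d := x (k + 1) - x k with hd
  have h3 : x k - α • gradient F (x k) - x (k + 1) = -(d + α • gradient F (x k)) := by
    rw [hd]; abel
  have h4 : x k - x (k + 1) = -d := by rw [hd]; abel
  rw [h3, h4, inner_neg_neg, inner_add_left, real_inner_self_eq_norm_sq,
    real_inner_smul_left] at h1
  have h5 : L ≤ 1 / (2 * α) := by
    rw [le_div_iff₀ (by positivity)]; linarith
  have h6 : inner ℝ (gradient F (x k)) d ≤ -(1 / α) * ‖d‖ ^ 2 := by
    have : inner ℝ (gradient F (x k)) d ≤ (-‖d‖ ^ 2) / α := by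
      rw [le_div_iff₀ hα]; linarith
    calc _ ≤ _ := this
      _ = _ := by ring
  have h7 : L * ‖d‖ ^ 2 ≤ 1 / (2 * α) * ‖d‖ ^ 2 := by gcongr
  have h8 : 1 / α = 1 / (2 * α) + 1 / (2 * α) := by field_simp; norm_num
  rw [h8] at h6
  linarith

theorem IsProjGradDescent.clusterPt (hB : Convex ℝ B) (hBc : IsCompact B)
    (hF : QuadUpperBound F B L) (hβ₀ : β₀ ∈ B) {α : ℝ} (hα : 0 < α) (hαL : α * (2 * L) ≤ 1)
    {x : ℕ → EuclideanSpace ℝ (Fin p)} (hx : IsProjGradDescent F B β₀ α x)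
    {y : EuclideanSpace ℝ (Fin p)} (hy : MapClusterPt y atTop x) :
    y ∈ B ∧ F y ≤ F β₀ ∧ ∀ b ∈ B, 0 ≤ inner ℝ (gradient F y) (b - y) := by
  have hstep := hx.step_le hB hF hβ₀ hα hαL
  have hanti : Antitone fun k => F (x k) := antitone_nat_of_succ_le fun k => by
    have := hstep k
    have : 0 ≤ 1 / (2 * α) * ‖x (k + 1) - x k‖ ^ 2 := by positivity
    linarith
  obtain ⟨m, hm⟩ := (hBc.image hF.diff.continuous).bddBelow
  have hbdd : BddBelow (Set.range fun k => F (x k)) :=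
    ⟨m, by rintro _ ⟨k, rfl⟩; exact hm ⟨x k, hx.mem hβ₀ k, rfl⟩⟩
  have hlim := tendsto_atTop_ciInf hanti hbdd
  have hdiff : Tendsto (fun k => x (k + 1) - x k) atTop (𝓝 0) := by
    have h1 : Tendsto (fun k => 2 * α * (F (x k) - F (x (k + 1)))) atTop (𝓝 0) := by
      have := (hlim.sub (hlim.comp (tendsto_add_atTop_nat 1))).const_mul (2 * α)
      simpa using this
    have h2 : Tendsto (fun k => ‖x (k + 1) - x k‖ ^ 2) atTop (𝓝 0) := by
      refine squeeze_zero (fun _ => by positivity) (fun k => ?_) h1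
      have := hstep k
      have h3 : 1 / (2 * α) * ‖x (k + 1) - x k‖ ^ 2 ≤ F (x k) - F (x (k + 1)) := by linarith
      calc ‖x (k + 1) - x k‖ ^ 2 = 2 * α * (1 / (2 * α) * ‖x (k + 1) - x k‖ ^ 2) := by
            field_simp
        _ ≤ _ := by gcongr
    have h3 := (Real.continuous_sqrt.tendsto 0).comp h2
    rw [tendsto_zero_iff_norm_tendsto_zero]
    simpa [Function.comp_def, Real.sqrt_sq] using h3
  obtain ⟨φ, hφ, hφy⟩ := hy.tendsto_subseq
  have hφ' : Tendsto (fun k => x (φ k + 1)) atTop (𝓝 y) := by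
    have := hφy.add (hdiff.comp hφ.tendsto_atTop)
    simpa [Function.comp_def] using this
  refine ⟨hBc.isClosed.mem_of_tendsto hφy (Eventually.of_forall fun k => hx.mem hβ₀ _), ?_, ?_⟩
  · refine le_of_tendsto ((hF.diff.continuous.tendsto y).comp hφy) (Eventually.of_forall fun k => ?_)
    have := hanti (Nat.zero_le (φ k))
    simpa [hx.1] using this
  · intro b hb
    have h1 : Tendsto (fun k => inner ℝ (x (φ k) - α • gradient F (x (φ k)) - x (φ k + 1))
        (b - x (φ k + 1))) atTop (𝓝 (inner ℝ (y - α • gradient F y - y) (b - y))) := by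
      refine Tendsto.inner ?_ (tendsto_const_nhds.sub hφ')
      exact (hφy.sub (((hF.cont.tendsto y).comp hφy).const_smul α)).sub hφ'
    have h2 := le_of_tendsto h1
      (Eventually.of_forall fun k => (hx.2 (φ k)).inner_le_zero hB hb)
    have h3 : y - α • gradient F y - y = -(α • gradient F y) := by abel
    rw [h3, inner_neg_left, real_inner_smul_left] at h2
    by_contra hcon
    push Not at hcon
    have := mul_neg_of_pos_of_neg hα hcon
    linarith

theorem QuadUpperBound.exists_lipschitz (hBc : IsCompact B) (hF : QuadUpperBound F B L)
    (hL : 0 ≤ L) : ∃ G K : ℝ, 0 ≤ G ∧ 0 ≤ K ∧ (∀ x ∈ B, ‖gradient F x‖ ≤ G) ∧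
      ∀ x ∈ B, ∀ y ∈ B, |F y - F x| ≤ K * ‖y - x‖ := by
  obtain ⟨G, hG⟩ := hBc.exists_bound_of_continuousOn hF.cont.continuousOn
  obtain ⟨D, hD⟩ := hBc.isBounded.subset_closedBall 0
  have hb : ∀ x ∈ B, ‖x‖ ≤ G ⊔ D ⊔ 0 := fun x hx => by
    have : ‖x‖ ≤ D := by simpa using hD hx
    simp [this]
  refine ⟨G ⊔ 0, (G ⊔ 0) + L * (2 * (G ⊔ D ⊔ 0)), le_max_right _ _, ?_,
    fun x hx => (hG x hx).trans (le_max_left _ _), ?_⟩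
  · have : (0 : ℝ) ≤ G ⊔ D ⊔ 0 := le_max_right _ _
    have : (0 : ℝ) ≤ G ⊔ 0 := le_max_right _ _
    positivity
  · have key : ∀ x ∈ B, ∀ y ∈ B,
        F y - F x ≤ ((G ⊔ 0) + L * (2 * (G ⊔ D ⊔ 0))) * ‖y - x‖ := by
      intro x hx y hy
      have h1 := hF.upper x hx y hy
      have h2 : inner ℝ (gradient F x) (y - x) ≤ (G ⊔ 0) * ‖y - x‖ :=
        (real_inner_le_norm _ _).trans (by
          gcongr; exact (hG x hx).trans (le_max_left _ _))
      have h3 : ‖y - x‖ ≤ 2 * (G ⊔ D ⊔ 0) := (norm_sub_le _ _).trans (by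
        have := hb x hx; have := hb y hy; linarith)
      have h4 : L * ‖y - x‖ ^ 2 ≤ L * (2 * (G ⊔ D ⊔ 0)) * ‖y - x‖ := by
        rw [sq, mul_assoc]; gcongr
      linarith
    intro x hx y hy
    rw [abs_le]
    refine ⟨?_, key x hx y hy⟩
    have := key y hy x hx
    rw [norm_sub_rev] at this
    linarith

/-- Along the projected gradient flow, the velocity `v` is almost everywhere the derivative of the
trajectory, and it is orthogonal to the normal vector: the trajectory stays in `B` on both sides of
an interior time, so a normal vector can have neither sign against the velocity. -/
theorem ae_velocity_of_flow {x v : ℝ → EuclideanSpace ℝ (Fin p)}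
    (hv : ∀ t, 0 ≤ t → IntervalIntegrable v volume 0 t ∧
      x t = β₀ + ∫ s in (0 : ℝ)..t, v s ∧
      ∃ ν ∈ normalCone B (x t), v t = -gradient F (x t) - ν) :
    ∀ᵐ t, 0 < t → HasDerivAt x (v t) t ∧ ‖v t‖ ^ 2 = -inner ℝ (gradient F (x t)) (v t) := by
  have h1 : ∀ n : ℕ, ∀ᵐ t, t ∈ Set.Ioo (0 : ℝ) n → HasDerivAt x (v t) t := by
    intro n
    filter_upwards [(hv n (Nat.cast_nonneg n)).1.ae_hasDerivAt_integral] with t ht htn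
    have h2 := ht (by rw [Set.uIcc_of_le (Nat.cast_nonneg n)]; exact Set.Ioo_subset_Icc_self htn)
      0 Set.left_mem_uIcc
    have h3 : HasDerivAt (fun t => β₀ + ∫ s in (0 : ℝ)..t, v s) (v t) t := h2.const_add β₀
    refine h3.congr_of_eventuallyEq ?_
    filter_upwards [lt_mem_nhds htn.1] with s hs using (hv s hs.le).2.1
  filter_upwards [ae_all_iff.2 h1] with t ht ht0
  obtain ⟨n, hn⟩ := exists_nat_gt t
  have hd := ht n ⟨ht0, hn⟩
  refine ⟨hd, ?_⟩
  obtain ⟨ν, hν, hvt⟩ := (hv t ht0.le).2.2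
  have hmax : IsLocalMax (fun s => inner ℝ ν (x s)) t := by
    filter_upwards [lt_mem_nhds ht0] with s hs
    obtain ⟨ν', hν', -⟩ := (hv s hs.le).2.2
    have := hν.2 _ hν'.1
    rw [inner_sub_right] at this
    linarith
  have horth : inner ℝ ν (v t) = 0 := by
    have h4 : HasDerivAt (fun s => inner ℝ ν (x s)) (inner ℝ ν (v t)) t := by
      simpa using (hasDerivAt_const t ν).inner ℝ hd
    exact hmax.hasDerivAt_eq_zero h4
  have h5 : inner ℝ (v t) (v t) = inner ℝ (-gradient F (x t) - ν) (v t) := by rw [← hvt]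
  rw [real_inner_self_eq_norm_sq, inner_sub_left, inner_neg_left, horth] at h5
  linarith

theorem AbsolutelyContinuousOnInterval.of_dist_le {X Y : Type*} [PseudoMetricSpace X]
    [PseudoMetricSpace Y] {g : ℝ → X} {f : ℝ → Y} {a b K : ℝ} (hK : 0 ≤ K)
    (hg : AbsolutelyContinuousOnInterval g a b)
    (h : ∀ r ∈ Set.uIcc a b, ∀ s ∈ Set.uIcc a b, dist (f r) (f s) ≤ K * dist (g r) (g s)) :
    AbsolutelyContinuousOnInterval f a b := by
  rw [absolutelyContinuousOnInterval_iff] at hg ⊢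
  intro ε hε
  obtain ⟨δ, hδ, hE⟩ := hg (ε / (K + 1)) (by positivity)
  refine ⟨δ, hδ, fun E hE' hEδ => ?_⟩
  have h1 := hE E hE' hEδ
  rw [lt_div_iff₀ (by positivity)] at h1
  refine lt_of_le_of_lt ?_ h1
  rw [Finset.sum_mul]
  refine Finset.sum_le_sum fun i hi => ?_
  have hmem := hE'.1 i hi
  refine (h _ hmem.1 _ hmem.2).trans ?_
  rw [mul_comm]
  gcongr
  linarith

theorem flow_absolutelyContinuous (hBc : IsCompact B) (hF : QuadUpperBound F B L) (hL : 0 ≤ L)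
    {x v : ℝ → EuclideanSpace ℝ (Fin p)}
    (hv : ∀ t, 0 ≤ t → IntervalIntegrable v volume 0 t ∧
      x t = β₀ + ∫ s in (0 : ℝ)..t, v s ∧
      ∃ ν ∈ normalCone B (x t), v t = -gradient F (x t) - ν) {t : ℝ} (ht : 0 ≤ t) :
    AbsolutelyContinuousOnInterval (fun r => F (x r)) 0 t := by
  obtain ⟨G, K, -, hK, -, hlip⟩ := hF.exists_lipschitz hBc hL
  have hxB : ∀ r, 0 ≤ r → x r ∈ B := fun r hr => by
    obtain ⟨ν, hν, -⟩ := (hv r hr).2.2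
    exact hν.1
  refine ((hv t ht).1.norm.absolutelyContinuousOnInterval_intervalIntegral
    Set.left_mem_uIcc).of_dist_le hK fun r hr s hs => ?_
  rw [Set.uIcc_of_le ht] at hr hs
  have h2 := hlip _ (hxB _ hs.1) _ (hxB _ hr.1)
  rw [Real.dist_eq, dist_eq_norm]
  have h3 : x r - x s = ∫ u in s..r, v u := by
    rw [(hv r hr.1).2.1, (hv s hs.1).2.1, add_sub_add_left_eq_sub,
      intervalIntegral.integral_interval_sub_left (hv r hr.1).1 (hv s hs.1).1]
  rw [Real.norm_eq_abs,
    intervalIntegral.integral_interval_sub_left (hv r hr.1).1.norm (hv s hs.1).1.norm]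
  refine h2.trans ?_
  rw [h3]
  gcongr
  exact intervalIntegral.norm_integral_le_abs_integral_norm

/-- Energy dissipation along the projected gradient flow. -/
theorem flow_energy (hBc : IsCompact B) (hF : QuadUpperBound F B L) (hL : 0 ≤ L)
    {x v : ℝ → EuclideanSpace ℝ (Fin p)}
    (hv : ∀ t, 0 ≤ t → IntervalIntegrable v volume 0 t ∧
      x t = β₀ + ∫ s in (0 : ℝ)..t, v s ∧
      ∃ ν ∈ normalCone B (x t), v t = -gradient F (x t) - ν) {s t : ℝ} (hs : 0 ≤ s)
    (hst : s ≤ t) :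
    IntervalIntegrable (fun r => ‖v r‖ ^ 2) volume s t ∧
      F (x t) - F (x s) = -∫ r in s..t, ‖v r‖ ^ 2 := by
  have hac := flow_absolutelyContinuous hBc hF hL hv (hs.trans hst)
  have hac' := hac.mono (c := s) (d := t) (by
    rw [Set.uIcc_of_le hst, Set.uIcc_of_le (hs.trans hst)]
    exact Set.Icc_subset_Icc_left hs)
  have hder : ∀ᵐ r, 0 < r → deriv (fun r => F (x r)) r = -‖v r‖ ^ 2 := by
    filter_upwards [ae_velocity_of_flow hv] with r hr hr0
    obtain ⟨h1, h2⟩ := hr hr0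
    have h3 := (hF.diff (x r)).hasGradientAt.hasFDerivAt.comp_hasDerivAt r h1
    have h4 : deriv (fun r => F (x r)) r = inner ℝ (gradient F (x r)) (v r) := by
      simpa [Function.comp_def] using h3.deriv
    rw [h4, h2]; ring
  have hder' : ∀ᵐ r, r ∈ Set.uIoc s t → deriv (fun r => F (x r)) r = -‖v r‖ ^ 2 := by
    filter_upwards [hder] with r hr hrs
    rw [Set.uIoc_of_le hst] at hrs
    exact hr (hs.trans_lt hrs.1)
  have hint : IntervalIntegrable (fun r => -‖v r‖ ^ 2) volume s t :=
    hac'.intervalIntegrable_deriv.congr_ae (by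
      rw [EventuallyEq, ae_restrict_iff' measurableSet_uIoc]; exact hder')
  refine ⟨by simpa [Pi.neg_def] using hint.neg, ?_⟩
  rw [← intervalIntegral.integral_neg, ← hac'.integral_deriv_eq_sub]
  exact intervalIntegral.integral_congr_ae hder'

theorem IsProjGradFlow.clusterPt (hBc : IsCompact B) (hF : QuadUpperBound F B L) (hL : 0 ≤ L)
    {x : ℝ → EuclideanSpace ℝ (Fin p)} (hx : IsProjGradFlow F B β₀ x)
    {y : EuclideanSpace ℝ (Fin p)} (hy : MapClusterPt y atTop x) :
    y ∈ B ∧ F y ≤ F β₀ ∧ ∀ b ∈ B, 0 ≤ inner ℝ (gradient F y) (b - y) := by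
  obtain ⟨v, -, hv⟩ := hx
  obtain ⟨G, K, hG0, hK, hG, hlip⟩ := hF.exists_lipschitz hBc hL
  have hx0 : x 0 = β₀ := by simpa using (hv 0 le_rfl).2.1
  have hxB : ∀ r, 0 ≤ r → x r ∈ B := fun r hr => by
    obtain ⟨ν, hν, -⟩ := (hv r hr).2.2
    exact hν.1
  have hanti : ∀ s t, 0 ≤ s → s ≤ t → F (x t) ≤ F (x s) := fun s t hs hst => by
    have h1 := (flow_energy hBc hF hL hv hs hst).2
    have h2 : 0 ≤ ∫ r in s..t, ‖v r‖ ^ 2 :=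
      intervalIntegral.integral_nonneg hst fun _ _ => by positivity
    linarith
  have hmem : ∀ {C : Set (EuclideanSpace ℝ (Fin p))}, IsClosed C → (∀ r, 0 ≤ r → x r ∈ C) →
      y ∈ C := fun {C} hC h => by
    exact hC.mem_of_mapClusterPt hy ((eventually_ge_atTop 0).mono h)
  have hyB : y ∈ B := hmem hBc.isClosed hxB
  refine ⟨hyB, ?_, ?_⟩
  · refine hmem (C := {z | F z ≤ F β₀}) (isClosed_le hF.diff.continuous continuous_const) ?_
    intro r hr
    simpa [hx0] using hanti 0 r le_rfl hr
  intro b hb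
  by_contra hcon
  push Not at hcon
  obtain ⟨η, hη, hηlt⟩ : ∃ η > 0, inner ℝ (gradient F y) (b - y) < -η :=
    ⟨-inner ℝ (gradient F y) (b - y) / 2, by linarith, by linarith⟩
  have hcont : Continuous fun z => inner ℝ (gradient F z) (b - z) :=
    hF.cont.inner (continuous_const.sub continuous_id)
  obtain ⟨r, hr, hball⟩ := Metric.eventually_nhds_iff.1
    (hcont.continuousAt.eventually_lt continuousAt_const hηlt)
  obtain ⟨D, hD⟩ := hBc.isBounded.subset_closedBall b
  have hD0 : 0 ≤ D := by
    have := hD hb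
    simpa using this
  -- time during which a trajectory of speed at most `G` stays within `r / 2`
  set τ : ℝ := r / (2 * (G + 1)) with hτ
  have hτ0 : 0 < τ := by positivity
  set κ : ℝ := (η / (D + 1)) ^ 2 with hκ
  have hκ0 : 0 < κ := by positivity
  have hlim : ∃ m, Tendsto (fun t : ℝ => F (x (max t 0))) atTop (𝓝 m) := by
    have h1 : Antitone fun t : ℝ => F (x (max t 0)) := fun s t hst =>
      hanti _ _ (le_max_right _ _) (max_le_max_right 0 hst)
    obtain ⟨m, hm⟩ := (hBc.image hF.diff.continuous).bddBelow
    exact ⟨_, tendsto_atTop_ciInf h1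
      ⟨m, by rintro _ ⟨k, rfl⟩; exact hm ⟨_, hxB _ (le_max_right _ _), rfl⟩⟩⟩
  obtain ⟨m, hm⟩ := hlim
  have hdec : Tendsto (fun t : ℝ => F (x (max t 0)) - F (x (max (t + τ) 0))) atTop (𝓝 0) := by
    simpa using hm.sub (hm.comp (tendsto_atTop_add_const_right _ τ tendsto_id))
  have hfreq : ∃ᶠ t in atTop, x t ∈ Metric.ball y (r / 2) :=
    hy.frequently (Metric.ball_mem_nhds y (by positivity))
  obtain ⟨t, hty, htdec, ht0⟩ := (hfreq.and_eventually
    ((hdec.eventually_lt_const (show 0 < τ * κ by positivity)).and (eventually_ge_atTop 0))).exists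
  rw [max_eq_left ht0, max_eq_left (by linarith)] at htdec
  have hvG : ∀ᵐ s, 0 < s → ‖v s‖ ≤ G := by
    filter_upwards [ae_velocity_of_flow hv] with s hs hs0
    obtain ⟨-, h2⟩ := hs hs0
    have h3 : -inner ℝ (gradient F (x s)) (v s) ≤ G * ‖v s‖ := by
      rw [← inner_neg_left]
      refine (real_inner_le_norm _ _).trans ?_
      rw [norm_neg]
      gcongr
      exact hG _ (hxB s hs0.le)
    rw [← h2, sq] at h3
    by_contra hlt
    push Not at hlt
    have : 0 < ‖v s‖ := hG0.trans_lt hlt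
    exact absurd h3 (not_le.2 (by gcongr))
  have hnear : ∀ s ∈ Set.Icc t (t + τ), x s ∈ Metric.ball y r := by
    intro s hs
    have h1 : x s - x t = ∫ u in t..s, v u := by
      rw [(hv s (ht0.trans hs.1)).2.1, (hv t ht0).2.1, add_sub_add_left_eq_sub,
        intervalIntegral.integral_interval_sub_left (hv s (ht0.trans hs.1)).1 (hv t ht0).1]
    have h2 : ‖x s - x t‖ ≤ G * |s - t| := by
      rw [h1]
      refine intervalIntegral.norm_integral_le_of_norm_le_const_ae ?_
      filter_upwards [hvG] with u hu hut
      rw [Set.uIoc_of_le hs.1] at hut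
      exact hu (ht0.trans_lt hut.1)
    have h3 : G * |s - t| ≤ r / 2 := by
      rw [abs_of_nonneg (by linarith [hs.1])]
      calc G * (s - t) ≤ (G + 1) * τ := by
            have := hs.2
            have := hs.1
            gcongr <;> linarith
        _ = r / 2 := by rw [hτ]; field_simp
    rw [Metric.mem_ball] at hty ⊢
    calc dist (x s) y ≤ dist (x s) (x t) + dist (x t) y := dist_triangle _ _ _
      _ < r / 2 + r / 2 := by rw [dist_eq_norm (x s)]; linarith
      _ = r := by ring
  have hspeed : ∀ s ∈ Set.Icc t (t + τ), κ ≤ ‖v s‖ ^ 2 := by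
    intro s hs
    have hs0 : 0 ≤ s := ht0.trans hs.1
    obtain ⟨ν, hν, hvs⟩ := (hv s hs0).2.2
    have h1 : η ≤ inner ℝ (v s) (b - x s) := by
      rw [hvs, inner_sub_left, inner_neg_left]
      have := hball (hnear s hs)
      have := hν.2 b hb
      linarith
    have h2 : inner ℝ (v s) (b - x s) ≤ ‖v s‖ * (D + 1) := by
      refine (real_inner_le_norm _ _).trans ?_
      gcongr
      have := hD (hxB s hs0)
      rw [Metric.mem_closedBall, dist_comm, dist_eq_norm] at this
      linarith
    have h3 : η / (D + 1) ≤ ‖v s‖ := by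
      rw [div_le_iff₀ (by positivity)]; linarith
    rw [hκ]
    gcongr
  obtain ⟨hi, he⟩ := flow_energy hBc hF hL hv ht0 (show t ≤ t + τ by linarith)
  have h1 : ∫ _ in t..(t + τ), κ ≤ ∫ s in t..(t + τ), ‖v s‖ ^ 2 :=
    intervalIntegral.integral_mono_on (by linarith) intervalIntegrable_const hi hspeed
  rw [intervalIntegral.integral_const, smul_eq_mul] at h1
  have h2 : t + τ - t = τ := by ring
  rw [h2] at h1
  linarith

/-- Every point found by projected gradient descent is a stationary point, at which the objective
is at most its value at the initializer. -/
theorem IsFoundPoint.stationary (hB : Convex ℝ B) (hBc : IsCompact B)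
    (hF : QuadUpperBound F B L) (hL : 0 ≤ L) (hβ₀ : β₀ ∈ B) {α₀ : ℝ} (hα₀ : α₀ * (2 * L) ≤ 1)
    {y : EuclideanSpace ℝ (Fin p)} (hy : IsFoundPoint F B β₀ α₀ y) :
    y ∈ B ∧ F y ≤ F β₀ ∧ ∀ b ∈ B, 0 ≤ inner ℝ (gradient F y) (b - y) := by
  rcases hy with ⟨α, x, hα, hαα, hx, hxy⟩ | ⟨x, hx, hxy⟩
  · refine hx.clusterPt hB hBc hF hβ₀ hα (le_trans ?_ hα₀) hxy
    gcongr
  · exact hx.clusterPt hBc hF hL hxy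

theorem convex_feasibleBox (p : ℕ) (M : ℝ) : Convex ℝ (feasibleBox p M) := by
  intro x hx y hy a b ha hb hab i
  have h1 : (a • x + b • y) i = a * x i + b * y i := by simp
  rw [h1]
  have := hx i
  have := hy i
  constructor
  · have := mul_nonneg ha (hx i).1
    have := mul_nonneg hb (hy i).1
    linarith
  · calc a * x i + b * y i ≤ a * M + b * M := by
          gcongr
          · exact (hx i).2
          · exact (hy i).2
      _ = M := by rw [← add_mul, hab, one_mul]

theorem isCompact_feasibleBox (p : ℕ) (M : ℝ) : IsCompact (feasibleBox p M) := by
  have h : feasibleBox p M =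
      (EuclideanSpace.equiv (Fin p) ℝ) ⁻¹' (Set.Icc (fun _ => 0) (fun _ => M)) := by
    ext x
    simp [feasibleBox, Set.mem_Icc, Pi.le_def, forall_and]
  rw [h]
  exact (EuclideanSpace.equiv (Fin p) ℝ).toHomeomorph.isCompact_preimage.2 isCompact_Icc

/-- At a stationary point of the box, a coordinate with positive partial derivative vanishes. -/
theorem eq_zero_of_stationary {M : ℝ} {g y : EuclideanSpace ℝ (Fin p)}
    (hy : y ∈ feasibleBox p M) (hst : ∀ b ∈ feasibleBox p M, 0 ≤ inner ℝ g (b - y))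
    {l : Fin p} (hl : 0 < g l) : y l = 0 := by
  have hyl := hy l
  have hM : 0 ≤ M := hyl.1.trans hyl.2
  have hb : y - EuclideanSpace.single l (y l) ∈ feasibleBox p M := by
    intro i
    by_cases hi : i = l
    · subst hi; simpa using hM
    · simpa [hi] using hy i
  have h := hst _ hb
  have h2 : y - EuclideanSpace.single l (y l) - y = -EuclideanSpace.single l (y l) := by abel
  rw [h2, inner_neg_right, EuclideanSpace.inner_single_right] at h
  have h3 : y l * g l ≤ 0 := by simpa using h
  by_contra hne
  have : 0 < y l := lt_of_le_of_ne hyl.1 (Ne.symm hne)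
  have := mul_pos this hl
  linarith

end Descent

/-! ### Concentration of averages of empirical deviations -/

/-- The deviation `n⁻¹ ∑ i, g (D i) - E_Q g` of the empirical mean of `g` from its expectation. -/
noncomputable def meanDev {Z : Type*} [MeasurableSpace Z] {n : ℕ} (Q : Measure Z) (D : Fin n → Z)
    (g : Z → ℝ) : ℝ :=
  (∑ i, g (D i)) / n - ∫ z, g z ∂Q

section Concentration

variable {Z Θ : Type*} [MeasurableSpace Z] [MeasurableSpace Θ] {n : ℕ}

theorem hasSubgaussianMGF_sum_sub_integral (Q : Measure Z) [IsProbabilityMeasure Q] {g : Z → ℝ}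
    (hg : Measurable g) (hg1 : ∀ z, |g z| ≤ 1) :
    HasSubgaussianMGF (fun D : Fin n → Z => ∑ i, (g (D i) - ∫ z, g z ∂Q)) n
      (Measure.pi fun _ => Q) := by
  have h1 : HasSubgaussianMGF (fun z => g z - ∫ z, g z ∂Q) 1 Q := by
    have h := hasSubgaussianMGF_of_mem_Icc (μ := Q) (X := g) (a := -1) (b := 1) hg.aemeasurable
      (Eventually.of_forall fun z => abs_le.1 (hg1 z))
    have h2 : (‖(1 : ℝ) - -1‖₊ / 2) ^ 2 = 1 := by
      have : ‖(1 : ℝ) - -1‖₊ = 2 := by ext; norm_num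
      rw [this]; norm_num
    rwa [h2] at h
  have h2 : ∀ i ∈ (Finset.univ : Finset (Fin n)), HasSubgaussianMGF
      (fun D : Fin n → Z => g (D i) - ∫ z, g z ∂Q) 1 (Measure.pi fun _ => Q) := fun i _ => by
    refine HasSubgaussianMGF.of_map (Y := fun D : Fin n → Z => D i)
      (X := fun z => g z - ∫ z, g z ∂Q) (measurable_pi_apply i).aemeasurable ?_
    rwa [(measurePreserving_eval (fun _ : Fin n => Q) i).map_eq]
  have h3 : iIndepFun (fun (i : Fin n) (D : Fin n → Z) => g (D i) - ∫ z, g z ∂Q)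
      (Measure.pi fun _ => Q) :=
    iIndepFun_pi (X := fun _ z => g z - ∫ z, g z ∂Q)
      fun i => (hg.sub_const _).aemeasurable
  have h4 := HasSubgaussianMGF.sum_of_iIndepFun h3 h2
  simpa using h4

theorem lintegral_exp_abs_sum_le (Q : Measure Z) [IsProbabilityMeasure Q] {g : Z → ℝ}
    (hg : Measurable g) (hg1 : ∀ z, |g z| ≤ 1) (u : ℝ) :
    ∫⁻ D : Fin n → Z, ENNReal.ofReal (Real.exp (u * |∑ i, (g (D i) - ∫ z, g z ∂Q)|))
      ∂(Measure.pi fun _ => Q) ≤ ENNReal.ofReal (2 * Real.exp (n * u ^ 2 / 2)) := by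
  have h := hasSubgaussianMGF_sum_sub_integral (n := n) Q hg hg1
  set N : (Fin n → Z) → ℝ := fun D => ∑ i, (g (D i) - ∫ z, g z ∂Q)
  have h1 : ∀ D, Real.exp (u * |N D|) ≤ Real.exp (u * N D) + Real.exp (-u * N D) := fun D => by
    rcases abs_cases (N D) with ⟨h, -⟩ | ⟨h, -⟩ <;> rw [h]
    · have := Real.exp_pos (-u * N D); linarith
    · have := Real.exp_pos (u * N D)
      rw [show u * -N D = -u * N D by ring]; linarith
  calc _ ≤ ∫⁻ D, ENNReal.ofReal (Real.exp (u * N D) + Real.exp (-u * N D))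
        ∂(Measure.pi fun _ => Q) := by gcongr with D; exact h1 D
    _ = ENNReal.ofReal (∫ D, (Real.exp (u * N D) + Real.exp (-u * N D))
        ∂(Measure.pi fun _ => Q)) := by
      refine (ofReal_integral_eq_lintegral_ofReal
        ((h.integrable_exp_mul u).add (h.integrable_exp_mul (-u)))
        (Eventually.of_forall fun _ => ?_)).symm
      simp only [Pi.zero_apply, Pi.add_apply]
      positivity
    _ ≤ _ := by
      gcongr
      rw [integral_add (h.integrable_exp_mul u) (h.integrable_exp_mul (-u)), two_mul]
      have h2 := h.mgf_le u
      have h3 := h.mgf_le (-u)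
      rw [neg_sq] at h3
      rw [mgf] at h2 h3
      exact add_le_add (by simpa using h2) (by simpa using h3)

/-- An average over `θ` of absolute deviations `|n⁻¹ ∑ i, f_θ (D i) - E f_θ|` has the sub-Gaussian
tail of a single one of them: by convexity of the exponential, its exponential moments are at most
the average of theirs. -/
theorem measure_le_integral_abs_meanDev (Q : Measure Z) [IsProbabilityMeasure Q]
    (ν : Measure Θ) [IsProbabilityMeasure ν] {f : Θ → Z → ℝ}
    (hf : Measurable (Function.uncurry f)) (hf1 : ∀ θ z, |f θ z| ≤ 1) (hn : 1 ≤ n) {s : ℝ}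
    (hs : 0 ≤ s) :
    (Measure.pi fun _ : Fin n => Q) {D | s ≤ ∫ θ, |meanDev Q D (f θ)| ∂ν} ≤
      ENNReal.ofReal (2 * Real.exp (-(n * s ^ 2 / 2))) := by
  have hn0 : (0 : ℝ) < n := by exact_mod_cast hn
  have hint : Measurable fun θ => ∫ z, f θ z ∂Q :=
    (hf.stronglyMeasurable.integral_prod_right (ν := Q)).measurable
  set N : Θ → (Fin n → Z) → ℝ := fun θ D => ∑ i, (f θ (D i) - ∫ z, f θ z ∂Q) with hN
  have hNdev : ∀ θ D, |N θ D| = n * |meanDev Q D (f θ)| := fun θ D => by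
    have : N θ D = n * meanDev Q D (f θ) := by
      simp only [hN, meanDev, Finset.sum_sub_distrib, Finset.sum_const, Finset.card_univ,
        Fintype.card_fin, nsmul_eq_mul]
      field_simp
    rw [this, abs_mul, abs_of_pos hn0]
  have hNmeas : Measurable fun q : (Fin n → Z) × Θ => N q.2 q.1 := by
    refine Finset.measurable_sum _ fun i _ => Measurable.sub ?_ (hint.comp measurable_snd)
    exact hf.comp (measurable_snd.prodMk ((measurable_pi_apply i).comp measurable_fst))
  have hNb : ∀ θ D, |N θ D| ≤ n * 2 := fun θ D => by
    refine (Finset.abs_sum_le_sum_abs _ _).trans ?_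
    refine (Finset.sum_le_sum (g := fun _ => (2 : ℝ)) fun i _ => ?_).trans (by simp)
    have h1 : |∫ z, f θ z ∂Q| ≤ 1 := by
      simpa using norm_integral_le_of_norm_le_const (μ := Q) (f := f θ) (C := 1)
        (Eventually.of_forall fun z => by simpa using hf1 θ z)
    calc |f θ (D i) - ∫ z, f θ z ∂Q| ≤ |f θ (D i)| + |∫ z, f θ z ∂Q| := abs_sub _ _
      _ ≤ 2 := by linarith [hf1 θ (D i)]
  -- Jensen's inequality for the exponential
  have hjensen : ∀ D : Fin n → Z,
      ENNReal.ofReal (Real.exp (s * (n * ∫ θ, |meanDev Q D (f θ)| ∂ν))) ≤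
        ∫⁻ θ, ENNReal.ofReal (Real.exp (s * |N θ D|)) ∂ν := fun D => by
    have hm : Measurable fun θ => N θ D := hNmeas.comp measurable_prodMk_left
    have hi : Integrable (fun θ => s * |N θ D|) ν := by
      refine Integrable.const_mul (Integrable.of_bound (by fun_prop) (n * 2 : ℝ)
        (Eventually.of_forall fun θ => ?_)) s
      simpa using hNb θ D
    have hie : Integrable (fun θ => Real.exp (s * |N θ D|)) ν := by
      refine Integrable.of_bound (by fun_prop) (Real.exp (s * (n * 2)))
        (Eventually.of_forall fun θ => ?_)
      rw [Real.norm_eq_abs, abs_of_pos (Real.exp_pos _)]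
      gcongr
      exact hNb θ D
    rw [← ofReal_integral_eq_lintegral_ofReal hie (Eventually.of_forall fun _ => by positivity)]
    gcongr
    have h1 := convexOn_exp.map_integral_le (μ := ν) Real.continuous_exp.continuousOn isClosed_univ
      (Eventually.of_forall fun θ => Set.mem_univ (s * |N θ D|)) hi hie
    refine le_of_eq_of_le ?_ h1
    simp_rw [hNdev]
    rw [integral_const_mul, integral_const_mul]
  have hexp : Measurable fun q : (Fin n → Z) × Θ =>
      ENNReal.ofReal (Real.exp (s * |N q.2 q.1|)) :=
    ENNReal.measurable_ofReal.comp (Real.measurable_exp.comp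
      (measurable_const.mul hNmeas.abs))
  have hmeas : Measurable fun D : Fin n → Z =>
      ∫⁻ θ, ENNReal.ofReal (Real.exp (s * |N θ D|)) ∂ν := hexp.lintegral_prod_right'
  have htotal : ∫⁻ D : Fin n → Z, ∫⁻ θ, ENNReal.ofReal (Real.exp (s * |N θ D|)) ∂ν
      ∂(Measure.pi fun _ => Q) ≤ ENNReal.ofReal (2 * Real.exp (n * s ^ 2 / 2)) := by
    rw [lintegral_lintegral_swap hexp.aemeasurable]
    calc _ ≤ ∫⁻ _, ENNReal.ofReal (2 * Real.exp (n * s ^ 2 / 2)) ∂ν := by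
          gcongr with θ
          exact lintegral_exp_abs_sum_le Q (hf.comp measurable_prodMk_left) (hf1 θ) s
      _ = _ := by simp
  have hsub : {D : Fin n → Z | s ≤ ∫ θ, |meanDev Q D (f θ)| ∂ν} ⊆
      {D | ENNReal.ofReal (Real.exp (s * (n * s))) ≤
        ∫⁻ θ, ENNReal.ofReal (Real.exp (s * |N θ D|)) ∂ν} := fun D hD => by
    refine le_trans ?_ (hjensen D)
    have : s ≤ ∫ θ, |meanDev Q D (f θ)| ∂ν := hD
    gcongr
  refine (measure_mono hsub).trans ?_
  have hmarkov := mul_meas_ge_le_lintegral (μ := Measure.pi fun _ : Fin n => Q) hmeas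
    (ENNReal.ofReal (Real.exp (s * (n * s))))
  have h0 : ENNReal.ofReal (Real.exp (s * (n * s))) ≠ 0 := by
    simp [Real.exp_pos]
  have h1 := (ENNReal.le_div_iff_mul_le (Or.inl h0) (Or.inl ENNReal.ofReal_ne_top)).2
    ((mul_comm _ _).trans_le (hmarkov.trans htotal))
  refine h1.trans (le_of_eq ?_)
  rw [← ENNReal.ofReal_div_of_pos (Real.exp_pos _), mul_div_assoc, ← Real.exp_sub]
  congr 3
  ring

end Concentration

/-! ### Product functions as mixtures of orthant indicators -/

/-- The uniform distribution on `[-R - 1, R]^p`. -/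
noncomputable def uniformBox (p : ℕ) (R : ℝ) : Measure (Fin p → ℝ) :=
  Measure.pi fun _ => cond volume (Set.Icc (-R - 1) R)

/-- `1` if `r ≤ s`, else `0`. -/
noncomputable def stepFun (r s : ℝ) : ℝ := if r ≤ s then 1 else 0

/-- On the cube `[-R, R]^p` the function `g` is a mixture of indicators of orthants
`{x | r ≤ x}` with respect to `uniformBox p R`, with weights bounded by `K`. -/
def IsOrthantMixture {p : ℕ} (R K : ℝ) (g : (Fin p → ℝ) → ℝ) : Prop :=
  ∃ v : (Fin p → ℝ) → ℝ, Measurable v ∧ (∀ r, |v r| ≤ K) ∧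
    ∀ x : Fin p → ℝ, (∀ i, |x i| ≤ R) → g x = ∫ r, v r * ∏ i, stepFun (r i) (x i) ∂uniformBox p R

theorem isProbabilityMeasure_cond_Icc {R : ℝ} (hR : 0 ≤ R) :
    IsProbabilityMeasure (cond (volume : Measure ℝ) (Set.Icc (-R - 1) R)) :=
  cond_isProbabilityMeasure_of_finite (by simp; linarith) (by simp)

theorem isProbabilityMeasure_uniformBox (p : ℕ) {R : ℝ} (hR : 0 ≤ R) :
    IsProbabilityMeasure (uniformBox p R) := by
  have := isProbabilityMeasure_cond_Icc hR
  unfold uniformBox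
  infer_instance

theorem measurable_stepFun : Measurable (Function.uncurry stepFun) := by
  unfold stepFun Function.uncurry
  exact Measurable.ite (measurableSet_le measurable_fst measurable_snd)
    measurable_const measurable_const

theorem stepFun_nonneg (r s : ℝ) : 0 ≤ stepFun r s := by unfold stepFun; split_ifs <;> norm_num

theorem stepFun_le_one (r s : ℝ) : stepFun r s ≤ 1 := by unfold stepFun; split_ifs <;> norm_num

theorem abs_prod_stepFun_le_one {p : ℕ} (r x : Fin p → ℝ) :
    |∏ i, stepFun (r i) (x i)| ≤ 1 := by
  rw [abs_of_nonneg (Finset.prod_nonneg fun i _ => stepFun_nonneg _ _)]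
  exact Finset.prod_le_one (fun i _ => stepFun_nonneg _ _) fun i _ => stepFun_le_one _ _

theorem measurable_prod_stepFun {p : ℕ} :
    Measurable fun w : (Fin p → ℝ) × (Fin p → ℝ) => ∏ i, stepFun (w.1 i) (w.2 i) := by
  refine Finset.measurable_prod _ fun i _ => ?_
  exact measurable_stepFun.comp (g := Function.uncurry stepFun)
    (f := fun w : (Fin p → ℝ) × (Fin p → ℝ) => (w.1 i, w.2 i))
    (((measurable_pi_apply i).comp measurable_fst).prodMk
      ((measurable_pi_apply i).comp measurable_snd))

/-- The fundamental theorem of calculus for a Lipschitz function on `[-R, R]`, with its value at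
`-R` produced by a ramp on `[-R - 1, -R]`. -/
theorem exists_stepFun_repr {R : ℝ} (hR : 0 ≤ R) {K : NNReal} {u : ℝ → ℝ}
    (hu : LipschitzOnWith K u (Set.Icc (-R) R)) (huK : |u (-R)| ≤ K) :
    ∃ v : ℝ → ℝ, Measurable v ∧ (∀ r, |v r| ≤ (2 * R + 1) * K) ∧
      ∀ s, |s| ≤ R → u s = ∫ r, v r * stepFun r s ∂(cond volume (Set.Icc (-R - 1) R)) := by
  obtain ⟨g, hg, hug⟩ := hu.extend_real
  have hgd : ∀ r, |deriv g r| ≤ K := fun r => by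
    simpa using norm_deriv_le_of_lipschitz hg (x₀ := r)
  have hw : ∀ r, |(if r < -R then u (-R) else deriv g r)| ≤ K := fun r => by
    split_ifs
    exacts [huK, hgd r]
  have hwm : Measurable fun r => if r < -R then u (-R) else deriv g r :=
    Measurable.ite measurableSet_Iio measurable_const (measurable_deriv g)
  refine ⟨fun r => (2 * R + 1) * (if r < -R then u (-R) else deriv g r),
    hwm.const_mul _, fun r => ?_, fun s hs => ?_⟩
  · rw [abs_mul, abs_of_pos (by linarith)]
    have := hw r
    gcongr
  · obtain ⟨hs1, hs2⟩ := abs_le.1 hs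
    have hwi : ∀ a b, IntervalIntegrable (fun r => if r < -R then u (-R) else deriv g r)
        volume a b := fun a b => by
      refine (intervalIntegrable_const (c := (K : ℝ))).mono_fun hwm.aestronglyMeasurable ?_
      refine Eventually.of_forall fun r => ?_
      simpa using hw r
    have h1 : ∫ r in (-R - 1)..s, (if r < -R then u (-R) else deriv g r) = u s := by
      rw [← intervalIntegral.integral_add_adjacent_intervals (hwi (-R - 1) (-R)) (hwi (-R) s)]
      have h2 : ∫ r in (-R - 1)..(-R), (if r < -R then u (-R) else deriv g r) = u (-R) := by
        rw [intervalIntegral.integral_congr_ae (g := fun _ => u (-R))]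
        · simp
        · have : ∀ᵐ r : ℝ, r ≠ -R := by simp [ae_iff, measure_singleton]
          filter_upwards [this] with r hr hrm
          rw [Set.uIoc_of_le (by linarith)] at hrm
          rw [if_pos (lt_of_le_of_ne hrm.2 hr)]
      have h3 : ∫ r in (-R)..s, (if r < -R then u (-R) else deriv g r) = u s - u (-R) := by
        rw [intervalIntegral.integral_congr (g := deriv g)]
        · rw [(hg.lipschitzOnWith.absolutelyContinuousOnInterval).integral_deriv_eq_sub,
            hug ⟨hs1, hs2⟩, hug ⟨le_rfl, by linarith⟩]
        · intro r hr
          rw [Set.uIcc_of_le hs1] at hr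
          simp only
          rw [if_neg (not_lt.2 hr.1)]
      rw [h2, h3]; ring
    have hvol : (volume (Set.Icc (-R - 1) R))⁻¹.toReal = (2 * R + 1)⁻¹ := by
      rw [Real.volume_Icc, ENNReal.toReal_inv, ENNReal.toReal_ofReal (by linarith)]
      congr 1; ring
    rw [ProbabilityTheory.cond, integral_smul_measure, hvol, smul_eq_mul]
    have h4 : ∫ r in Set.Icc (-R - 1) R,
        (2 * R + 1) * (if r < -R then u (-R) else deriv g r) * stepFun r s =
        (2 * R + 1) * u s := by
      rw [← h1, intervalIntegral.integral_of_le (by linarith), ← integral_Icc_eq_integral_Ioc,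
        ← integral_const_mul]
      have h5 : (fun r => (2 * R + 1) * (if r < -R then u (-R) else deriv g r) * stepFun r s) =
          (Set.Iic s).indicator
            (fun r => (2 * R + 1) * (if r < -R then u (-R) else deriv g r)) := by
        ext r
        simp [stepFun, Set.indicator_apply]
      rw [h5, setIntegral_indicator measurableSet_Iic]
      congr 2
      ext r
      simp only [Set.mem_inter_iff, Set.mem_Icc, Set.mem_Iic]
      constructor
      · rintro ⟨⟨h, -⟩, h'⟩; exact ⟨h, h'⟩
      · rintro ⟨h, h'⟩; exact ⟨⟨h, h'.trans hs2⟩, h'⟩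
    rw [h4, inv_mul_cancel_left₀ (by linarith)]

theorem isOrthantMixture_prod {p : ℕ} {R : ℝ} (hR : 0 ≤ R) {K : NNReal} {u : Fin p → ℝ → ℝ}
    (hu : ∀ i, LipschitzOnWith K (u i) (Set.Icc (-R) R)) (huK : ∀ i, |u i (-R)| ≤ K) :
    IsOrthantMixture R (((2 * R + 1) * K) ^ p) (fun x => ∏ i, u i (x i)) := by
  choose v hvm hvK hv using fun i => exists_stepFun_repr hR (hu i) (huK i)
  have := isProbabilityMeasure_cond_Icc hR
  refine ⟨fun r => ∏ i, v i (r i), Finset.measurable_prod _ fun i _ =>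
    (hvm i).comp (measurable_pi_apply i), fun r => ?_, fun x hx => ?_⟩
  · rw [Finset.abs_prod]
    refine (Finset.prod_le_prod (fun _ _ => abs_nonneg _) fun i _ => hvK i (r i)).trans ?_
    simp
  · simp_rw [← Finset.prod_mul_distrib]
    rw [uniformBox, integral_fintype_prod_eq_prod (f := fun i r => v i r * stepFun r (x i))]
    exact Finset.prod_congr rfl fun i _ => hv i _ (hx i)

/-! ### Uniform deviation of pair averages -/

section UniformDeviation

variable {p n : ℕ}

/-- The test function `a(z) 1{r ≤ x}` attached to the corner `r` and the weight `a`. -/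
noncomputable def orthantTest (a : DataPoint p → ℝ) (r : Fin p → ℝ) (z : DataPoint p) : ℝ :=
  a z * ∏ i, stepFun (r i) (z.1 i)

/-- The average over corners `r` of the absolute deviations of the empirical means of
`orthantTest a r`. -/
noncomputable def orthantDev (Q : Measure (DataPoint p)) (R : ℝ) (a : DataPoint p → ℝ)
    (D : Fin n → DataPoint p) : ℝ :=
  ∫ r, |meanDev Q D (orthantTest a r)| ∂uniformBox p R

theorem measurable_orthantTest {a : DataPoint p → ℝ} (ha : Measurable a) :
    Measurable (Function.uncurry (orthantTest a)) := by
  unfold orthantTest Function.uncurry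
  exact (ha.comp measurable_snd).mul (measurable_prod_stepFun.comp
    (measurable_fst.prodMk (measurable_fst.comp measurable_snd)))

theorem abs_orthantTest_le {a : DataPoint p → ℝ} (ha1 : ∀ z, |a z| ≤ 1) (r : Fin p → ℝ)
    (z : DataPoint p) : |orthantTest a r z| ≤ 1 := by
  rw [orthantTest, abs_mul]
  exact mul_le_one₀ (ha1 z) (abs_nonneg _) (abs_prod_stepFun_le_one _ _)

theorem measure_le_orthantDev (Q : Measure (DataPoint p)) [IsProbabilityMeasure Q] {R : ℝ}
    (hR : 0 ≤ R) {a : DataPoint p → ℝ} (ha : Measurable a) (ha1 : ∀ z, |a z| ≤ 1) (hn : 1 ≤ n)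
    {s : ℝ} (hs : 0 ≤ s) :
    (Measure.pi fun _ : Fin n => Q) {D | s ≤ orthantDev Q R a D} ≤
      ENNReal.ofReal (2 * Real.exp (-(n * s ^ 2 / 2))) := by
  have := isProbabilityMeasure_uniformBox p hR
  exact measure_le_integral_abs_meanDev Q _ (measurable_orthantTest ha)
    (abs_orthantTest_le ha1) hn hs

theorem abs_meanDev_le_of_isOrthantMixture (Q : Measure (DataPoint p)) [IsProbabilityMeasure Q]
    {R K : ℝ} (hR : 0 ≤ R) (hQ : ∀ᵐ z ∂Q, ∀ l, |z.1 l| ≤ R) {a : DataPoint p → ℝ}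
    (ha : Measurable a) (ha1 : ∀ z, |a z| ≤ 1) {D : Fin n → DataPoint p}
    (hD : ∀ i l, |(D i).1 l| ≤ R) {g : (Fin p → ℝ) → ℝ} (hg : IsOrthantMixture R K g) :
    |meanDev Q D (fun z => a z * g z.1)| ≤ K * orthantDev Q R a D := by
  obtain ⟨v, hvm, hvK, hv⟩ := hg
  have := isProbabilityMeasure_uniformBox p hR
  have hK : 0 ≤ K := (abs_nonneg _).trans (hvK 0)
  have hTm := measurable_orthantTest ha
  have hprod : Measurable fun w : DataPoint p × (Fin p → ℝ) => v w.2 * orthantTest a w.2 w.1 :=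
    (hvm.comp measurable_snd).mul (hTm.comp (measurable_snd.prodMk measurable_fst))
  have hbound : ∀ r z, |v r * orthantTest a r z| ≤ K := fun r z => by
    rw [abs_mul]
    calc |v r| * |orthantTest a r z| ≤ K * 1 := by
          gcongr
          · exact hvK r
          · exact abs_orthantTest_le ha1 r z
      _ = K := mul_one K
  have hrepr : ∀ z : DataPoint p, (∀ l, |z.1 l| ≤ R) →
      a z * g z.1 = ∫ r, v r * orthantTest a r z ∂uniformBox p R := fun z hz => by
    rw [hv z.1 hz, ← integral_const_mul]
    congr 1; ext r; rw [orthantTest]; ring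
  have hi : ∀ z, Integrable (fun r => v r * orthantTest a r z) (uniformBox p R) := fun z =>
    Integrable.of_bound (hprod.comp measurable_prodMk_left).aestronglyMeasurable K
      (Eventually.of_forall fun r => hbound r z)
  have hi2 : Integrable (fun w : DataPoint p × (Fin p → ℝ) => v w.2 * orthantTest a w.2 w.1)
      (Q.prod (uniformBox p R)) :=
    Integrable.of_bound hprod.aestronglyMeasurable K (Eventually.of_forall fun w => hbound w.2 w.1)
  have hmean : ∫ z, a z * g z.1 ∂Q =
      ∫ r, v r * ∫ z, orthantTest a r z ∂Q ∂uniformBox p R := by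
    rw [integral_congr_ae (hQ.mono hrepr), integral_integral_swap hi2]
    simp_rw [integral_const_mul]
  have hi3 : Integrable (fun r => v r * ∫ z, orthantTest a r z ∂Q) (uniformBox p R) := by
    have := hi2.integral_prod_right
    simpa only [integral_const_mul] using this
  have hdev : meanDev Q D (fun z => a z * g z.1) =
      ∫ r, v r * meanDev Q D (orthantTest a r) ∂uniformBox p R := by
    have h1 : ∀ r, v r * meanDev Q D (orthantTest a r) =
        (∑ i, v r * orthantTest a r (D i)) / n - v r * ∫ z, orthantTest a r z ∂Q := fun r => by
      rw [meanDev, mul_sub, mul_div_assoc', Finset.mul_sum]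
    simp_rw [h1]
    rw [integral_sub ((integrable_finsetSum _ fun i _ => hi (D i)).div_const _) hi3,
      integral_div, integral_finsetSum _ fun i _ => hi (D i), meanDev, hmean]
    congr 2
    exact Finset.sum_congr rfl fun i _ => hrepr (D i) (hD i)
  have hmm : Measurable fun r => meanDev Q D (orthantTest a r) := by
    unfold meanDev
    refine Measurable.sub (Measurable.div_const (Finset.measurable_sum _ fun i _ => ?_) _) ?_
    · exact hTm.comp measurable_prodMk_right
    · exact (hTm.stronglyMeasurable.integral_prod_right (ν := Q)).measurable
  have hmb : ∀ r, |meanDev Q D (orthantTest a r)| ≤ n / n + 1 := fun r => by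
    unfold meanDev
    refine (abs_sub _ _).trans (add_le_add ?_ ?_)
    · rw [abs_div, Nat.abs_cast]
      gcongr
      refine (Finset.abs_sum_le_sum_abs _ _).trans ?_
      refine (Finset.sum_le_sum fun i _ => abs_orthantTest_le ha1 r (D i)).trans (by simp)
    · simpa using norm_integral_le_of_norm_le_const (μ := Q) (f := orthantTest a r) (C := 1)
        (Eventually.of_forall fun z => by simpa using abs_orthantTest_le ha1 r z)
  rw [hdev, orthantDev, ← integral_const_mul]
  refine (abs_integral_le_integral_abs).trans (integral_mono_of_nonneg
    (Eventually.of_forall fun _ => abs_nonneg _) ?_ (Eventually.of_forall fun r => ?_))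
  · exact (Integrable.of_bound hmm.abs.aestronglyMeasurable (n / n + 1 : ℝ)
      (Eventually.of_forall fun r => by simpa using hmb r)).const_mul K
  · simp only [abs_mul]
    gcongr
    exact hvK r

/-- The average of `a(z) a(z') k(x, x')` over all ordered pairs of sample points. -/
noncomputable def pairAvg (a : DataPoint p → ℝ) (k : (Fin p → ℝ) → (Fin p → ℝ) → ℝ)
    (D : Fin n → DataPoint p) : ℝ :=
  (∑ i, ∑ j, a (D i) * a (D j) * k (D i).1 (D j).1) / n ^ 2

/-- The expectation of `a(z) a(z') k(x, x')` for independent `z, z' ∼ Q`. -/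
noncomputable def pairMean (Q : Measure (DataPoint p)) (a : DataPoint p → ℝ)
    (k : (Fin p → ℝ) → (Fin p → ℝ) → ℝ) : ℝ :=
  ∫ z, a z * ∫ z', a z' * k z'.1 z.1 ∂Q ∂Q

/-- A pair average is within `2 K` times `orthantDev` of its expectation when all sections of the
kernel are orthant mixtures: replace the empirical measure by `Q` in one argument at a time. -/
theorem abs_pairAvg_sub_pairMean_le (Q : Measure (DataPoint p)) [IsProbabilityMeasure Q]
    {R K : ℝ} (hR : 0 ≤ R) (hQ : ∀ᵐ z ∂Q, ∀ l, |z.1 l| ≤ R) {a : DataPoint p → ℝ}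
    (ha : Measurable a) (ha1 : ∀ z, |a z| ≤ 1) {D : Fin n → DataPoint p} (hn : 1 ≤ n)
    (hD : ∀ i l, |(D i).1 l| ≤ R) {k : (Fin p → ℝ) → (Fin p → ℝ) → ℝ}
    (hkm : Measurable (Function.uncurry k)) (hks : ∀ x x', k x x' = k x' x)
    {C : ℝ} (hkC : ∀ x x', (∀ l, |x l| ≤ R) → (∀ l, |x' l| ≤ R) → |k x x'| ≤ C)
    (hk : ∀ x', (∀ l, |x' l| ≤ R) → IsOrthantMixture R K fun x => k x x') :
    |pairAvg a k D - pairMean Q a k| ≤ 2 * (K * orthantDev Q R a D) := by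
  have hn0 : (0 : ℝ) < n := by exact_mod_cast hn
  set T : (Fin p → ℝ) → ℝ := fun x' => ∫ z, a z * k z.1 x' ∂Q with hT
  set TD : (Fin p → ℝ) → ℝ := fun x' => (∑ i, a (D i) * k (D i).1 x') / n with hTD
  have hdev : ∀ x', (∀ l, |x' l| ≤ R) → |TD x' - T x'| ≤ K * orthantDev Q R a D :=
    fun x' hx' => abs_meanDev_le_of_isOrthantMixture Q hR hQ ha ha1 hD (hk x' hx')
  have hCi : ∀ x', (∀ l, |x' l| ≤ R) → Integrable (fun z => a z * k z.1 x') Q := fun x' hx' => by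
    refine Integrable.of_bound (ha.mul (hkm.comp
      (measurable_fst.prodMk measurable_const))).aestronglyMeasurable C ?_
    filter_upwards [hQ] with z hz
    rw [Real.norm_eq_abs, abs_mul]
    calc _ ≤ 1 * C := by
          gcongr
          · exact ha1 z
          · exact hkC _ _ hz hx'
      _ = C := one_mul C
  have hTm : Measurable T := by
    have h1 : Measurable fun w : (Fin p → ℝ) × DataPoint p => a w.2 * k w.2.1 w.1 :=
      (ha.comp measurable_snd).mul (hkm.comp
        ((measurable_fst.comp measurable_snd).prodMk measurable_fst))
    exact (h1.stronglyMeasurable.integral_prod_right (ν := Q)).measurable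
  have hTb : ∀ x', (∀ l, |x' l| ≤ R) → |T x'| ≤ C := fun x' hx' => by
    have := norm_integral_le_of_norm_le_const (μ := Q) (f := fun z => a z * k z.1 x') (C := C) (by
      filter_upwards [hQ] with z hz
      rw [Real.norm_eq_abs, abs_mul]
      calc _ ≤ 1 * C := by
            gcongr
            · exact ha1 z
            · exact hkC _ _ hz hx'
        _ = C := one_mul C)
    simpa using this
  have haT : Integrable (fun z => a z * T z.1) Q := by
    refine Integrable.of_bound (ha.mul (hTm.comp measurable_fst)).aestronglyMeasurable C ?_
    filter_upwards [hQ] with z hz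
    rw [Real.norm_eq_abs, abs_mul]
    calc _ ≤ 1 * C := by
          gcongr
          · exact ha1 z
          · exact hTb _ hz
      _ = C := one_mul C
  have hii : ∀ i, Integrable (fun z => a (D i) * (a z * k z.1 (D i).1)) Q := fun i =>
    (hCi (D i).1 (hD i)).const_mul _
  -- integrating the empirical section against `Q` gives back the empirical mean of `a T`
  have hswap : ∫ z, a z * TD z.1 ∂Q = (∑ i, a (D i) * T (D i).1) / n := by
    have h1 : ∀ z : DataPoint p, a z * TD z.1 = (∑ i, a (D i) * (a z * k z.1 (D i).1)) / n :=
      fun z => by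
        rw [hTD]
        simp only
        rw [mul_div_assoc', Finset.mul_sum]
        congr 1
        refine Finset.sum_congr rfl fun i _ => ?_
        rw [hks z.1 (D i).1]; ring
    simp_rw [h1]
    rw [integral_div, integral_finsetSum _ fun i _ => hii i]
    simp_rw [integral_const_mul]
    rfl
  have haTD : Integrable (fun z => a z * TD z.1) Q := by
    have h1 : (fun z : DataPoint p => a z * TD z.1) =
        fun z => (∑ i, a (D i) * (a z * k z.1 (D i).1)) / n := by
      ext z
      rw [hTD]
      simp only
      rw [mul_div_assoc', Finset.mul_sum]
      congr 1
      refine Finset.sum_congr rfl fun i _ => ?_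
      rw [hks z.1 (D i).1]; ring
    rw [h1]
    exact (integrable_finsetSum _ fun i _ => hii i).div_const _
  have hsplit : pairAvg a k D - pairMean Q a k =
      (∑ j, a (D j) * (TD (D j).1 - T (D j).1)) / n + ∫ z, a z * (TD z.1 - T z.1) ∂Q := by
    simp_rw [mul_sub]
    rw [integral_sub haTD haT, hswap, Finset.sum_sub_distrib, sub_div]
    have h1 : pairAvg a k D = (∑ j, a (D j) * TD (D j).1) / n := by
      rw [pairAvg, hTD, Finset.sum_comm, sq, ← div_div, Finset.sum_div]
      congr 1
      refine Finset.sum_congr rfl fun j _ => ?_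
      simp only
      rw [mul_div_assoc', Finset.mul_sum]
      congr 1
      exact Finset.sum_congr rfl fun i _ => by ring
    rw [h1, pairMean]
    ring
  have hb1 : |(∑ j, a (D j) * (TD (D j).1 - T (D j).1)) / n| ≤ K * orthantDev Q R a D := by
    rw [abs_div, Nat.abs_cast, div_le_iff₀ hn0]
    refine (Finset.abs_sum_le_sum_abs _ _).trans ?_
    refine (Finset.sum_le_sum (g := fun _ => K * orthantDev Q R a D) fun j _ => ?_).trans
      (by simp [mul_comm])
    rw [abs_mul]
    exact (mul_le_of_le_one_left (abs_nonneg _) (ha1 _)).trans (hdev _ (hD j))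
  have hb2 : |∫ z, a z * (TD z.1 - T z.1) ∂Q| ≤ K * orthantDev Q R a D := by
    have := norm_integral_le_of_norm_le_const (μ := Q)
      (f := fun z => a z * (TD z.1 - T z.1)) (C := K * orthantDev Q R a D) (by
        filter_upwards [hQ] with z hz
        rw [Real.norm_eq_abs, abs_mul]
        exact (mul_le_of_le_one_left (abs_nonneg _) (ha1 _)).trans (hdev _ hz))
    simpa using this
  rw [hsplit]
  refine (abs_add_le _ _).trans ?_
  linarith

end UniformDeviation

/-! ### The kernel profile and its derivative -/

section Profile

variable {μ : Measure ℝ} [IsFiniteMeasure μ] {a b : ℝ}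

/-- `-h'(u) = ∫ t e^{-tu} μ(dt)`. -/
noncomputable def profileSlope (μ : Measure ℝ) (u : ℝ) : ℝ := ∫ t, t * Real.exp (-(t * u)) ∂μ

theorem mem_interior_integrableExpSet (hμs : ∀ᵐ t ∂μ, t ∈ Set.Icc a b) (u : ℝ) :
    u ∈ interior (integrableExpSet id μ) := by
  have h : integrableExpSet id μ = Set.univ := by
    ext u
    simpa [integrableExpSet] using
      integrable_exp_mul_of_mem_Icc (t := u) aemeasurable_id hμs
  simp [h]

theorem integrable_exp_neg_mul (hμs : ∀ᵐ t ∂μ, t ∈ Set.Icc a b) (u : ℝ) :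
    Integrable (fun t => Real.exp (-(t * u))) μ := by
  have h := integrable_exp_mul_of_mem_Icc (t := -u) aemeasurable_id hμs
  refine h.congr (Eventually.of_forall fun t => ?_)
  simp [mul_comm]

theorem integrable_mul_exp_neg_mul (hμs : ∀ᵐ t ∂μ, t ∈ Set.Icc a b) (u : ℝ) :
    Integrable (fun t => t * Real.exp (-(t * u))) μ := by
  have h := integrable_pow_mul_exp_of_mem_interior_integrableExpSet
    (mem_interior_integrableExpSet hμs (-u)) 1
  refine h.congr (Eventually.of_forall fun t => ?_)
  simp [mul_comm]

theorem hasDerivAt_kernelProfile (hμs : ∀ᵐ t ∂μ, t ∈ Set.Icc a b) (u : ℝ) :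
    HasDerivAt (kernelProfile μ) (-profileSlope μ u) u := by
  have h := (hasDerivAt_mgf (mem_interior_integrableExpSet hμs (-u))).comp u (hasDerivAt_neg u)
  have h1 : mgf id μ ∘ Neg.neg = kernelProfile μ := by
    ext u
    simp [mgf, kernelProfile, mul_comm]
  rw [h1] at h
  refine h.congr_deriv ?_
  simp [profileSlope, mul_comm]

theorem continuous_profileSlope (hμs : ∀ᵐ t ∂μ, t ∈ Set.Icc a b) :
    Continuous (profileSlope μ) := by
  have h : ∀ u, HasDerivAt (fun u => ∫ t, (id t) ^ 1 * Real.exp (u * id t) ∂μ)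
      (∫ t, (id t) ^ 2 * Real.exp (u * id t) ∂μ) u := fun u =>
    hasDerivAt_integral_pow_mul_exp_real (mem_interior_integrableExpSet hμs u) 1
  have h1 : Continuous fun u => ∫ t, (id t) ^ 1 * Real.exp (u * id t) ∂μ :=
    continuous_iff_continuousAt.2 fun u => (h u).continuousAt
  have h2 : profileSlope μ = (fun u => ∫ t, (id t) ^ 1 * Real.exp (u * id t) ∂μ) ∘ Neg.neg := by
    ext u
    simp [profileSlope, mul_comm]
  rw [h2]
  exact h1.comp continuous_neg

theorem abs_exp_neg_sub_le {x y : ℝ} (hx : 0 ≤ x) (hy : 0 ≤ y) :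
    |Real.exp (-y) - Real.exp (-x) + Real.exp (-x) * (y - x)| ≤ (y - x) ^ 2 := by
  have hx1 : Real.exp (-x) ≤ 1 := Real.exp_le_one_iff.2 (by linarith)
  have hy1 : Real.exp (-y) ≤ 1 := Real.exp_le_one_iff.2 (by linarith)
  have hxp := Real.exp_pos (-x)
  have hyp := Real.exp_pos (-y)
  -- tangent lines of `exp` at `-x` and `-y`
  have h1 : Real.exp (-x) * (1 + (x - y)) ≤ Real.exp (-y) := by
    have h := Real.add_one_le_exp (x - y)
    have h' : Real.exp (-y) = Real.exp (-x) * Real.exp (x - y) := by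
      rw [← Real.exp_add]; congr 1; ring
    rw [h']; gcongr; linarith
  have h2 : Real.exp (-y) * (1 + (y - x)) ≤ Real.exp (-x) := by
    have h := Real.add_one_le_exp (y - x)
    have h' : Real.exp (-x) = Real.exp (-y) * Real.exp (y - x) := by
      rw [← Real.exp_add]; congr 1; ring
    rw [h']; gcongr; linarith
  rw [abs_of_nonneg (by nlinarith)]
  rcases le_total x y with h | h
  · nlinarith [mul_nonneg hxp.le (sub_nonneg.2 h), mul_nonneg hyp.le (sub_nonneg.2 h),
      mul_nonneg (sub_nonneg.2 hx1) (sq_nonneg (y - x))]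
  · nlinarith [mul_nonneg hxp.le (sub_nonneg.2 h), mul_nonneg hyp.le (sub_nonneg.2 h),
      mul_nonneg (sub_nonneg.2 hy1) (sq_nonneg (y - x))]

theorem abs_kernelProfile_taylor_le (ha : 0 < a) (hμs : ∀ᵐ t ∂μ, t ∈ Set.Icc a b) {u v : ℝ}
    (hu : 0 ≤ u) (hv : 0 ≤ v) :
    |kernelProfile μ v - kernelProfile μ u + profileSlope μ u * (v - u)| ≤
      b ^ 2 * μ.real Set.univ * (v - u) ^ 2 := by
  have h1 : kernelProfile μ v - kernelProfile μ u + profileSlope μ u * (v - u) =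
      ∫ t, (Real.exp (-(t * v)) - Real.exp (-(t * u)) + t * Real.exp (-(t * u)) * (v - u)) ∂μ := by
    have hi := integral_add ((integrable_exp_neg_mul hμs v).sub (integrable_exp_neg_mul hμs u))
      ((integrable_mul_exp_neg_mul hμs u).mul_const (v - u))
    simp only [Pi.sub_apply] at hi
    rw [hi, integral_sub (integrable_exp_neg_mul hμs v) (integrable_exp_neg_mul hμs u),
      integral_mul_const]
    rfl
  rw [h1]
  have h2 := norm_integral_le_of_norm_le_const (μ := μ) (C := b ^ 2 * (v - u) ^ 2)
    (f := fun t => Real.exp (-(t * v)) - Real.exp (-(t * u)) +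
      t * Real.exp (-(t * u)) * (v - u)) (by
      filter_upwards [hμs] with t ht
      have ht0 : 0 ≤ t := ha.le.trans ht.1
      have h3 := abs_exp_neg_sub_le (mul_nonneg ht0 hu) (mul_nonneg ht0 hv)
      rw [Real.norm_eq_abs]
      calc _ = |Real.exp (-(t * v)) - Real.exp (-(t * u)) +
            Real.exp (-(t * u)) * (t * v - t * u)| := by congr 1; ring
        _ ≤ (t * v - t * u) ^ 2 := h3
        _ = t ^ 2 * (v - u) ^ 2 := by ring
        _ ≤ b ^ 2 * (v - u) ^ 2 := by
            gcongr
            exact ht.2)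
  rw [Real.norm_eq_abs] at h2
  calc _ ≤ _ := h2
    _ = _ := by ring

theorem abs_kernelProfile_le (ha : 0 < a) (hμs : ∀ᵐ t ∂μ, t ∈ Set.Icc a b) {u : ℝ}
    (hu : 0 ≤ u) : |kernelProfile μ u| ≤ μ.real Set.univ := by
  have h2 := norm_integral_le_of_norm_le_const (μ := μ) (C := 1)
    (f := fun t => Real.exp (-(t * u))) (by
      filter_upwards [hμs] with t ht
      have ht0 : 0 ≤ t := ha.le.trans ht.1
      rw [Real.norm_eq_abs, abs_of_pos (Real.exp_pos _)]
      exact Real.exp_le_one_iff.2 (neg_nonpos.2 (mul_nonneg ht0 hu)))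
  simpa [kernelProfile] using h2

end Profile

/-! ### The objective of a discrete distribution -/

section Discrete

variable {p n : ℕ}

/-- The vector of coordinatewise distances `|x_i - x'_i|^q`. -/
noncomputable def distVec (q : ℕ) (x x' : Fin p → ℝ) : EuclideanSpace ℝ (Fin p) :=
  WithLp.toLp 2 fun i => |x i - x' i| ^ q

theorem weightedDist_eq_inner (q : ℕ) (β : EuclideanSpace ℝ (Fin p)) (x x' : Fin p → ℝ) :
    weightedDist q β x x' = inner ℝ (distVec q x x') β := by
  simp [weightedDist, distVec, PiLp.inner_apply]

theorem weightedDist_nonneg (q : ℕ) {M : ℝ} {β : EuclideanSpace ℝ (Fin p)}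
    (hβ : β ∈ feasibleBox p M) (x x' : Fin p → ℝ) : 0 ≤ weightedDist q β x x' :=
  Finset.sum_nonneg fun i _ => mul_nonneg (hβ i).1 (by positivity)

theorem norm_distVec_sq_le (q : ℕ) {R : ℝ} {x x' : Fin p → ℝ} (hx : ∀ i, |x i| ≤ R)
    (hx' : ∀ i, |x' i| ≤ R) : ‖distVec q x x'‖ ^ 2 ≤ p * ((2 * R) ^ q) ^ 2 := by
  rw [EuclideanSpace.norm_sq_eq]
  refine (Finset.sum_le_sum (g := fun _ => ((2 * R) ^ q) ^ 2) fun i _ => ?_).trans (by simp)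
  have h1 : |x i - x' i| ≤ 2 * R := (abs_sub _ _).trans (by linarith [hx i, hx' i])
  simp only [distVec, Real.norm_eq_abs, sq_abs]
  gcongr

/-- The metric learning objective of the signed discrete distribution that gives mass `e i` to the
point `X i`. -/
noncomputable def discreteObjective (μ : Measure ℝ) (q : ℕ) (e : Fin n → ℝ)
    (X : Fin n → Fin p → ℝ) (β : EuclideanSpace ℝ (Fin p)) : ℝ :=
  -∑ i, ∑ j, e i * e j * kernelProfile μ (weightedDist q β (X i) (X j))

/-- The gradient of `discreteObjective`. -/
noncomputable def discreteGradient (μ : Measure ℝ) (q : ℕ) (e : Fin n → ℝ)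
    (X : Fin n → Fin p → ℝ) (β : EuclideanSpace ℝ (Fin p)) : EuclideanSpace ℝ (Fin p) :=
  ∑ i, ∑ j, (e i * e j * profileSlope μ (weightedDist q β (X i) (X j))) • distVec q (X i) (X j)

theorem mlObjective_sum_smul_dirac (μ : Measure ℝ) (q : ℕ) (c : Fin n → ℝ) (hc : ∀ i, 0 ≤ c i)
    (D : Fin n → DataPoint p) :
    mlObjective μ q (∑ i, ENNReal.ofReal (c i) • Measure.dirac (D i)) =
      discreteObjective μ q (fun i => c i * (D i).2) (fun i => (D i).1) := by
  ext β
  rw [mlObjective, discreteObjective]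
  congr 1
  have hprod : (∑ i, ENNReal.ofReal (c i) • Measure.dirac (D i)).prod
      (∑ i, ENNReal.ofReal (c i) • Measure.dirac (D i)) =
      ∑ i, ∑ j, ENNReal.ofReal (c i * c j) • Measure.dirac (D i, D j) := by
    simp_rw [← Measure.sum_fintype]
    rw [Measure.prod_sum_left]
    congr 1; ext1 i
    rw [Measure.prod_sum_right]
    congr 1; ext1 j
    rw [Measure.prod_smul_left, Measure.prod_smul_right, Measure.dirac_prod_dirac, smul_smul,
      ENNReal.ofReal_mul (hc i)]
  have hi : ∀ (i j : Fin n) (f : DataPoint p × DataPoint p → ℝ),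
      Integrable f (ENNReal.ofReal (c i * c j) • Measure.dirac (D i, D j)) := fun i j f =>
    (integrable_dirac (by simp)).smul_measure ENNReal.ofReal_ne_top
  rw [hprod, integral_finsetSum_measure fun i _ => integrable_finsetSum_measure.2
    fun j _ => hi i j _]
  refine Finset.sum_congr rfl fun i _ => ?_
  rw [integral_finsetSum_measure fun j _ => hi i j _]
  refine Finset.sum_congr rfl fun j _ => ?_
  rw [integral_smul_measure, integral_dirac,
    ENNReal.toReal_ofReal (mul_nonneg (hc i) (hc j)), smul_eq_mul]
  ring

variable {μ : Measure ℝ} [IsFiniteMeasure μ] {a b : ℝ}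

theorem hasGradientAt_discreteObjective (hμs : ∀ᵐ t ∂μ, t ∈ Set.Icc a b) (q : ℕ) (e : Fin n → ℝ)
    (X : Fin n → Fin p → ℝ) (β : EuclideanSpace ℝ (Fin p)) :
    HasGradientAt (discreteObjective μ q e X) (discreteGradient μ q e X β) β := by
  have h1 : ∀ i j, HasFDerivAt
      (fun β => e i * e j * kernelProfile μ (weightedDist q β (X i) (X j)))
      ((e i * e j * -profileSlope μ (weightedDist q β (X i) (X j))) •
        innerSL ℝ (distVec q (X i) (X j))) β := fun i j => by
    have h2 : HasFDerivAt (fun β => weightedDist q β (X i) (X j))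
        (innerSL ℝ (distVec q (X i) (X j))) β := by
      simp_rw [weightedDist_eq_inner]
      exact (innerSL ℝ (distVec q (X i) (X j))).hasFDerivAt
    have h3 := ((hasDerivAt_kernelProfile hμs _).comp_hasFDerivAt β h2).const_mul (e i * e j)
    rw [smul_smul] at h3
    exact h3
  have h4 := (HasFDerivAt.fun_sum fun i (_ : i ∈ Finset.univ) =>
    HasFDerivAt.fun_sum fun j (_ : j ∈ Finset.univ) => h1 i j).neg
  rw [hasGradientAt_iff_hasFDerivAt]
  refine h4.congr_fderiv ?_
  ext w
  simp [discreteGradient]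

theorem gradient_discreteObjective (hμs : ∀ᵐ t ∂μ, t ∈ Set.Icc a b) (q : ℕ) (e : Fin n → ℝ)
    (X : Fin n → Fin p → ℝ) :
    gradient (discreteObjective μ q e X) = discreteGradient μ q e X :=
  gradient_eq fun β => hasGradientAt_discreteObjective hμs q e X β

/-- The objective of a discrete distribution of total variation at most `1` on the cube
`[-R, R]^p` satisfies a quadratic upper bound, with a constant that does not depend on the
distribution. -/
theorem quadUpperBound_discreteObjective (ha : 0 < a) (hμs : ∀ᵐ t ∂μ, t ∈ Set.Icc a b) (q : ℕ)
    {e : Fin n → ℝ} (he : ∑ i, |e i| ≤ 1) {R : ℝ} {X : Fin n → Fin p → ℝ}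
    (hX : ∀ i l, |X i l| ≤ R) (M : ℝ) :
    QuadUpperBound (discreteObjective μ q e X) (feasibleBox p M)
      (b ^ 2 * μ.real Set.univ * (p * ((2 * R) ^ q) ^ 2)) where
  diff β := (hasGradientAt_discreteObjective hμs q e X β).differentiableAt
  cont := by
    rw [gradient_discreteObjective hμs]
    unfold discreteGradient
    refine continuous_finsetSum _ fun i _ => continuous_finsetSum _ fun j _ => ?_
    refine Continuous.smul (continuous_const.mul ((continuous_profileSlope hμs).comp ?_))
      continuous_const
    simp_rw [weightedDist_eq_inner]
    fun_prop
  upper x hx y hy := by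
    set L := b ^ 2 * μ.real Set.univ * (p * ((2 * R) ^ q) ^ 2) with hL
    rw [gradient_discreteObjective hμs]
    have h1 : ∀ i j, |e i * e j * (kernelProfile μ (weightedDist q y (X i) (X j)) -
        kernelProfile μ (weightedDist q x (X i) (X j)) +
        profileSlope μ (weightedDist q x (X i) (X j)) *
          (weightedDist q y (X i) (X j) - weightedDist q x (X i) (X j)))| ≤
        |e i| * |e j| * (L * ‖y - x‖ ^ 2) := fun i j => by
      rw [abs_mul, abs_mul]
      gcongr
      refine (abs_kernelProfile_taylor_le ha hμs (weightedDist_nonneg q hx _ _)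
        (weightedDist_nonneg q hy _ _)).trans ?_
      rw [hL, mul_assoc _ _ (‖y - x‖ ^ 2)]
      gcongr
      rw [weightedDist_eq_inner, weightedDist_eq_inner, ← inner_sub_right]
      calc _ = |inner ℝ (distVec q (X i) (X j)) (y - x)| ^ 2 := (sq_abs _).symm
        _ ≤ (‖distVec q (X i) (X j)‖ * ‖y - x‖) ^ 2 := by
            gcongr; exact abs_real_inner_le_norm _ _
        _ = ‖distVec q (X i) (X j)‖ ^ 2 * ‖y - x‖ ^ 2 := by ring
        _ ≤ _ := by gcongr; exact norm_distVec_sq_le q (hX i) (hX j)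
    have h2 : discreteObjective μ q e X y - discreteObjective μ q e X x -
        inner ℝ (discreteGradient μ q e X x) (y - x) =
        -∑ i, ∑ j, e i * e j * (kernelProfile μ (weightedDist q y (X i) (X j)) -
          kernelProfile μ (weightedDist q x (X i) (X j)) +
          profileSlope μ (weightedDist q x (X i) (X j)) *
          (weightedDist q y (X i) (X j) - weightedDist q x (X i) (X j))) := by
      simp only [discreteObjective, discreteGradient, sum_inner, real_inner_smul_left,
        weightedDist_eq_inner q y, mul_add, mul_sub, Finset.sum_add_distrib,
        Finset.sum_sub_distrib, weightedDist_eq_inner q x, inner_sub_right]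
      simp only [← mul_assoc]
      ring
    have h3 : |∑ i, ∑ j, e i * e j * (kernelProfile μ (weightedDist q y (X i) (X j)) -
          kernelProfile μ (weightedDist q x (X i) (X j)) +
          profileSlope μ (weightedDist q x (X i) (X j)) *
          (weightedDist q y (X i) (X j) - weightedDist q x (X i) (X j)))| ≤
        (∑ i, |e i|) ^ 2 * (L * ‖y - x‖ ^ 2) := by
      refine (Finset.abs_sum_le_sum_abs _ _).trans ?_
      rw [sq, Finset.sum_mul_sum, Finset.sum_mul]
      refine Finset.sum_le_sum fun i _ => (Finset.abs_sum_le_sum_abs _ _).trans ?_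
      rw [Finset.sum_mul]
      exact Finset.sum_le_sum fun j _ => h1 i j
    have hL0 : 0 ≤ L * ‖y - x‖ ^ 2 := by positivity
    have h4 : (∑ i, |e i|) ^ 2 * (L * ‖y - x‖ ^ 2) ≤ 1 * (L * ‖y - x‖ ^ 2) := by
      gcongr
      exact pow_le_one₀ (Finset.sum_nonneg fun i _ => abs_nonneg _) he
    have h5 := (abs_le.1 (h3.trans h4)).1
    linarith

theorem abs_discreteObjective_le (ha : 0 < a) (hμs : ∀ᵐ t ∂μ, t ∈ Set.Icc a b) (q : ℕ)
    {e : Fin n → ℝ} (he : ∑ i, |e i| ≤ 1) (X : Fin n → Fin p → ℝ) {M : ℝ}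
    {β : EuclideanSpace ℝ (Fin p)} (hβ : β ∈ feasibleBox p M) :
    |discreteObjective μ q e X β| ≤ μ.real Set.univ := by
  rw [discreteObjective, abs_neg]
  calc _ ≤ ∑ i, ∑ j, |e i| * |e j| * μ.real Set.univ := by
        refine (Finset.abs_sum_le_sum_abs _ _).trans (Finset.sum_le_sum fun i _ =>
          (Finset.abs_sum_le_sum_abs _ _).trans (Finset.sum_le_sum fun j _ => ?_))
        rw [abs_mul, abs_mul]
        gcongr
        exact abs_kernelProfile_le ha hμs (weightedDist_nonneg q hβ _ _)
    _ = (∑ i, |e i|) ^ 2 * μ.real Set.univ := by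
        rw [sq, Finset.sum_mul_sum, Finset.sum_mul]
        exact Finset.sum_congr rfl fun i _ => by rw [Finset.sum_mul]
    _ ≤ 1 * μ.real Set.univ := by
        gcongr
        exact pow_le_one₀ (Finset.sum_nonneg fun i _ => abs_nonneg _) he
    _ = _ := one_mul _

end Discrete

/-! ### The exponential kernels -/

section Kernels

variable {p : ℕ}

/-- `exp (-t ‖x - x'‖_{q,β}^q)`. -/
noncomputable def expKernel (q : ℕ) (t : ℝ) (β : EuclideanSpace ℝ (Fin p))
    (x x' : Fin p → ℝ) : ℝ := Real.exp (-(t * weightedDist q β x x'))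

/-- `|x_l - x'_l|^q exp (-t ‖x - x'‖_{q,β}^q)`. -/
noncomputable def gradKernel (q : ℕ) (t : ℝ) (β : EuclideanSpace ℝ (Fin p)) (l : Fin p)
    (x x' : Fin p → ℝ) : ℝ := |x l - x' l| ^ q * expKernel q t β x x'

theorem weightedDist_comm (q : ℕ) (β : EuclideanSpace ℝ (Fin p)) (x x' : Fin p → ℝ) :
    weightedDist q β x x' = weightedDist q β x' x := by
  simp only [weightedDist, abs_sub_comm]

theorem expKernel_comm (q : ℕ) (t : ℝ) (β : EuclideanSpace ℝ (Fin p)) (x x' : Fin p → ℝ) :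
    expKernel q t β x x' = expKernel q t β x' x := by
  rw [expKernel, weightedDist_comm, expKernel]

theorem gradKernel_comm (q : ℕ) (t : ℝ) (β : EuclideanSpace ℝ (Fin p)) (l : Fin p)
    (x x' : Fin p → ℝ) : gradKernel q t β l x x' = gradKernel q t β l x' x := by
  rw [gradKernel, expKernel_comm, abs_sub_comm, gradKernel]

theorem measurable_expKernel (q : ℕ) (t : ℝ) (β : EuclideanSpace ℝ (Fin p)) :
    Measurable (Function.uncurry (expKernel q t β)) := by
  unfold expKernel weightedDist Function.uncurry
  fun_prop

theorem measurable_gradKernel (q : ℕ) (t : ℝ) (β : EuclideanSpace ℝ (Fin p)) (l : Fin p) :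
    Measurable (Function.uncurry (gradKernel q t β l)) := by
  unfold gradKernel expKernel weightedDist Function.uncurry
  fun_prop

theorem expKernel_pos (q : ℕ) (t : ℝ) (β : EuclideanSpace ℝ (Fin p)) (x x' : Fin p → ℝ) :
    0 < expKernel q t β x x' := Real.exp_pos _

theorem expKernel_le_one (q : ℕ) {t M : ℝ} (ht : 0 ≤ t) {β : EuclideanSpace ℝ (Fin p)}
    (hβ : β ∈ feasibleBox p M) (x x' : Fin p → ℝ) : expKernel q t β x x' ≤ 1 :=
  Real.exp_le_one_iff.2 (neg_nonpos.2 (mul_nonneg ht (weightedDist_nonneg q hβ x x')))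

theorem abs_sub_pow_le (q : ℕ) {R s y : ℝ} (hs : |s| ≤ R) (hy : |y| ≤ R) :
    |s - y| ^ q ≤ (2 * R) ^ q := by
  have h1 : |s - y| ≤ 2 * R := (abs_sub _ _).trans (by linarith)
  gcongr

theorem abs_expKernel_le (q : ℕ) {t M : ℝ} (ht : 0 ≤ t) {β : EuclideanSpace ℝ (Fin p)}
    (hβ : β ∈ feasibleBox p M) (x x' : Fin p → ℝ) : |expKernel q t β x x'| ≤ 1 := by
  rw [abs_of_pos (expKernel_pos _ _ _ _ _)]
  exact expKernel_le_one q ht hβ x x'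

theorem abs_gradKernel_le (q : ℕ) {t M R : ℝ} (ht : 0 ≤ t) {β : EuclideanSpace ℝ (Fin p)}
    (hβ : β ∈ feasibleBox p M) (l : Fin p) {x x' : Fin p → ℝ} (hx : ∀ i, |x i| ≤ R)
    (hx' : ∀ i, |x' i| ≤ R) : |gradKernel q t β l x x'| ≤ (2 * R) ^ q := by
  rw [gradKernel, abs_mul, abs_of_nonneg (by positivity : 0 ≤ |x l - x' l| ^ q)]
  have h := abs_sub_pow_le q (hx l) (hx' l)
  calc _ ≤ (2 * R) ^ q * 1 := by
        gcongr
        · exact le_trans (by positivity) h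
        · exact abs_expKernel_le q ht hβ x x'
    _ = _ := mul_one _

/-- One coordinate factor of the two kernels, as a function of the first argument. -/
noncomputable def coordFactor (q e : ℕ) (c y s : ℝ) : ℝ :=
  (|s - y| ^ q) ^ e * Real.exp (-(c * |s - y| ^ q))

theorem expKernel_eq_prod (q : ℕ) (t : ℝ) (β : EuclideanSpace ℝ (Fin p)) (x x' : Fin p → ℝ) :
    expKernel q t β x x' = ∏ i, coordFactor q 0 (t * β i) (x' i) (x i) := by
  simp only [expKernel, weightedDist, coordFactor, pow_zero, one_mul]
  rw [← Real.exp_sum, Finset.sum_neg_distrib, Finset.mul_sum]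
  simp only [mul_assoc]

theorem gradKernel_eq_prod (q : ℕ) (t : ℝ) (β : EuclideanSpace ℝ (Fin p)) (l : Fin p)
    (x x' : Fin p → ℝ) : gradKernel q t β l x x' =
      ∏ i, coordFactor q (if i = l then 1 else 0) (t * β i) (x' i) (x i) := by
  rw [gradKernel, expKernel_eq_prod]
  simp only [coordFactor, Finset.prod_mul_distrib, pow_zero, one_mul]
  congr 1
  rw [Finset.prod_eq_single l]
  · simp
  · intro i _ hi; simp [hi]
  · simp

theorem abs_exp_neg_sub_exp_neg_le {x y : ℝ} (hx : 0 ≤ x) (hy : 0 ≤ y) :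
    |Real.exp (-x) - Real.exp (-y)| ≤ |x - y| := by
  wlog h : x ≤ y generalizing x y
  · rw [abs_sub_comm, abs_sub_comm x]; exact this hy hx (le_of_not_ge h)
  have h1 : Real.exp (-y) ≤ Real.exp (-x) := Real.exp_le_exp.2 (by linarith)
  rw [abs_of_nonneg (sub_nonneg.2 h1), abs_sub_comm, abs_of_nonneg (sub_nonneg.2 h)]
  have h2 := Real.add_one_le_exp (x - y)
  have h3 : Real.exp (-y) = Real.exp (-x) * Real.exp (x - y) := by
    rw [← Real.exp_add]; congr 1; ring
  have h4 : Real.exp (-x) ≤ 1 := Real.exp_le_one_iff.2 (by linarith)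
  have h5 := Real.exp_pos (-x)
  rw [h3]
  nlinarith

theorem abs_pow_sub_pow_le_mul {q : ℕ} (hq : q = 1 ∨ q = 2) {R u v : ℝ} (hu : 0 ≤ u)
    (huR : u ≤ 2 * R) (hv : 0 ≤ v) (hvR : v ≤ 2 * R) :
    |u ^ q - v ^ q| ≤ (4 * R + 1) * |u - v| := by
  have hR : 0 ≤ R := by linarith
  have h0 := abs_nonneg (u - v)
  rcases hq with rfl | rfl
  · simp only [pow_one]
    nlinarith
  · rw [sq_sub_sq, abs_mul, abs_of_nonneg (by linarith)]
    exact mul_le_mul_of_nonneg_right (by linarith) h0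

/-- The coordinate factors are Lipschitz on `[-R, R]`, uniformly in their parameters. -/
theorem exists_coordFactor_lipschitz {q : ℕ} (hq : q = 1 ∨ q = 2) {R : ℝ} (hR : 0 ≤ R) {cmax : ℝ}
    (hcmax : 0 ≤ cmax) : ∃ K : NNReal, ∀ e : ℕ, e = 0 ∨ e = 1 → ∀ c : ℝ, 0 ≤ c → c ≤ cmax →
      ∀ y : ℝ, |y| ≤ R → LipschitzOnWith K (coordFactor q e c y) (Set.Icc (-R) R) ∧
        |coordFactor q e c y (-R)| ≤ K := by
  set Dm : ℝ := (2 * R) ^ q with hDm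
  have hDm0 : 0 ≤ Dm := by positivity
  set K : ℝ := (1 + cmax + Dm * cmax) * (4 * R + 1) + Dm + 1 with hK
  have hK0 : 0 ≤ K := by positivity
  refine ⟨NNReal.mk K hK0, fun e he c hc hcc y hy => ⟨?_, ?_⟩⟩
  · refine LipschitzOnWith.of_dist_le_mul fun s hs s' hs' => ?_
    rw [Real.dist_eq, Real.dist_eq, NNReal.coe_mk]
    have hs1 : |s| ≤ R := abs_le.2 hs
    have hs1' : |s'| ≤ R := abs_le.2 hs'
    set z := |s - y| ^ q with hz
    set z' := |s' - y| ^ q with hz'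
    have hz0 : 0 ≤ z := by positivity
    have hz0' : 0 ≤ z' := by positivity
    have hzD' : z' ≤ Dm := abs_sub_pow_le q hs1' hy
    have h1 : |z - z'| ≤ (4 * R + 1) * |s - s'| := by
      refine (abs_pow_sub_pow_le_mul (R := R) hq (abs_nonneg _) ((abs_sub _ _).trans (by linarith))
        (abs_nonneg _) ((abs_sub _ _).trans (by linarith))).trans ?_
      refine mul_le_mul_of_nonneg_left ?_ (by linarith)
      have h := abs_abs_sub_abs_le (s - y) (s' - y)
      rwa [sub_sub_sub_cancel_right] at h
    have h2 : |Real.exp (-(c * z)) - Real.exp (-(c * z'))| ≤ cmax * |z - z'| := by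
      refine (abs_exp_neg_sub_exp_neg_le (mul_nonneg hc hz0) (mul_nonneg hc hz0')).trans ?_
      rw [← mul_sub, abs_mul, abs_of_nonneg hc]
      gcongr
    have h3 : |coordFactor q e c y s - coordFactor q e c y s'| ≤
        (1 + cmax + Dm * cmax) * |z - z'| := by
      have h0 := abs_nonneg (z - z')
      rcases he with rfl | rfl
      · simp only [coordFactor, pow_zero, one_mul]
        refine h2.trans ?_
        gcongr
        nlinarith
      · simp only [coordFactor, pow_one]
        rw [show z * Real.exp (-(c * z)) - z' * Real.exp (-(c * z')) =
          (z - z') * Real.exp (-(c * z)) + z' * (Real.exp (-(c * z)) - Real.exp (-(c * z'))) by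
          ring]
        refine (abs_add_le _ _).trans ?_
        rw [abs_mul, abs_mul, abs_of_pos (Real.exp_pos _), abs_of_nonneg hz0']
        have h4 : |z - z'| * Real.exp (-(c * z)) ≤ |z - z'| * 1 := by
          gcongr
          exact Real.exp_le_one_iff.2 (neg_nonpos.2 (mul_nonneg hc hz0))
        have h5 : z' * |Real.exp (-(c * z)) - Real.exp (-(c * z'))| ≤ Dm * (cmax * |z - z'|) := by
          gcongr
        nlinarith [mul_nonneg hcmax h0]
    refine h3.trans ?_
    calc (1 + cmax + Dm * cmax) * |z - z'| ≤
          (1 + cmax + Dm * cmax) * ((4 * R + 1) * |s - s'|) := by gcongr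
      _ = (1 + cmax + Dm * cmax) * (4 * R + 1) * |s - s'| := by ring
      _ ≤ K * |s - s'| := by gcongr; rw [hK]; linarith
  · have h1 : |(-R) - y| ^ q ≤ Dm := abs_sub_pow_le q (by rw [abs_neg, abs_of_nonneg hR]) hy
    have h2 : (|(-R) - y| ^ q) ^ e ≤ Dm + 1 := by
      rcases he with rfl | rfl
      · simpa using hDm0
      · simpa using h1.trans (by linarith)
    have h3 : Real.exp (-(c * |(-R) - y| ^ q)) ≤ 1 :=
      Real.exp_le_one_iff.2 (neg_nonpos.2 (by positivity))
    rw [coordFactor, abs_of_nonneg (by positivity), NNReal.coe_mk]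
    calc _ ≤ (Dm + 1) * 1 := by gcongr
      _ ≤ K := by
        have : 0 ≤ (1 + cmax + Dm * cmax) * (4 * R + 1) := by positivity
        rw [hK]; linarith

/-- All sections of the kernels with parameters `t ∈ [0, b]` and `β` in the box are orthant mixtures
with a common bound. -/
theorem exists_isOrthantMixture_kernel (p : ℕ) {q : ℕ} (hq : q = 1 ∨ q = 2) {R b M : ℝ}
    (hR : 0 ≤ R) (hb : 0 ≤ b) (hM : 0 ≤ M) : ∃ K : ℝ, 0 ≤ K ∧
      ∀ t, 0 ≤ t → t ≤ b → ∀ β ∈ feasibleBox p M, ∀ x' : Fin p → ℝ, (∀ i, |x' i| ≤ R) →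
        IsOrthantMixture R K (fun x => expKernel q t β x x') ∧
        ∀ l, IsOrthantMixture R K (fun x => gradKernel q t β l x x') := by
  obtain ⟨K, hK⟩ := exists_coordFactor_lipschitz hq hR (mul_nonneg hb hM)
  refine ⟨((2 * R + 1) * K) ^ p, by positivity, fun t ht htb β hβ x' hx' => ?_⟩
  have hc : ∀ i, 0 ≤ t * β i ∧ t * β i ≤ b * M := fun i =>
    ⟨mul_nonneg ht (hβ i).1, mul_le_mul htb (hβ i).2 (hβ i).1 hb⟩
  constructor
  · simp_rw [expKernel_eq_prod]
    exact isOrthantMixture_prod hR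
      (fun i => (hK 0 (Or.inl rfl) _ (hc i).1 (hc i).2 _ (hx' i)).1)
      (fun i => (hK 0 (Or.inl rfl) _ (hc i).1 (hc i).2 _ (hx' i)).2)
  · intro l
    simp_rw [gradKernel_eq_prod]
    have he : ∀ i, (if i = l then 1 else 0 : ℕ) = 0 ∨ (if i = l then 1 else 0 : ℕ) = 1 := fun i => by
      split_ifs <;> simp
    exact isOrthantMixture_prod hR
      (fun i => (hK _ (he i) _ (hc i).1 (hc i).2 _ (hx' i)).1)
      (fun i => (hK _ (he i) _ (hc i).1 (hc i).2 _ (hx' i)).2)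

end Kernels

/-! ### Positive definiteness of the exponential kernels -/

section PositiveDefinite

/-- `φ` is a convolution square root of the kernel `κ`: the kernel is
`κ x x' = ∫ φ (s - x) φ (s - x') ds`, and the Fourier transform of `φ` vanishes nowhere. -/
structure IsConvRoot (κ : ℝ → ℝ → ℝ) (φ : ℝ → ℝ) : Prop where
  meas : Measurable φ
  bdd : ∃ C, ∀ s, |φ s| ≤ C
  int : Integrable φ
  kernel : ∀ x x', κ x x' = ∫ s, φ (s - x) * φ (s - x')
  fourier : ∀ ω : ℝ, ∫ s : ℝ, Complex.exp (Complex.I * ω * s) * (φ s : ℂ) ≠ 0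

/-- The Laplace kernel is the autocorrelation of a one-sided exponential. -/
theorem exists_isConvRoot_laplace {c : ℝ} (hc : 0 < c) :
    ∃ φ, IsConvRoot (fun x x' => Real.exp (-(c * |x - x'|))) φ := by
  set φ : ℝ → ℝ := (Set.Ioi 0).indicator fun s => √(2 * c) * Real.exp (-c * s) with hφ
  have hint : IntegrableOn (fun s => √(2 * c) * Real.exp (-c * s)) (Set.Ioi 0) :=
    (integrableOn_exp_mul_Ioi (by linarith) 0).const_mul _
  refine ⟨φ, ⟨?_, ⟨√(2 * c), fun s => ?_⟩, ?_, fun x x' => ?_, fun ω => ?_⟩⟩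
  · exact (by fun_prop : Measurable fun s => √(2 * c) * Real.exp (-c * s)).indicator
      measurableSet_Ioi
  · rw [hφ, Set.indicator_apply]
    split_ifs with h
    · rw [abs_of_nonneg (by positivity)]
      refine mul_le_of_le_one_right (by positivity) (Real.exp_le_one_iff.2 ?_)
      have : 0 < s := h
      nlinarith
    · simp
  · rwa [hφ, integrable_indicator_iff measurableSet_Ioi]
  · have h1 : (fun s => φ (s - x) * φ (s - x')) = (Set.Ioi (max x x')).indicator
        fun s => 2 * c * Real.exp (c * (x + x')) * Real.exp (-(2 * c) * s) := by
      ext s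
      simp only [hφ, Set.indicator_apply, Set.mem_Ioi, sub_pos, max_lt_iff]
      by_cases hx : x < s <;> by_cases hx' : x' < s <;> simp only [hx, hx', if_true, if_false,
        mul_zero, zero_mul, and_true, and_false, and_self]
      have h2 : √(2 * c) * √(2 * c) = 2 * c := Real.mul_self_sqrt (by positivity)
      have h3 : Real.exp (-c * (s - x)) * Real.exp (-c * (s - x')) =
          Real.exp (c * (x + x')) * Real.exp (-(2 * c) * s) := by
        rw [← Real.exp_add, ← Real.exp_add]; congr 1; ring
      calc _ = (√(2 * c) * √(2 * c)) *
            (Real.exp (-c * (s - x)) * Real.exp (-c * (s - x'))) := by ring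
        _ = _ := by rw [h2, h3]; ring
    rw [h1, integral_indicator measurableSet_Ioi, integral_const_mul,
      integral_exp_mul_Ioi (by linarith)]
    have h4 : -(c * |x - x'|) = c * (x + x') + -(2 * c) * max x x' := by
      rw [max_def]
      split_ifs with h
      · rw [abs_of_nonpos (by linarith)]; ring
      · rw [abs_of_nonneg (by linarith)]; ring
    rw [h4, Real.exp_add]
    field_simp
  · have h1 : (fun s : ℝ => Complex.exp (Complex.I * ω * s) * (φ s : ℂ)) = (Set.Ioi (0 : ℝ)).indicator
        fun s : ℝ => (√(2 * c) : ℂ) * Complex.exp ((Complex.I * ω - c) * s) := by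
      ext s
      simp only [hφ, Set.indicator_apply]
      split_ifs
      · push_cast
        rw [mul_left_comm, ← Complex.exp_add]
        congr 2; ring
      · simp
    have hre : (Complex.I * ω - c).re < 0 := by simp [hc]
    rw [h1, integral_indicator measurableSet_Ioi, integral_const_mul,
      integral_exp_mul_complex_Ioi hre]
    have h2 : Complex.I * ω - c ≠ 0 := fun h => by rw [h] at hre; simp at hre
    have h3 : √c ≠ 0 := (Real.sqrt_pos.2 hc).ne'
    simp [h2, h3]

/-- The Gaussian kernel is a multiple of the autocorrelation of a narrower Gaussian. -/
theorem exists_isConvRoot_gaussian {c : ℝ} (hc : 0 < c) :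
    ∃ φ, IsConvRoot (fun x x' => Real.exp (-(c * |x - x'| ^ 2))) φ := by
  set A : ℝ := √(√(Real.pi / (4 * c))⁻¹) with hA
  have hA0 : 0 < A := by positivity
  have hA2 : A * A * √(Real.pi / (4 * c)) = 1 := by
    have : 0 < √(Real.pi / (4 * c)) := by positivity
    rw [hA, Real.mul_self_sqrt (by positivity)]
    rw [Real.sqrt_inv]
    exact inv_mul_cancel₀ this.ne'
  have hint : Integrable fun s : ℝ => A * Real.exp (-(2 * c) * s ^ 2) :=
    (integrable_exp_neg_mul_sq (by positivity)).const_mul _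
  refine ⟨fun s => A * Real.exp (-(2 * c) * s ^ 2),
    ⟨by fun_prop, ⟨A, fun s => ?_⟩, hint, fun x x' => ?_, fun ω => ?_⟩⟩
  · rw [abs_of_nonneg (by positivity)]
    refine mul_le_of_le_one_right hA0.le (Real.exp_le_one_iff.2 ?_)
    nlinarith [sq_nonneg s]
  · have h1 : ∀ s, A * Real.exp (-(2 * c) * (s - x) ^ 2) * (A * Real.exp (-(2 * c) * (s - x') ^ 2)) =
        A * A * Real.exp (-(c * |x - x'| ^ 2)) *
          Real.exp (-(4 * c) * (s - (x + x') / 2) ^ 2) := fun s => by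
      have : Real.exp (-(2 * c) * (s - x) ^ 2) * Real.exp (-(2 * c) * (s - x') ^ 2) =
          Real.exp (-(c * |x - x'| ^ 2)) * Real.exp (-(4 * c) * (s - (x + x') / 2) ^ 2) := by
        rw [← Real.exp_add, ← Real.exp_add, sq_abs]; congr 1; ring
      calc _ = A * A * (Real.exp (-(2 * c) * (s - x) ^ 2) *
            Real.exp (-(2 * c) * (s - x') ^ 2)) := by ring
        _ = _ := by rw [this]; ring
    simp_rw [h1]
    rw [integral_const_mul, integral_sub_right_eq_self (fun s => Real.exp (-(4 * c) * s ^ 2)),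
      integral_gaussian]
    calc _ = Real.exp (-(c * |x - x'| ^ 2)) * (A * A * √(Real.pi / (4 * c))) := by
          rw [hA2, mul_one]
      _ = _ := by ring
  · have h1 : ∀ s : ℝ, Complex.exp (Complex.I * ω * s) *
        ((A * Real.exp (-(2 * c) * s ^ 2) : ℝ) : ℂ) =
        A * (Complex.exp (Complex.I * ω * s) * Complex.exp (-((2 * c : ℝ) : ℂ) * s ^ 2)) := fun s => by
      push_cast; ring
    have hre : 0 < (((2 * c : ℝ) : ℂ)).re := by
      rw [Complex.ofReal_re]; positivity
    simp_rw [h1]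
    rw [integral_const_mul, fourierIntegral_gaussian hre]
    have h2 : (((2 * c : ℝ) : ℂ)) ≠ 0 := by
      exact_mod_cast (by positivity : (2 * c : ℝ) ≠ 0)
    refine mul_ne_zero (by exact_mod_cast hA0.ne') (mul_ne_zero ?_ (Complex.exp_ne_zero _))
    rw [Ne, Complex.cpow_eq_zero_iff, not_and_or]
    exact Or.inl (div_ne_zero (by exact_mod_cast Real.pi_ne_zero) h2)

theorem exists_isConvRoot {q : ℕ} (hq : q = 1 ∨ q = 2) {c : ℝ} (hc : 0 < c) :
    ∃ φ, IsConvRoot (fun x x' => Real.exp (-(c * |x - x'| ^ q))) φ := by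
  rcases hq with rfl | rfl
  · simpa using exists_isConvRoot_laplace hc
  · exact exists_isConvRoot_gaussian hc

variable {Z : Type*} [MeasurableSpace Z] {ι : Type*} [Fintype ι]

/-- The quadratic form of a product of kernels with convolution square roots is the integral of the
square of `s ↦ E[a ∏ φ_i(s_i - X_i)]`. -/
theorem integral_integral_convRoot (Q : Measure Z) [IsProbabilityMeasure Q] {a : Z → ℝ}
    (ha : Measurable a) (ha1 : ∀ z, |a z| ≤ 1) {X : Z → ι → ℝ} (hX : Measurable X)
    {κ : ι → ℝ → ℝ → ℝ} {φ : ι → ℝ → ℝ} (h : ∀ i, IsConvRoot (κ i) (φ i)) :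
    Integrable (fun s : ι → ℝ => (∫ z, a z * ∏ i, φ i (s i - X z i) ∂Q) ^ 2) ∧
    ∫ z, a z * ∫ z', a z' * ∏ i, κ i (X z' i) (X z i) ∂Q ∂Q =
      ∫ s : ι → ℝ, (∫ z, a z * ∏ i, φ i (s i - X z i) ∂Q) ^ 2 := by
  choose C hC using fun i => (h i).bdd
  have hC0 : ∀ i, 0 ≤ C i := fun i => (abs_nonneg _).trans (hC i 0)
  set Φ : (ι → ℝ) → Z → ℝ := fun s z => ∏ i, φ i (s i - X z i) with hΦ
  have hΦm : Measurable fun w : (ι → ℝ) × Z => Φ w.1 w.2 := by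
    refine Finset.measurable_prod _ fun i _ => (h i).meas.comp ?_
    fun_prop
  have hΦb : ∀ s z, |Φ s z| ≤ ∏ i, C i := fun s z => by
    rw [hΦ]
    simp only
    rw [Finset.abs_prod]
    exact Finset.prod_le_prod (fun _ _ => abs_nonneg _) fun i _ => hC i _
  have hΦi : ∀ z, Integrable fun s => Φ s z := fun z =>
    Integrable.fintype_prod (f := fun i s => φ i (s - X z i)) fun i => (h i).int.comp_sub_right _
  have hΦn : ∀ z, ∫ s, ‖Φ s z‖ = ∏ i, ∫ s, |φ i s| := fun z => by
    have h1 : ∀ s, ‖Φ s z‖ = ∏ i, |φ i (s i - X z i)| := fun s => by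
      rw [Real.norm_eq_abs, hΦ]; simp only [Finset.abs_prod]
    simp_rw [h1]
    rw [integral_fintype_prod_volume_eq_prod (f := fun i s => |φ i (s - X z i)|)]
    exact Finset.prod_congr rfl fun i _ => integral_sub_right_eq_self (fun s => |φ i s|) _
  -- integrability of `a Φ` on `Q × ds`
  have hI1 : Integrable (fun w : Z × (ι → ℝ) => a w.1 * Φ w.2 w.1) (Q.prod volume) := by
    have hm : Measurable fun w : Z × (ι → ℝ) => a w.1 * Φ w.2 w.1 :=
      (ha.comp measurable_fst).mul (hΦm.comp (measurable_snd.prodMk measurable_fst))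
    rw [integrable_prod_iff hm.aestronglyMeasurable]
    refine ⟨Eventually.of_forall fun z => (hΦi z).const_mul (a z), ?_⟩
    have h1 : (fun z => ∫ s, ‖a z * Φ s z‖) = fun z => |a z| * ∏ i, ∫ s, |φ i s| := by
      ext z
      simp_rw [norm_mul]
      rw [integral_const_mul, hΦn, Real.norm_eq_abs]
    rw [h1]
    exact (Integrable.of_bound ha.abs.aestronglyMeasurable 1
      (Eventually.of_forall fun z => by simpa using ha1 z)).mul_const _
  set G : (ι → ℝ) → ℝ := fun s => ∫ z, a z * Φ s z ∂Q with hG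
  have hGi : Integrable G := hI1.integral_prod_right
  have hGb : ∀ s, |G s| ≤ ∏ i, C i := fun s => by
    have := norm_integral_le_of_norm_le_const (μ := Q) (f := fun z => a z * Φ s z)
      (C := ∏ i, C i) (Eventually.of_forall fun z => by
        rw [Real.norm_eq_abs, abs_mul]
        exact (mul_le_of_le_one_left (abs_nonneg _) (ha1 z)).trans (hΦb s z))
    simpa using this
  have hkern : ∀ z z', ∏ i, κ i (X z' i) (X z i) = ∫ s, Φ s z' * Φ s z := fun z z' => by
    simp_rw [hΦ, ← Finset.prod_mul_distrib]
    rw [integral_fintype_prod_volume_eq_prod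
      (f := fun i s => φ i (s - X z' i) * φ i (s - X z i))]
    exact Finset.prod_congr rfl fun i _ => (h i).kernel _ _
  have hinner : ∀ z, ∫ z', a z' * ∏ i, κ i (X z' i) (X z i) ∂Q = ∫ s, G s * Φ s z := fun z => by
    simp_rw [hkern, ← integral_const_mul, ← mul_assoc]
    rw [integral_integral_swap]
    · simp_rw [integral_mul_const]
      rfl
    · refine hI1.mul_bdd (c := ∏ i, C i)
        (hΦm.comp (measurable_snd.prodMk measurable_const)).aestronglyMeasurable
        (Eventually.of_forall fun w => ?_)
      rw [Real.norm_eq_abs]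
      exact hΦb _ _
  refine ⟨?_, ?_⟩
  · simp_rw [sq]
    refine hGi.mul_bdd (c := ∏ i, C i) hGi.aestronglyMeasurable (Eventually.of_forall fun s => ?_)
    rw [Real.norm_eq_abs]
    exact hGb s
  · simp_rw [hinner, ← integral_const_mul]
    rw [integral_integral_swap]
    · refine integral_congr_ae (Eventually.of_forall fun s => ?_)
      simp only
      have : ∀ z, a z * (G s * Φ s z) = G s * (a z * Φ s z) := fun z => by ring
      simp_rw [this]
      rw [integral_const_mul, sq]
    · have h1 : Integrable (fun w : Z × (ι → ℝ) => (a w.1 * Φ w.2 w.1) * G w.2)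
          (Q.prod volume) := by
        refine hI1.mul_bdd (c := ∏ i, C i) ?_ (Eventually.of_forall fun w => ?_)
        · exact hGi.aestronglyMeasurable.comp_snd
        · rw [Real.norm_eq_abs]
          exact hGb _
      refine h1.congr (Eventually.of_forall fun w => ?_)
      simp only [Function.uncurry]
      ring

theorem integral_integral_expKernel_nonneg (Q : Measure Z) [IsProbabilityMeasure Q] {q : ℕ}
    (hq : q = 1 ∨ q = 2) {a : Z → ℝ} (ha : Measurable a) (ha1 : ∀ z, |a z| ≤ 1)
    {X : Z → ι → ℝ} (hX : Measurable X) {c : ι → ℝ} (hc : ∀ i, 0 < c i) :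
    0 ≤ ∫ z, a z * ∫ z', a z' * ∏ i, Real.exp (-(c i * |X z' i - X z i| ^ q)) ∂Q ∂Q := by
  choose φ hφ using fun i => exists_isConvRoot hq (hc i)
  rw [(integral_integral_convRoot Q ha ha1 hX hφ).2]
  exact integral_nonneg fun s => by positivity

/-- If the quadratic form of the exponential kernel vanishes at `a`, so does the Fourier transform
of the signed measure `a Q` under `X`. -/
theorem integral_mul_cexp_eq_zero (Q : Measure Z) [IsProbabilityMeasure Q] {q : ℕ}
    (hq : q = 1 ∨ q = 2) {a : Z → ℝ} (ha : Measurable a) (ha1 : ∀ z, |a z| ≤ 1)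
    {X : Z → ι → ℝ} (hX : Measurable X) {c : ι → ℝ} (hc : ∀ i, 0 < c i)
    (h0 : ∫ z, a z * ∫ z', a z' * ∏ i, Real.exp (-(c i * |X z' i - X z i| ^ q)) ∂Q ∂Q = 0)
    (ω : ι → ℝ) : ∫ z, (a z : ℂ) * Complex.exp (Complex.I * ∑ i, (ω i : ℂ) * X z i) ∂Q = 0 := by
  choose φ hφ using fun i => exists_isConvRoot hq (hc i)
  obtain ⟨hi, he⟩ := integral_integral_convRoot Q ha ha1 hX hφ
  rw [h0, eq_comm, integral_eq_zero_iff_of_nonneg (fun s => by positivity) hi] at he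
  choose C hC using fun i => (hφ i).bdd
  -- the Fourier transform of `s ↦ E[a ∏ φ_i(s_i - X_i)]`, computed in two ways
  set E : (ι → ℝ) → ℂ := fun s => ∏ i, Complex.exp (Complex.I * ω i * s i) with hE
  have hEn : ∀ s, ‖E s‖ = 1 := fun s => by
    rw [hE]
    simp only [norm_prod]
    refine Finset.prod_eq_one fun i _ => ?_
    rw [mul_assoc, mul_comm, ← Complex.ofReal_mul, Complex.norm_exp_ofReal_mul_I]
  have hEm : Measurable E := by
    rw [hE]
    refine Finset.measurable_prod _ fun i _ => ?_
    fun_prop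
  have hzero : ∫ s, E s * ((∫ z, a z * ∏ i, φ i (s i - X z i) ∂Q : ℝ) : ℂ) = 0 := by
    refine integral_eq_zero_of_ae ?_
    filter_upwards [he] with s hs
    have : ∫ z, a z * ∏ i, φ i (s i - X z i) ∂Q = 0 := by simpa using hs
    simp [this]
  have hm : Measurable fun w : (ι → ℝ) × Z => a w.2 * ∏ i, φ i (w.1 i - X w.2 i) := by
    refine (ha.comp measurable_snd).mul
      (Finset.measurable_prod _ fun i _ => (hφ i).meas.comp ?_)
    fun_prop
  have hint : Integrable (fun w : (ι → ℝ) × Z =>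
      E w.1 * ((a w.2 * ∏ i, φ i (w.1 i - X w.2 i) : ℝ) : ℂ)) (volume.prod Q) := by
    have hr : Integrable (fun w : (ι → ℝ) × Z => a w.2 * ∏ i, φ i (w.1 i - X w.2 i))
        (volume.prod Q) := by
      rw [integrable_prod_iff' hm.aestronglyMeasurable]
      refine ⟨Eventually.of_forall fun z => (Integrable.fintype_prod
        (f := fun i s => φ i (s - X z i)) fun i => (hφ i).int.comp_sub_right _).const_mul (a z), ?_⟩
      have h1 : (fun z => ∫ s : ι → ℝ, ‖a z * ∏ i, φ i (s i - X z i)‖) =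
          fun z => |a z| * ∏ i, ∫ s, |φ i s| := by
        ext z
        simp_rw [norm_mul, norm_prod, Real.norm_eq_abs]
        rw [integral_const_mul,
          integral_fintype_prod_volume_eq_prod (f := fun i s => |φ i (s - X z i)|)]
        congr 1
        exact Finset.prod_congr rfl fun i _ => integral_sub_right_eq_self (fun s => |φ i s|) _
      rw [h1]
      exact (Integrable.of_bound ha.abs.aestronglyMeasurable 1
        (Eventually.of_forall fun z => by simpa using ha1 z)).mul_const _
    refine (hr.ofReal (𝕜 := ℂ)).bdd_mul (c := 1) (hEm.comp measurable_fst).aestronglyMeasurable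
      (Eventually.of_forall fun w => (hEn _).le)
  have hswap : ∫ s, E s * ((∫ z, a z * ∏ i, φ i (s i - X z i) ∂Q : ℝ) : ℂ) =
      ∫ z, (a z : ℂ) * Complex.exp (Complex.I * ∑ i, (ω i : ℂ) * X z i) *
        (∏ i, ∫ s : ℝ, Complex.exp (Complex.I * ω i * s) * (φ i s : ℂ)) ∂Q := by
    have h1 : ∀ s, E s * ((∫ z, a z * ∏ i, φ i (s i - X z i) ∂Q : ℝ) : ℂ) =
        ∫ z, E s * ((a z * ∏ i, φ i (s i - X z i) : ℝ) : ℂ) ∂Q := fun s => by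
      rw [integral_const_mul, integral_complex_ofReal]
    simp_rw [h1]
    rw [integral_integral_swap hint]
    refine integral_congr_ae (Eventually.of_forall fun z => ?_)
    simp only
    have h2 : ∀ s : ι → ℝ, E s * ((a z * ∏ i, φ i (s i - X z i) : ℝ) : ℂ) =
        (a z : ℂ) * ∏ i, (Complex.exp (Complex.I * ω i * s i) * (φ i (s i - X z i) : ℂ)) :=
      fun s => by
        rw [Finset.prod_mul_distrib, hE]
        push_cast
        ring
    simp_rw [h2]
    rw [integral_const_mul, integral_fintype_prod_volume_eq_prod
      (f := fun i (s : ℝ) => Complex.exp (Complex.I * ω i * s) * (φ i (s - X z i) : ℂ)), mul_assoc,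
      Finset.mul_sum, Complex.exp_sum, ← Finset.prod_mul_distrib]
    congr 1
    refine Finset.prod_congr rfl fun i _ => ?_
    rw [← integral_const_mul, ← integral_add_right_eq_self _ (X z i)]
    refine integral_congr_ae (Eventually.of_forall fun s => ?_)
    simp only [add_sub_cancel_right]
    rw [← mul_assoc, ← Complex.exp_add]
    congr 2
    push_cast
    ring
  rw [hswap, integral_mul_const] at hzero
  exact (mul_eq_zero.1 hzero).resolve_right
    (Finset.prod_ne_zero_iff.2 fun i _ => (hφ i).fourier (ω i))

end PositiveDefinite

/-! ### Residuals of the response -/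

theorem integral_mul_eq_integral_condExp_mul {Ω : Type*} {m m₀ : MeasurableSpace Ω} (hm : m ≤ m₀)
    {P : Measure Ω} [IsFiniteMeasure P] {g f : Ω → ℝ} (hg : Integrable g P) (hf : Measurable[m] f)
    {C : ℝ} (hfC : ∀ᵐ z ∂P, |f z| ≤ C) : ∫ z, g z * f z ∂P = ∫ z, (P[g | m]) z * f z ∂P := by
  rw [← integral_condExp (f := fun z => g z * f z) hm]
  refine integral_congr_ae ?_
  have h1 : Integrable (g * f) P :=
    hg.mul_bdd (c := C) (hf.mono hm le_rfl).aestronglyMeasurable hfC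
  exact condExp_mul_of_stronglyMeasurable_right hf.stronglyMeasurable h1 hg

section Residual

variable {p : ℕ}

/-- The σ-algebra generated by the features in `A`. -/
abbrev featureSigma (A : Finset (Fin p)) : MeasurableSpace (DataPoint p) :=
  MeasurableSpace.comap (subfeatures A) inferInstance

/-- The σ-algebra generated by all features. -/
abbrev allSigma (p : ℕ) : MeasurableSpace (DataPoint p) :=
  MeasurableSpace.comap (Prod.fst : DataPoint p → (Fin p → ℝ)) inferInstance

theorem measurable_subfeatures (A : Finset (Fin p)) : Measurable (subfeatures A) := by
  unfold subfeatures
  fun_prop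

theorem featureSigma_le (A : Finset (Fin p)) :
    featureSigma A ≤ (inferInstance : MeasurableSpace (DataPoint p)) :=
  (measurable_subfeatures A).comap_le

theorem allSigma_le (p : ℕ) : allSigma p ≤ (inferInstance : MeasurableSpace (DataPoint p)) :=
  measurable_fst.comap_le

theorem featureSigma_le_allSigma (A : Finset (Fin p)) : featureSigma A ≤ allSigma p := by
  have h : subfeatures A = (fun (x : Fin p → ℝ) (i : A) => x i) ∘ Prod.fst := rfl
  rw [featureSigma, h, ← MeasurableSpace.comap_comp]
  exact MeasurableSpace.comap_mono (Measurable.comap_le (by fun_prop))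

theorem featureSigma_mono {A B : Finset (Fin p)} (h : A ⊆ B) : featureSigma A ≤ featureSigma B := by
  have h' : subfeatures A = (fun (x : B → ℝ) (i : A) => x ⟨i, h i.2⟩) ∘ subfeatures B := rfl
  rw [featureSigma, h', ← MeasurableSpace.comap_comp]
  exact MeasurableSpace.comap_mono (Measurable.comap_le (by fun_prop))

/-- Truncation to `[-1, 1]`. -/
noncomputable def clip (y : ℝ) : ℝ := max (-1) (min 1 y)

theorem abs_clip_le (y : ℝ) : |clip y| ≤ 1 := by
  unfold clip
  exact abs_le.2 ⟨le_max_left _ _, max_le (by norm_num) (min_le_left _ _)⟩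

theorem clip_eq_self {y : ℝ} (hy : |y| ≤ 1) : clip y = y := by
  obtain ⟨h1, h2⟩ := abs_le.1 hy
  rw [clip, min_eq_right h2, max_eq_right h1]

theorem measurable_clip : Measurable clip := by unfold clip; fun_prop

/-- A version of `E[Y | X_A]` with values in `[-1, 1]`. -/
noncomputable def condMean (Q : Measure (DataPoint p)) (A : Finset (Fin p)) (z : DataPoint p) : ℝ :=
  clip ((Q[(Prod.snd : DataPoint p → ℝ) | featureSigma A]) z)

/-- A bounded version of half the residual, `(Y - E[Y | X_A]) / 2`. -/
noncomputable def halfResidual (Q : Measure (DataPoint p)) (A : Finset (Fin p))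
    (z : DataPoint p) : ℝ :=
  (clip z.2 - condMean Q A z) / 2

variable (Q : Measure (DataPoint p))

theorem measurable_condMean (A : Finset (Fin p)) : Measurable[featureSigma A] (condMean Q A) :=
  measurable_clip.comp (stronglyMeasurable_condExp.measurable)

theorem abs_condMean_le (A : Finset (Fin p)) (z : DataPoint p) : |condMean Q A z| ≤ 1 :=
  abs_clip_le _

theorem measurable_halfResidual (A : Finset (Fin p)) : Measurable (halfResidual Q A) :=
  ((measurable_clip.comp measurable_snd).sub
    ((measurable_condMean Q A).mono (featureSigma_le A) le_rfl)).div_const _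

theorem abs_halfResidual_le (A : Finset (Fin p)) (z : DataPoint p) : |halfResidual Q A z| ≤ 1 := by
  rw [halfResidual, abs_div, abs_two, div_le_iff₀ (by norm_num)]
  refine (abs_sub _ _).trans ?_
  linarith [abs_clip_le z.2, abs_condMean_le Q A z]

theorem ae_abs_response_le {Q : Measure (DataPoint p)}
    (hY : ∀ᵐ z ∂Q, z.2 = 1 ∨ z.2 = -1) : ∀ᵐ z ∂Q, |z.2| ≤ 1 := by
  filter_upwards [hY] with z hz
  rcases hz with h | h <;> simp [h]

variable {Q}

theorem condMean_ae_eq (hY : ∀ᵐ z ∂Q, z.2 = 1 ∨ z.2 = -1)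
    (A : Finset (Fin p)) :
    condMean Q A =ᵐ[Q] Q[(Prod.snd : DataPoint p → ℝ) | featureSigma A] := by
  filter_upwards [ae_bdd_abs_condExp_of_ae_bdd_abs (m := featureSigma A) (μ := Q) (R := (1 : ℝ))
    (f := (Prod.snd : DataPoint p → ℝ)) (ae_abs_response_le hY)] with z hz
  exact clip_eq_self hz

variable [IsProbabilityMeasure Q]

theorem integrable_response (hY : ∀ᵐ z ∂Q, z.2 = 1 ∨ z.2 = -1) :
    Integrable (Prod.snd : DataPoint p → ℝ) Q :=
  Integrable.of_bound measurable_snd.aestronglyMeasurable 1 (ae_abs_response_le hY)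

theorem integral_response_mul (hY : ∀ᵐ z ∂Q, z.2 = 1 ∨ z.2 = -1)
    (m : MeasurableSpace (DataPoint p)) (hm : m ≤ Prod.instMeasurableSpace) {f : DataPoint p → ℝ}
    (hf : Measurable[m] f) {C : ℝ} (hfC : ∀ᵐ z ∂Q, |f z| ≤ C) :
    ∫ z, z.2 * f z ∂Q = ∫ z, (Q[(Prod.snd : DataPoint p → ℝ) | m]) z * f z ∂Q :=
  integral_mul_eq_integral_condExp_mul hm (integrable_response hY) hf hfC

/-- The residual is orthogonal to the functions of `X_A`. -/
theorem integral_halfResidual_mul_eq_zero (hY : ∀ᵐ z ∂Q, z.2 = 1 ∨ z.2 = -1)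
    (A : Finset (Fin p)) {f : DataPoint p → ℝ}
    (hf : Measurable[featureSigma A] f) {C : ℝ} (hfC : ∀ᵐ z ∂Q, |f z| ≤ C) :
    ∫ z, halfResidual Q A z * f z ∂Q = 0 := by
  have hfm := (hf.mono (featureSigma_le A) le_rfl).aestronglyMeasurable (μ := Q)
  have h1 : ∀ᵐ z ∂Q, halfResidual Q A z * f z =
      (z.2 * f z - (Q[(Prod.snd : DataPoint p → ℝ) | featureSigma A]) z * f z) / 2 := by
    filter_upwards [ae_abs_response_le hY, condMean_ae_eq hY A] with z hz1 hz2
    rw [halfResidual, clip_eq_self hz1, hz2]; ring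
  rw [integral_congr_ae h1, integral_div, integral_sub,
    integral_response_mul hY _ (featureSigma_le A) hf hfC, sub_self, zero_div]
  · exact (integrable_response hY).mul_bdd (c := C) hfm hfC
  · exact integrable_condExp.mul_bdd (c := C) hfm hfC

/-- The weight `Q(Y = -y | X_A = x_A)` times the response is the residual `(y - E[Y | X_A]) / 2`:
reweighting recentres the response. -/
theorem flipWeight_mul_response (hY : ∀ᵐ z ∂Q, z.2 = 1 ∨ z.2 = -1)
    (A : Finset (Fin p)) :
    ∀ᵐ z ∂Q, flipWeight Q A z * z.2 = halfResidual Q A z := by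
  have hcond : ∀ y : ℝ, (y = 1 ∨ y = -1) → ∀ᵐ z ∂Q,
      (condDistrib (Prod.snd : DataPoint p → ℝ) (subfeatures A) Q (subfeatures A z)).real {y} =
        (1 + y * condMean Q A z) / 2 := by
    intro y hy
    have h1 := condDistrib_ae_eq_condExp (μ := Q) (measurable_subfeatures A)
      (measurable_snd : Measurable (Prod.snd : DataPoint p → ℝ)) (measurableSet_singleton y)
    classical
    have h2 : (Prod.snd ⁻¹' {y} : Set (DataPoint p)).indicator (fun _ => (1 : ℝ)) =ᵐ[Q]
        fun z => (1 / 2 : ℝ) + (y / 2) • z.2 := by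
      filter_upwards [hY] with z hz
      rw [Set.indicator_apply]
      rcases hz with h | h <;> rcases hy with h' | h' <;> simp [h, h'] <;> norm_num
    have h3 := condExp_congr_ae (m := featureSigma A) h2
    have h4 : Q[fun z : DataPoint p => (1 / 2 : ℝ) + (y / 2) • z.2 | featureSigma A] =ᵐ[Q]
        Q[fun _ : DataPoint p => (1 / 2 : ℝ) | featureSigma A] +
          Q[(y / 2) • (Prod.snd : DataPoint p → ℝ) | featureSigma A] :=
      condExp_add (f := fun _ : DataPoint p => (1 / 2 : ℝ))
        (g := (y / 2) • (Prod.snd : DataPoint p → ℝ)) (integrable_const _)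
        ((integrable_response hY).smul _) _
    have h5 := condExp_smul (μ := Q) (y / 2) (Prod.snd : DataPoint p → ℝ) (featureSigma A)
    filter_upwards [h1, h3, h4, h5, condMean_ae_eq hY A] with z h1 h3 h4 h5 h6
    rw [h1, h3, h4, Pi.add_apply, h5, condExp_const (featureSigma_le A), Pi.smul_apply, ← h6,
      smul_eq_mul]
    ring
  filter_upwards [hY, hcond 1 (Or.inl rfl), hcond (-1) (Or.inr rfl), ae_abs_response_le hY]
    with z hz h1 h2 h3
  rw [halfResidual, clip_eq_self h3, flipWeight]
  rcases hz with h | h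
  · rw [h, h2]; ring
  · rw [h, neg_neg, h1]; ring

theorem flipWeight_nonneg (A : Finset (Fin p)) (z : DataPoint p) : 0 ≤ flipWeight Q A z :=
  measureReal_nonneg

theorem flipWeight_le_one (A : Finset (Fin p)) (z : DataPoint p) : flipWeight Q A z ≤ 1 := by
  unfold flipWeight
  exact measureReal_le_one

/-- The mean weight is positive when the response is not a function of the features. -/
theorem integral_halfResidual_mul_clip_pos (hY : ∀ᵐ z ∂Q, z.2 = 1 ∨ z.2 = -1)
    (hY_var : 0 < ∫ z, (Var[(Prod.snd : DataPoint p → ℝ); Q | allSigma p]) z ∂Q)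
    (A : Finset (Fin p)) : 0 < ∫ z, halfResidual Q A z * clip z.2 ∂Q := by
  have hae : ∀ᵐ z ∂Q, halfResidual Q A z * clip z.2 = flipWeight Q A z := by
    filter_upwards [flipWeight_mul_response hY A, hY, ae_abs_response_le hY] with z h1 h2 h3
    rw [← h1, clip_eq_self h3, mul_assoc]
    rcases h2 with h | h <;> simp [h]
  have hnn : 0 ≤ᵐ[Q] fun z => halfResidual Q A z * clip z.2 := by
    filter_upwards [hae] with z hz
    rw [hz]
    exact flipWeight_nonneg A z
  have hint : Integrable (fun z => halfResidual Q A z * clip z.2) Q := by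
    refine Integrable.of_bound ((measurable_halfResidual Q A).mul
      (measurable_clip.comp measurable_snd)).aestronglyMeasurable 1
      (Eventually.of_forall fun z => ?_)
    rw [Real.norm_eq_abs, abs_mul]
    exact mul_le_one₀ (abs_halfResidual_le Q A z) (abs_nonneg _) (abs_clip_le _)
  refine lt_of_le_of_ne (integral_nonneg_of_ae hnn) fun h0 => ?_
  -- if all weights vanish, `Y = E[Y | X_A]` is a function of `X`
  have h1 := (integral_eq_zero_iff_of_nonneg_ae hnn hint).1 h0.symm
  have h2 : (Prod.snd : DataPoint p → ℝ) =ᵐ[Q] condMean Q A := by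
    filter_upwards [h1, hae, flipWeight_mul_response hY A, ae_abs_response_le hY]
      with z h1 h2 h3 h4
    rw [← h2, h1] at h3
    rw [halfResidual, clip_eq_self h4] at h3
    simp only [Pi.zero_apply, zero_mul] at h3
    linarith
  have h3 := condVar_congr_ae (m := allSigma p) h2
  have h4 : Var[condMean Q A; Q | allSigma p] = 0 ∨
      Var[condMean Q A; Q | allSigma p] =ᵐ[Q] 0 := by
    right
    have hsm : StronglyMeasurable[allSigma p] (condMean Q A) :=
      ((measurable_condMean Q A).mono (featureSigma_le_allSigma A) le_rfl).stronglyMeasurable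
    have hi : Integrable (condMean Q A) Q := integrable_condExp.congr (condMean_ae_eq hY A).symm
    have h5 := condExp_of_stronglyMeasurable (allSigma_le p) hsm hi
    rw [condVar, h5]
    simp
  rw [integral_congr_ae h3] at hY_var
  rcases h4 with h4 | h4
  · rw [h4] at hY_var; simp at hY_var
  · rw [integral_congr_ae h4] at hY_var; simp at hY_var

/-- If the Fourier transform of the signed measure `(Y - E[Y | X_A]) Q` under `X` vanishes, then
`X_A` carries all the information of `X` on the mean of the response. -/
theorem isSufficient_of_fourier_eq_zero (hY : ∀ᵐ z ∂Q, z.2 = 1 ∨ z.2 = -1)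
    (A : Finset (Fin p))
    (h : ∀ ω : Fin p → ℝ, ∫ z, (halfResidual Q A z : ℂ) *
      Complex.exp (Complex.I * ∑ i, (ω i : ℂ) * z.1 i) ∂Q = 0) : IsSufficient Q A := by
  set r := halfResidual Q A with hr
  have hrm : Measurable r := measurable_halfResidual Q A
  have hr1 : ∀ z, |r z| ≤ 1 := abs_halfResidual_le Q A
  -- positive and negative parts of the signed measure
  set νp : Measure (Fin p → ℝ) :=
    (Q.withDensity fun z => ((Real.toNNReal (r z) : NNReal) : ENNReal)).map Prod.fst with hνp
  set νn : Measure (Fin p → ℝ) :=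
    (Q.withDensity fun z => ((Real.toNNReal (-r z) : NNReal) : ENNReal)).map Prod.fst with hνn
  have hfin : ∀ s : DataPoint p → ℝ, Measurable s → (∀ z, |s z| ≤ 1) → IsFiniteMeasure
      (Q.withDensity fun z => ((Real.toNNReal (s z) : NNReal) : ENNReal)) := fun s _ hs => by
    refine isFiniteMeasure_withDensity ?_
    refine ne_top_of_le_ne_top (b := 1) ENNReal.one_ne_top ?_
    calc _ ≤ ∫⁻ _, 1 ∂Q := by
          gcongr with z
          exact_mod_cast Real.toNNReal_le_one.2 ((le_abs_self _).trans (hs z))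
      _ = 1 := by simp
  have := hfin r hrm hr1
  have := hfin (fun z => -r z) hrm.neg (by simpa using hr1)
  have hneg : Measurable fun z => Real.toNNReal (-r z) := hrm.neg.real_toNNReal
  have hchar : νp = νn := by
    refine Measure.ext_of_charFunDual (funext fun L => ?_)
    rw [charFunDual_apply, charFunDual_apply, hνp, hνn,
      integral_map measurable_fst.aemeasurable (by fun_prop),
      integral_map measurable_fst.aemeasurable (by fun_prop),
      integral_withDensity_eq_integral_smul hrm.real_toNNReal,
      integral_withDensity_eq_integral_smul hneg]
    have hL : ∀ x : Fin p → ℝ, L x = ∑ i, L (Pi.single i 1) * x i := fun x => by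
      conv_lhs => rw [← Finset.univ_sum_single x]
      rw [map_sum]
      refine Finset.sum_congr rfl fun i _ => ?_
      have : (Pi.single i (x i) : Fin p → ℝ) = x i • Pi.single i 1 := by
        rw [← Pi.single_smul, smul_eq_mul, mul_one]
      rw [this, map_smul, smul_eq_mul, mul_comm]
    have hb : ∀ (s : DataPoint p → ℝ), Measurable s → (∀ z, |s z| ≤ 1) → Integrable
        (fun z => Real.toNNReal (s z) • Complex.exp (L z.1 * Complex.I)) Q := fun s hsm hs => by
      refine Integrable.of_bound ?_ 1 (Eventually.of_forall fun z => ?_)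
      · refine (Measurable.smul hsm.real_toNNReal ?_).aestronglyMeasurable
        fun_prop
      · rw [NNReal.smul_def, norm_smul, Complex.norm_exp_ofReal_mul_I, mul_one]
        rw [Real.norm_eq_abs, NNReal.abs_eq]
        exact_mod_cast Real.toNNReal_le_one.2 ((le_abs_self _).trans (hs z))
    rw [← sub_eq_zero, ← integral_sub (hb r hrm hr1)
      (hb (fun z => -r z) hrm.neg (by simpa using hr1))]
    rw [← h fun i => L (Pi.single i 1)]
    refine integral_congr_ae (Eventually.of_forall fun z => ?_)
    simp only [NNReal.smul_def, Real.coe_toNNReal']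
    rw [← sub_smul, hL z.1]
    have h1 : max (r z) 0 - max (-r z) 0 = r z := by
      rcases le_total 0 (r z) with h | h
      · rw [max_eq_left h, max_eq_right (by linarith)]; ring
      · rw [max_eq_right h, max_eq_left (by linarith)]; ring
    rw [h1, Complex.real_smul]
    congr 2
    push_cast
    ring
  -- hence the residual integrates to zero over every event of `X`
  have hset : ∀ E : Set (Fin p → ℝ), MeasurableSet E → ∫ z in Prod.fst ⁻¹' E, r z ∂Q = 0 := by
    intro E hE
    have h1 := congrArg (fun ν => ν.real E) hchar
    simp only [hνp, hνn, measureReal_def] at h1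
    rw [Measure.map_apply measurable_fst hE, Measure.map_apply measurable_fst hE,
      withDensity_apply _ (measurable_fst hE), withDensity_apply _ (measurable_fst hE)] at h1
    have hri : Integrable r (Q.restrict (Prod.fst ⁻¹' E)) :=
      Integrable.of_bound hrm.aestronglyMeasurable 1
        (Eventually.of_forall fun z => by simpa using hr1 z)
    rw [integral_eq_lintegral_pos_part_sub_lintegral_neg_part hri, sub_eq_zero]
    exact h1
  rw [IsSufficient]
  refine (ae_eq_condExp_of_forall_setIntegral_eq (allSigma_le p) (integrable_response hY)
    (fun s _ _ => integrable_condExp.integrableOn) ?_ ?_).symm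
  · rintro s ⟨E, hE, rfl⟩ -
    have h1 : ∫ z in Prod.fst ⁻¹' E, r z ∂Q =
        (∫ z in Prod.fst ⁻¹' E, z.2 ∂Q - ∫ z in Prod.fst ⁻¹' E,
          (Q[(Prod.snd : DataPoint p → ℝ) | featureSigma A]) z ∂Q) / 2 := by
      rw [← integral_sub (integrable_response hY).integrableOn integrable_condExp.integrableOn,
        ← integral_div]
      refine integral_congr_ae (ae_restrict_of_ae ?_)
      filter_upwards [ae_abs_response_le hY, condMean_ae_eq hY A] with z hz1 hz2
      rw [hr, halfResidual, clip_eq_self hz1, hz2]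
    rw [hset E hE] at h1
    have h2 : ∫ z in Prod.fst ⁻¹' E, z.2 ∂Q = ∫ z in Prod.fst ⁻¹' E,
          (Q[(Prod.snd : DataPoint p → ℝ) | featureSigma A]) z ∂Q := by linarith
    exact h2.symm
  · exact (stronglyMeasurable_condExp.mono (featureSigma_le_allSigma A)).aestronglyMeasurable

end Residual

/-! ### Self-penalization -/

theorem exists_pos_forall_le_of_finite {ι : Type*} [Finite ι] {f : ι → ℝ} (hf : ∀ i, 0 < f i) :
    ∃ m, 0 < m ∧ ∀ i, m ≤ f i := by
  have h1 : ∀ᶠ m : ℝ in 𝓝[>] 0, ∀ i, m ≤ f i :=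
    eventually_all.2 fun i => Filter.mem_of_superset (Ioc_mem_nhdsGT (hf i)) fun m hm => hm.2
  obtain ⟨m, h2, h3⟩ := (h1.and self_mem_nhdsWithin).exists
  exact ⟨m, h3, h2⟩

section SelfPenalization

variable {p : ℕ} {Q : Measure (DataPoint p)}

theorem pairMean_expKernel_eq_prod (q : ℕ) (t : ℝ) (β : EuclideanSpace ℝ (Fin p))
    (a : DataPoint p → ℝ) : pairMean Q a (expKernel q t β) =
      ∫ z, a z * ∫ z', a z' * ∏ i, Real.exp (-(t * β i * |z'.1 i - z.1 i| ^ q)) ∂Q ∂Q := by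
  have h : ∀ x x' : Fin p → ℝ, expKernel q t β x x' =
      ∏ i, Real.exp (-(t * β i * |x i - x' i| ^ q)) := fun x x' => by
    rw [expKernel_eq_prod]
    simp [coordFactor]
  simp only [pairMean, h]

variable [IsProbabilityMeasure Q]

theorem abs_integral_le_of_ae_abs_le {f : DataPoint p → ℝ} {C : ℝ} (h : ∀ᵐ z ∂Q, |f z| ≤ C) :
    |∫ z, f z ∂Q| ≤ C := by
  simpa using norm_integral_le_of_norm_le_const (μ := Q) (f := f) h

/-- Against functions of the features, the residual is a function of the features in `S`. -/
theorem integral_halfResidual_mul_eq (hY : ∀ᵐ z ∂Q, z.2 = 1 ∨ z.2 = -1) {S : Finset (Fin p)}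
    (hS : IsSufficient Q S) (A : Finset (Fin p)) {h : DataPoint p → ℝ}
    (hh : Measurable[allSigma p] h) {C : ℝ} (hC : ∀ᵐ z ∂Q, |h z| ≤ C) :
    ∫ z, halfResidual Q A z * h z ∂Q =
      ∫ z, (condMean Q S z - condMean Q A z) / 2 * h z ∂Q := by
  have hhm := (hh.mono (allSigma_le p) le_rfl).aestronglyMeasurable (μ := Q)
  have hcm : ∀ B, Integrable (fun z => condMean Q B z * h z) Q := fun B =>
    (integrable_condExp.congr (condMean_ae_eq hY B).symm).mul_bdd (c := C) hhm hC
  have h1 : ∀ᵐ z ∂Q, halfResidual Q A z * h z = (z.2 * h z - condMean Q A z * h z) / 2 := by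
    filter_upwards [ae_abs_response_le hY] with z hz1
    rw [halfResidual, clip_eq_self hz1]; ring
  have h2 : ∀ z, (condMean Q S z - condMean Q A z) / 2 * h z =
      (condMean Q S z * h z - condMean Q A z * h z) / 2 := fun z => by ring
  have h3 : ∫ z, z.2 * h z ∂Q = ∫ z, condMean Q S z * h z ∂Q := by
    rw [integral_response_mul hY _ (allSigma_le p) hh hC]
    refine integral_congr_ae ?_
    filter_upwards [hS, condMean_ae_eq hY S] with z h4 h5
    rw [h5, ← h4]
  simp only [h2]
  rw [integral_congr_ae h1, integral_div, integral_div, integral_sub _ (hcm A),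
    integral_sub (hcm S) (hcm A), h3]
  exact (integrable_response hY).mul_bdd (c := C) hhm hC

/-- The noise features factor out of integrals against the residual. -/
theorem integral_halfResidual_mul_mul (hY : ∀ᵐ z ∂Q, z.2 = 1 ∨ z.2 = -1) {S A : Finset (Fin p)}
    (hS : IsSufficient Q S) (hind : IndepFun (subfeatures S) (subfeatures Sᶜ) Q) (hA : A ⊆ S)
    {f g : DataPoint p → ℝ} (hf : Measurable[featureSigma S] f) {B : ℝ}
    (hfB : ∀ᵐ z ∂Q, |f z| ≤ B) (hg : Measurable[featureSigma Sᶜ] g) {C : ℝ}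
    (hgC : ∀ᵐ z ∂Q, |g z| ≤ C) :
    ∫ z, halfResidual Q A z * (f z * g z) ∂Q =
      (∫ z, halfResidual Q A z * f z ∂Q) * ∫ z, g z ∂Q := by
  have hb : Measurable[featureSigma S] fun z => (condMean Q S z - condMean Q A z) / 2 :=
    ((measurable_condMean Q S).sub
      ((measurable_condMean Q A).mono (featureSigma_mono hA) le_rfl)).div_const _
  have hbf : Measurable[featureSigma S] fun z => (condMean Q S z - condMean Q A z) / 2 * f z :=
    hb.mul hf
  have hf' := hf.mono (featureSigma_le_allSigma S) le_rfl
  have hg' := hg.mono (featureSigma_le_allSigma Sᶜ) le_rfl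
  have hfg : ∀ᵐ z ∂Q, |f z * g z| ≤ B * C := by
    filter_upwards [hfB, hgC] with z h1 h2
    rw [abs_mul]
    exact mul_le_mul h1 h2 (abs_nonneg _) ((abs_nonneg _).trans h1)
  have hI : IndepFun (fun z => (condMean Q S z - condMean Q A z) / 2 * f z) g Q := by
    rw [IndepFun_iff_Indep] at hind ⊢
    exact indep_of_indep_of_le_right (indep_of_indep_of_le_left hind hbf.comap_le) hg.comap_le
  rw [integral_halfResidual_mul_eq hY hS A (h := fun z => f z * g z) (hf'.mul hg') hfg,
    integral_halfResidual_mul_eq hY hS A hf' hfB,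
    ← hI.integral_fun_mul_eq_mul_integral
      (hbf.mono (featureSigma_le S) le_rfl).aestronglyMeasurable
      (hg.mono (featureSigma_le _) le_rfl).aestronglyMeasurable]
  refine integral_congr_ae (Eventually.of_forall fun z => ?_)
  ring

/-- The quadratic form of a product of a kernel of the signal features and a kernel of the noise
features. -/
theorem pairMean_mul (hY : ∀ᵐ z ∂Q, z.2 = 1 ∨ z.2 = -1) {S A : Finset (Fin p)}
    (hS : IsSufficient Q S) (hind : IndepFun (subfeatures S) (subfeatures Sᶜ) Q) (hA : A ⊆ S)
    {κ : (S → ℝ) → (S → ℝ) → ℝ} (hκ : Measurable (Function.uncurry κ))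
    (hκ1 : ∀ u v, |κ u v| ≤ 1)
    {χ : ((Sᶜ : Finset (Fin p)) → ℝ) → ((Sᶜ : Finset (Fin p)) → ℝ) → ℝ}
    (hχ : Measurable (Function.uncurry χ)) {C : ℝ}
    (hχC : ∀ᵐ z ∂Q, ∀ᵐ z' ∂Q, |χ (subfeatures Sᶜ z') (subfeatures Sᶜ z)| ≤ C) :
    ∫ z, halfResidual Q A z * ∫ z', halfResidual Q A z' *
        (κ (subfeatures S z') (subfeatures S z) *
          χ (subfeatures Sᶜ z') (subfeatures Sᶜ z)) ∂Q ∂Q =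
      (∫ z, halfResidual Q A z * ∫ z', halfResidual Q A z' *
        κ (subfeatures S z') (subfeatures S z) ∂Q ∂Q) *
      ∫ z, ∫ z', χ (subfeatures Sᶜ z') (subfeatures Sᶜ z) ∂Q ∂Q := by
  have hsec : ∀ {T : Finset (Fin p)} {k : (T → ℝ) → (T → ℝ) → ℝ},
      Measurable (Function.uncurry k) → ∀ v, Measurable[featureSigma T]
        fun z : DataPoint p => k (subfeatures T z) v := fun {T k} hk v =>
    (hk.comp (measurable_id.prodMk measurable_const)).comp (comap_measurable (subfeatures T))
  have h1 : ∀ᵐ z ∂Q, ∫ z', halfResidual Q A z' * (κ (subfeatures S z') (subfeatures S z) *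
      χ (subfeatures Sᶜ z') (subfeatures Sᶜ z)) ∂Q =
      (∫ z', halfResidual Q A z' * κ (subfeatures S z') (subfeatures S z) ∂Q) *
        ∫ z', χ (subfeatures Sᶜ z') (subfeatures Sᶜ z) ∂Q := by
    filter_upwards [hχC] with z hz
    exact integral_halfResidual_mul_mul hY hS hind hA (hsec hκ _)
      (Eventually.of_forall fun z' => hκ1 _ _) (hsec hχ _) hz
  have h2 : ∀ᵐ z ∂Q, halfResidual Q A z * ∫ z', halfResidual Q A z' *
      (κ (subfeatures S z') (subfeatures S z) *
        χ (subfeatures Sᶜ z') (subfeatures Sᶜ z)) ∂Q =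
      halfResidual Q A z *
        ((∫ z', halfResidual Q A z' * κ (subfeatures S z') (subfeatures S z) ∂Q) *
        ∫ z', χ (subfeatures Sᶜ z') (subfeatures Sᶜ z) ∂Q) := h1.mono fun z hz => by rw [hz]
  rw [integral_congr_ae h2]
  refine integral_halfResidual_mul_mul hY hS hind hA (B := 1) (C := C) ?_ ?_ ?_ ?_
  · have : Measurable fun v : S → ℝ => ∫ z', halfResidual Q A z' * κ (subfeatures S z') v ∂Q := by
      refine (StronglyMeasurable.integral_prod_right (ν := Q)
        (f := fun v z' => halfResidual Q A z' * κ (subfeatures S z') v) ?_).measurable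
      exact (((measurable_halfResidual Q A).comp measurable_snd).mul
        (hκ.comp (((measurable_subfeatures S).comp measurable_snd).prodMk
          measurable_fst))).stronglyMeasurable
    exact this.comp (comap_measurable (subfeatures S))
  · refine Eventually.of_forall fun z => abs_integral_le_of_ae_abs_le
      (Eventually.of_forall fun z' => ?_)
    rw [abs_mul]
    exact mul_le_one₀ (abs_halfResidual_le Q A z') (abs_nonneg _) (hκ1 _ _)
  · have : Measurable fun v => ∫ z', χ (subfeatures Sᶜ z') v ∂Q := by
      refine (StronglyMeasurable.integral_prod_right (ν := Q)
        (f := fun v z' => χ (subfeatures Sᶜ z') v) ?_).measurable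
      exact (hχ.comp (((measurable_subfeatures Sᶜ).comp measurable_snd).prodMk
          measurable_fst)).stronglyMeasurable
    exact this.comp (comap_measurable (subfeatures Sᶜ))
  · exact hχC.mono fun z hz => abs_integral_le_of_ae_abs_le hz

/-- The factor of `expKernel` contributed by the features in `T`. -/
noncomputable def blockKernel (q : ℕ) (t : ℝ) (β : EuclideanSpace ℝ (Fin p)) (T : Finset (Fin p))
    (u v : T → ℝ) : ℝ := Real.exp (-(t * ∑ i : T, β i * |u i - v i| ^ q))


theorem expKernel_eq_blockKernel_mul (q : ℕ) (t : ℝ) (β : EuclideanSpace ℝ (Fin p))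
    (T : Finset (Fin p)) (z z' : DataPoint p) : expKernel q t β z.1 z'.1 =
      blockKernel q t β T (subfeatures T z) (subfeatures T z') *
        blockKernel q t β Tᶜ (subfeatures Tᶜ z) (subfeatures Tᶜ z') := by
  rw [expKernel, blockKernel, blockKernel, ← Real.exp_add, ← neg_add, ← mul_add, weightedDist,
    ← Finset.sum_add_sum_compl T]
  simp only [subfeatures]
  rw [← Finset.sum_coe_sort T, ← Finset.sum_coe_sort Tᶜ]

theorem measurable_blockKernel (q : ℕ) (t : ℝ) (β : EuclideanSpace ℝ (Fin p))
    (T : Finset (Fin p)) : Measurable (Function.uncurry (blockKernel q t β T)) := by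
  unfold blockKernel Function.uncurry
  fun_prop

theorem blockKernel_pos (q : ℕ) (t : ℝ) (β : EuclideanSpace ℝ (Fin p)) (T : Finset (Fin p))
    (u v : T → ℝ) : 0 < blockKernel q t β T u v := Real.exp_pos _

theorem blockKernel_le_one (q : ℕ) {t M : ℝ} (ht : 0 ≤ t) {β : EuclideanSpace ℝ (Fin p)}
    (hβ : β ∈ feasibleBox p M) (T : Finset (Fin p)) (u v : T → ℝ) :
    blockKernel q t β T u v ≤ 1 := by
  refine Real.exp_le_one_iff.2 (neg_nonpos.2 (mul_nonneg ht (Finset.sum_nonneg fun i _ => ?_)))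
  exact mul_nonneg (hβ i).1 (by positivity)

theorem abs_blockKernel_le_one (q : ℕ) {t M : ℝ} (ht : 0 ≤ t) {β : EuclideanSpace ℝ (Fin p)}
    (hβ : β ∈ feasibleBox p M) (T : Finset (Fin p)) (u v : T → ℝ) :
    |blockKernel q t β T u v| ≤ 1 := by
  rw [abs_of_pos (blockKernel_pos _ _ _ _ _ _)]
  exact blockKernel_le_one q ht hβ T u v

/-- The quadratic form of a block kernel is nonnegative; features of weight zero are dropped. -/
theorem integral_integral_blockKernel_nonneg {q : ℕ} (hq : q = 1 ∨ q = 2) {t M : ℝ} (ht : 0 ≤ t)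
    {β : EuclideanSpace ℝ (Fin p)} (hβ : β ∈ feasibleBox p M) (A T : Finset (Fin p)) :
    0 ≤ ∫ z, halfResidual Q A z * ∫ z', halfResidual Q A z' *
        blockKernel q t β T (subfeatures T z') (subfeatures T z) ∂Q ∂Q := by
  classical
  have h := integral_integral_expKernel_nonneg Q hq (measurable_halfResidual Q A)
    (abs_halfResidual_le Q A) (ι := {i : T // 0 < t * β i}) (X := fun z i => z.1 i.1)
    (by fun_prop) (c := fun i => t * β i.1) (fun i => i.2)
  have h2 : ∀ z z' : DataPoint p, blockKernel q t β T (subfeatures T z') (subfeatures T z) =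
      ∏ i : {i : T // 0 < t * β i}, Real.exp (-(t * β i.1 * |z'.1 i.1 - z.1 i.1| ^ q)) := by
    intro z z'
    rw [← Real.exp_sum, blockKernel, Finset.sum_neg_distrib, Finset.mul_sum,
      ← Fintype.sum_subtype_add_sum_subtype (fun i : T => 0 < t * β i)]
    rw [add_eq_left.2]
    · simp only [subfeatures, mul_assoc]
    · refine Finset.sum_eq_zero fun i _ => ?_
      have h0 : t * β i.1 = 0 := le_antisymm (not_lt.1 i.2) (mul_nonneg ht (hβ i.1).1)
      rw [← mul_assoc, h0, zero_mul]
  simp only [h2]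
  exact h

/-- A nonconstant feature has a positive mean pairwise distance. -/
theorem integral_integral_abs_sub_pow_pos {R : ℝ} (hQ : ∀ᵐ z ∂Q, ∀ l, |z.1 l| ≤ R) (l : Fin p)
    (hl : 0 < Var[fun z : DataPoint p => z.1 l; Q]) {q : ℕ} (hq : q ≠ 0) :
    0 < ∫ z, ∫ z', |z'.1 l - z.1 l| ^ q ∂Q ∂Q := by
  have hb : ∀ᵐ z ∂Q, ∀ᵐ z' ∂Q, |(|z'.1 l - z.1 l| ^ q)| ≤ (2 * R) ^ q := by
    filter_upwards [hQ] with z hz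
    filter_upwards [hQ] with z' hz'
    rw [abs_of_nonneg (by positivity)]
    exact abs_sub_pow_le q (hz' l) (hz l)
  have hnn : ∀ z : DataPoint p, 0 ≤ ∫ z', |z'.1 l - z.1 l| ^ q ∂Q := fun z =>
    integral_nonneg fun z' => by positivity
  refine lt_of_le_of_ne (integral_nonneg hnn) fun h0 => ?_
  have hm : StronglyMeasurable fun z : DataPoint p => ∫ z', |z'.1 l - z.1 l| ^ q ∂Q := by
    refine StronglyMeasurable.integral_prod_right (ν := Q)
        (f := fun z z' : DataPoint p => |z'.1 l - z.1 l| ^ q) ?_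
    refine Measurable.stronglyMeasurable ?_
    unfold Function.uncurry
    fun_prop
  have hi : Integrable (fun z : DataPoint p => ∫ z', |z'.1 l - z.1 l| ^ q ∂Q) Q :=
    Integrable.of_bound hm.aestronglyMeasurable ((2 * R) ^ q)
      (hb.mono fun z hz => abs_integral_le_of_ae_abs_le hz)
  have h1 := (integral_eq_zero_iff_of_nonneg hnn hi).1 h0.symm
  obtain ⟨z, hz, hzb⟩ := (h1.and hb).exists
  have h2 : (fun z' : DataPoint p => |z'.1 l - z.1 l| ^ q) =ᵐ[Q] 0 := by
    refine (integral_eq_zero_iff_of_nonneg (fun z' => by positivity) ?_).1 hz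
    exact Integrable.of_bound (by fun_prop) _ hzb
  have h3 : (fun z' : DataPoint p => z'.1 l) =ᵐ[Q] fun _ => z.1 l := by
    filter_upwards [h2] with z' h
    have := pow_eq_zero_iff hq |>.1 h
    linarith [abs_eq_zero.1 this]
  rw [variance_congr h3, variance_eq_integral (by fun_prop)] at hl
  simp at hl

theorem pairMean_expKernel_eq_zero (hY : ∀ᵐ z ∂Q, z.2 = 1 ∨ z.2 = -1) (q : ℕ) {t M : ℝ}
    (ht : 0 ≤ t) {β : EuclideanSpace ℝ (Fin p)} (hβ : β ∈ feasibleBox p M) {A : Finset (Fin p)}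
    (hA : vecSupport β ⊆ A) : pairMean Q (halfResidual Q A) (expKernel q t β) = 0 := by
  have h0 : ∀ i ∉ A, β i = 0 := fun i hi => by
    by_contra h
    exact hi (hA (by simp [vecSupport, h]))
  have h1 : ∀ z : DataPoint p, ∫ z', halfResidual Q A z' * expKernel q t β z'.1 z.1 ∂Q = 0 := by
    intro z
    have h2 : (fun z' : DataPoint p => expKernel q t β z'.1 z.1) =
        (fun u => blockKernel q t β A u (subfeatures A z)) ∘ subfeatures A := by
      funext z'
      have h3 : blockKernel q t β Aᶜ (subfeatures Aᶜ z') (subfeatures Aᶜ z) = 1 := by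
        rw [blockKernel, Finset.sum_eq_zero fun i _ => ?_]
        · simp
        · rw [h0 i (Finset.mem_compl.1 i.2), zero_mul]
      rw [expKernel_eq_blockKernel_mul q t β A, h3, mul_one, Function.comp_apply]
    refine integral_halfResidual_mul_eq_zero hY A ?_ (C := 1)
      (Eventually.of_forall fun z' => abs_expKernel_le q ht hβ _ _)
    rw [h2]
    exact ((measurable_blockKernel q t β A).comp (measurable_id.prodMk measurable_const)).comp
      (comap_measurable (subfeatures A))
  simp [pairMean, h1]

/-- With all weights positive, the quadratic form at the residual is positive as long as `X_A` is
not sufficient. -/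
theorem pairMean_expKernel_pos (hY : ∀ᵐ z ∂Q, z.2 = 1 ∨ z.2 = -1) {q : ℕ} (hq : q = 1 ∨ q = 2)
    {t : ℝ} (ht : 0 < t) {β : EuclideanSpace ℝ (Fin p)} (hβ : ∀ i, 0 < β i)
    {A : Finset (Fin p)} (hA : ¬ IsSufficient Q A) :
    0 < pairMean Q (halfResidual Q A) (expKernel q t β) := by
  have hc : ∀ i, 0 < t * β i := fun i => mul_pos ht (hβ i)
  rw [pairMean_expKernel_eq_prod]
  refine lt_of_le_of_ne (integral_integral_expKernel_nonneg Q hq (measurable_halfResidual Q A)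
    (abs_halfResidual_le Q A) measurable_fst hc) fun h0 => hA ?_
  exact isSufficient_of_fourier_eq_zero hY A (integral_mul_cexp_eq_zero Q hq
    (measurable_halfResidual Q A) (abs_halfResidual_le Q A) measurable_fst hc h0.symm)

/-- Self-penalization: increasing the weight of a noise feature decreases the quadratic form at a
rate proportional to the form itself. -/
theorem exists_mul_pairMean_le_pairMean_gradKernel (hY : ∀ᵐ z ∂Q, z.2 = 1 ∨ z.2 = -1) {R : ℝ}
    (hQ : ∀ᵐ z ∂Q, ∀ l, |z.1 l| ≤ R)
    (hX_var : ∀ l, 0 < Var[fun z : DataPoint p => z.1 l; Q]) {S : Finset (Fin p)}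
    (hS : IsSufficient Q S) (hind : IndepFun (subfeatures S) (subfeatures Sᶜ) Q) {q : ℕ}
    (hq : q = 1 ∨ q = 2) (M : ℝ) {b : ℝ} (hb : 0 ≤ b) :
    ∃ c, 0 < c ∧ ∀ t, 0 ≤ t → t ≤ b → ∀ β ∈ feasibleBox p M, ∀ A ⊆ S,
      0 ≤ pairMean Q (halfResidual Q A) (expKernel q t β) ∧ ∀ l ∉ S,
      c * pairMean Q (halfResidual Q A) (expKernel q t β) ≤
        pairMean Q (halfResidual Q A) (gradKernel q t β l) := by
  have hq0 : q ≠ 0 := by rcases hq with rfl | rfl <;> norm_num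
  obtain ⟨m, hm0, hm⟩ : ∃ m : ℝ, 0 < m ∧
      ∀ l : Fin p, m ≤ ∫ z, ∫ z', |z'.1 l - z.1 l| ^ q ∂Q ∂Q :=
    exists_pos_forall_le_of_finite fun l =>
      integral_integral_abs_sub_pow_pos hQ l (hX_var l) hq0
  set E : ℝ := Real.exp (-(b * ∑ _i : Fin p, M * (2 * R) ^ q)) with hE
  have hE0 : 0 < E := Real.exp_pos _
  refine ⟨E * m, mul_pos hE0 hm0, fun t ht htb β hβ A hA => ?_⟩
  have hV := integral_integral_blockKernel_nonneg (Q := Q) hq ht hβ A S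
  set V := ∫ z, halfResidual Q A z * ∫ z', halfResidual Q A z' *
        blockKernel q t β S (subfeatures S z') (subfeatures S z) ∂Q ∂Q with hVdef
  have hbS := measurable_blockKernel q t β S
  have hbN := measurable_blockKernel q t β Sᶜ
  have h1 : pairMean Q (halfResidual Q A) (expKernel q t β) = V *
      ∫ z, ∫ z', blockKernel q t β Sᶜ (subfeatures Sᶜ z') (subfeatures Sᶜ z) ∂Q ∂Q := by
    rw [hVdef, ← pairMean_mul hY hS hind hA hbS (abs_blockKernel_le_one q ht hβ S) hbN (C := 1)
      (Eventually.of_forall fun z => Eventually.of_forall fun z' =>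
        abs_blockKernel_le_one q ht hβ _ _ _)]
    simp only [pairMean, expKernel_eq_blockKernel_mul q t β S]
  have hN0 : 0 ≤ ∫ z, ∫ z', blockKernel q t β Sᶜ (subfeatures Sᶜ z') (subfeatures Sᶜ z) ∂Q ∂Q :=
    integral_nonneg fun z => integral_nonneg fun z' => (blockKernel_pos _ _ _ _ _ _).le
  have hN1 : ∫ z, ∫ z', blockKernel q t β Sᶜ (subfeatures Sᶜ z') (subfeatures Sᶜ z) ∂Q ∂Q ≤ 1 :=
    (le_abs_self _).trans <| abs_integral_le_of_ae_abs_le <| Eventually.of_forall fun z =>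
      abs_integral_le_of_ae_abs_le <| Eventually.of_forall fun z' =>
        abs_blockKernel_le_one q ht hβ _ _ _
  refine ⟨h1 ▸ mul_nonneg hV hN0, fun l hl => ?_⟩
  have hl' : l ∈ Sᶜ := Finset.mem_compl.2 hl
  -- the noise factor of the gradient kernel
  set χ : ((Sᶜ : Finset (Fin p)) → ℝ) → ((Sᶜ : Finset (Fin p)) → ℝ) → ℝ := fun u v =>
    |u ⟨l, hl'⟩ - v ⟨l, hl'⟩| ^ q * blockKernel q t β Sᶜ u v with hχ
  have hχm : Measurable (Function.uncurry χ) := by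
    refine Measurable.mul ?_ hbN
    fun_prop
  have hχC : ∀ᵐ z ∂Q, ∀ᵐ z' ∂Q,
      |χ (subfeatures Sᶜ z') (subfeatures Sᶜ z)| ≤ (2 * R) ^ q := by
    filter_upwards [hQ] with z hz
    filter_upwards [hQ] with z' hz'
    have h2 := abs_sub_pow_le q (hz' l) (hz l)
    have h3 : 0 ≤ |z'.1 l - z.1 l| ^ q := by positivity
    simp only [hχ, subfeatures]
    rw [abs_mul, abs_of_nonneg h3]
    calc _ ≤ (2 * R) ^ q * 1 :=
          mul_le_mul h2 (abs_blockKernel_le_one q ht hβ _ _ _) (abs_nonneg _) (h3.trans h2)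
      _ = _ := mul_one _
  have h2 : pairMean Q (halfResidual Q A) (gradKernel q t β l) = V *
      ∫ z, ∫ z', χ (subfeatures Sᶜ z') (subfeatures Sᶜ z) ∂Q ∂Q := by
    rw [hVdef, ← pairMean_mul hY hS hind hA hbS (abs_blockKernel_le_one q ht hβ S) hχm hχC]
    have h3 : ∀ z z' : DataPoint p, gradKernel q t β l z'.1 z.1 =
        blockKernel q t β S (subfeatures S z') (subfeatures S z) *
          χ (subfeatures Sᶜ z') (subfeatures Sᶜ z) := fun z z' => by
      simp only [gradKernel, hχ, expKernel_eq_blockKernel_mul q t β S, subfeatures]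
      ring
    simp only [pairMean, h3]
  have h3 : E * m ≤ ∫ z, ∫ z', χ (subfeatures Sᶜ z') (subfeatures Sᶜ z) ∂Q ∂Q := by
    have hlow : ∀ᵐ z ∂Q, ∀ᵐ z' ∂Q, E * |z'.1 l - z.1 l| ^ q ≤
        χ (subfeatures Sᶜ z') (subfeatures Sᶜ z) := by
      filter_upwards [hQ] with z hz
      filter_upwards [hQ] with z' hz'
      rw [mul_comm]
      refine mul_le_mul_of_nonneg_left (Real.exp_le_exp.2 (neg_le_neg ?_)) (by positivity)
      have hM : ∀ i, β i * |z'.1 i - z.1 i| ^ q ≤ M * (2 * R) ^ q := fun i =>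
        mul_le_mul (hβ i).2 (abs_sub_pow_le q (hz' i) (hz i)) (by positivity)
          ((hβ i).1.trans (hβ i).2)
      have h4 : ∑ i : (Sᶜ : Finset (Fin p)), β i * |subfeatures Sᶜ z' i - subfeatures Sᶜ z i| ^ q ≤
          ∑ i, β i * |z'.1 i - z.1 i| ^ q := by
        simp only [subfeatures]
        rw [Finset.sum_coe_sort Sᶜ fun i => β i * |z'.1 i - z.1 i| ^ q]
        exact Finset.sum_le_sum_of_subset_of_nonneg (Finset.subset_univ _)
          fun i _ _ => mul_nonneg (hβ i).1 (by positivity)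
      refine mul_le_mul htb (h4.trans (Finset.sum_le_sum fun i _ => hM i))
        (Finset.sum_nonneg fun i _ => mul_nonneg (hβ i).1 (by positivity)) hb
    have hdist : ∀ᵐ z ∂Q, ∀ᵐ z' ∂Q, |E * |z'.1 l - z.1 l| ^ q| ≤ E * (2 * R) ^ q := by
      filter_upwards [hQ] with z hz
      filter_upwards [hQ] with z' hz'
      rw [abs_of_nonneg (by positivity)]
      exact mul_le_mul_of_nonneg_left (abs_sub_pow_le q (hz' l) (hz l)) hE0.le
    have hint : ∀ {k : DataPoint p → DataPoint p → ℝ} {C : ℝ}, Measurable (Function.uncurry k) →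
        (∀ᵐ z ∂Q, ∀ᵐ z' ∂Q, |k z z'| ≤ C) →
        Integrable (fun z => ∫ z', k z z' ∂Q) Q ∧ ∀ᵐ z ∂Q, Integrable (k z) Q := by
      intro k C hk hkC
      refine ⟨Integrable.of_bound
        (StronglyMeasurable.integral_prod_right hk.stronglyMeasurable).aestronglyMeasurable C
        (hkC.mono fun z hz => abs_integral_le_of_ae_abs_le hz), hkC.mono fun z hz => ?_⟩
      exact Integrable.of_bound (hk.comp measurable_prodMk_left).aestronglyMeasurable C hz
    have hd := hint (k := fun z z' => E * |z'.1 l - z.1 l| ^ q)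
      (by unfold Function.uncurry; fun_prop) hdist
    have hc := hint (k := fun z z' => χ (subfeatures Sᶜ z') (subfeatures Sᶜ z))
      (hχm.comp (((measurable_subfeatures Sᶜ).comp measurable_snd).prodMk
        ((measurable_subfeatures Sᶜ).comp measurable_fst))) hχC
    calc E * m ≤ E * ∫ z, ∫ z', |z'.1 l - z.1 l| ^ q ∂Q ∂Q :=
          mul_le_mul_of_nonneg_left (hm l) hE0.le
      _ = ∫ z, ∫ z', E * |z'.1 l - z.1 l| ^ q ∂Q ∂Q := by
          simp only [integral_const_mul]
      _ ≤ _ := by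
          refine integral_mono_ae hd.1 hc.1 ?_
          filter_upwards [hlow, hd.2, hc.2] with z h5 h6 h7
          exact integral_mono_ae h6 h7 h5
  rw [h1, h2]
  calc _ = V * (E * m *
        ∫ z, ∫ z', blockKernel q t β Sᶜ (subfeatures Sᶜ z') (subfeatures Sᶜ z) ∂Q ∂Q) := by ring
    _ ≤ V * (E * m * 1) := by gcongr
    _ ≤ _ := by rw [mul_one]; gcongr

end SelfPenalization

/-! ### Samples close to the population -/

section GoodSample

variable {p n : ℕ}

/-- The sample avoids the exceptional null sets of the population, and, for all selections
`A ⊆ S`, both the mean weight and the orthant averages of the residual deviate by less than `δ` from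
their expectations. -/
structure IsGoodSample (Q : Measure (DataPoint p)) [IsFiniteMeasure Q] (S : Finset (Fin p))
    (R δ : ℝ) (D : Fin n → DataPoint p) : Prop where
  resp : ∀ i, (D i).2 = 1 ∨ (D i).2 = -1
  box : ∀ i l, |(D i).1 l| ≤ R
  flip : ∀ A ⊆ S, ∀ i, flipWeight Q A (D i) * (D i).2 = halfResidual Q A (D i)
  weight : ∀ A ⊆ S, |meanDev Q D fun z => halfResidual Q A z * clip z.2| < δ
  dev : ∀ A ⊆ S, orthantDev Q R (halfResidual Q A) D < δ

theorem measure_not_isGoodSample_le (Q : Measure (DataPoint p)) [IsProbabilityMeasure Q]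
    (hY : ∀ᵐ z ∂Q, z.2 = 1 ∨ z.2 = -1) {R : ℝ} (hR : 0 ≤ R)
    (hQ : ∀ᵐ z ∂Q, ∀ l, |z.1 l| ≤ R) (S : Finset (Fin p)) (hn : 1 ≤ n) {δ : ℝ} (hδ : 0 ≤ δ) :
    (Measure.pi fun _ : Fin n => Q) {D | ¬ IsGoodSample Q S R δ D} ≤
      ENNReal.ofReal (2 ^ S.card * (4 * Real.exp (-(n * δ ^ 2 / 2)))) := by
  have hae : ∀ᵐ D ∂(Measure.pi fun _ : Fin n => Q), ∀ i, ((D i).2 = 1 ∨ (D i).2 = -1) ∧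
      (∀ l, |(D i).1 l| ≤ R) ∧
      ∀ A : Finset (Fin p), flipWeight Q A (D i) * (D i).2 = halfResidual Q A (D i) := by
    refine eventually_all.2 fun i => ?_
    have h := ae_all_iff.2 fun A : Finset (Fin p) => flipWeight_mul_response hY A
    have h' := hY.and (hQ.and h)
    exact (Measure.quasiMeasurePreserving_eval (μ := fun _ : Fin n => Q) i).ae h'
  set W : Finset (Fin p) → Set (Fin n → DataPoint p) := fun A =>
    {D | δ ≤ |meanDev Q D fun z => halfResidual Q A z * clip z.2|} with hW
  set O : Finset (Fin p) → Set (Fin n → DataPoint p) := fun A =>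
    {D | δ ≤ orthantDev Q R (halfResidual Q A) D} with hO
  have hWm : ∀ A, (Measure.pi fun _ : Fin n => Q) (W A) ≤
      ENNReal.ofReal (2 * Real.exp (-(n * δ ^ 2 / 2))) := fun A => by
    have h := measure_le_integral_abs_meanDev Q (Measure.dirac ())
      (f := fun _ z => halfResidual Q A z * clip z.2)
      (((measurable_halfResidual Q A).mul (measurable_clip.comp measurable_snd)).comp
        measurable_snd) (fun _ z => by
          rw [abs_mul]
          exact mul_le_one₀ (abs_halfResidual_le Q A z) (abs_nonneg _) (abs_clip_le _)) hn hδ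
    simpa using h
  have hOm : ∀ A, (Measure.pi fun _ : Fin n => Q) (O A) ≤
      ENNReal.ofReal (2 * Real.exp (-(n * δ ^ 2 / 2))) := fun A =>
    measure_le_orthantDev Q hR (measurable_halfResidual Q A) (abs_halfResidual_le Q A) hn hδ
  have hsub : {D | ¬ IsGoodSample Q S R δ D} ≤ᵐ[Measure.pi fun _ : Fin n => Q]
      (⋃ A ∈ S.powerset, (W A ∪ O A) : Set (Fin n → DataPoint p)) := by
    filter_upwards [hae] with D hD hbad
    by_contra hnot
    refine hbad ⟨fun i => (hD i).1, fun i => (hD i).2.1, fun A _ i => (hD i).2.2 A,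
      fun A hA => ?_, fun A hA => ?_⟩
    · by_contra h
      exact hnot (Set.mem_biUnion (Finset.mem_coe.2 (Finset.mem_powerset.2 hA))
        (Or.inl (not_lt.1 h)))
    · by_contra h
      exact hnot (Set.mem_biUnion (Finset.mem_coe.2 (Finset.mem_powerset.2 hA))
        (Or.inr (not_lt.1 h)))
  calc _ ≤ (Measure.pi fun _ : Fin n => Q) (⋃ A ∈ S.powerset, (W A ∪ O A)) :=
        measure_mono_ae hsub
    _ ≤ ∑ A ∈ S.powerset, (Measure.pi fun _ : Fin n => Q) (W A ∪ O A) :=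
        measure_biUnion_finset_le _ _
    _ ≤ ∑ _A ∈ S.powerset, ENNReal.ofReal (4 * Real.exp (-(n * δ ^ 2 / 2))) := by
        refine Finset.sum_le_sum fun A _ => (measure_union_le _ _).trans
          ((add_le_add (hWm A) (hOm A)).trans ?_)
        rw [← ENNReal.ofReal_add (by positivity) (by positivity)]
        exact ENNReal.ofReal_le_ofReal (by linarith)
    _ = _ := by
        rw [Finset.sum_const, Finset.card_powerset, ENNReal.ofReal_mul (by positivity)]
        simp [ENNReal.ofReal_pow]

end GoodSample

/-! ### The objective of a sample as a mixture of quadratic forms -/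

section EmpiricalObjective

variable {p n : ℕ} {μ : Measure ℝ} {a b : ℝ}

theorem integral_pairAvg {k : ℝ → (Fin p → ℝ) → (Fin p → ℝ) → ℝ}
    (hk : ∀ x x', Integrable (fun t => k t x x') μ) (r : DataPoint p → ℝ)
    (D : Fin n → DataPoint p) : Integrable (fun t => pairAvg r (k t) D) μ ∧
      ∫ t, pairAvg r (k t) D ∂μ =
        (∑ i, ∑ j, r (D i) * r (D j) * ∫ t, k t (D i).1 (D j).1 ∂μ) / n ^ 2 := by
  have h1 : ∀ i j, Integrable (fun t => r (D i) * r (D j) * k t (D i).1 (D j).1) μ :=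
    fun i j => (hk _ _).const_mul _
  have h2 : ∀ i, Integrable (fun t => ∑ j, r (D i) * r (D j) * k t (D i).1 (D j).1) μ :=
    fun i => integrable_finsetSum _ fun j _ => h1 i j
  unfold pairAvg
  refine ⟨(integrable_finsetSum _ fun i _ => h2 i).div_const _, ?_⟩
  rw [integral_div, integral_finsetSum _ fun i _ => h2 i]
  congr 1
  refine Finset.sum_congr rfl fun i _ => ?_
  rw [integral_finsetSum _ fun j _ => h1 i j]
  exact Finset.sum_congr rfl fun j _ => integral_const_mul _ _

variable [IsFiniteMeasure μ]

theorem integrable_pairAvg_expKernel (hμs : ∀ᵐ t ∂μ, t ∈ Set.Icc a b) (q : ℕ)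
    (β : EuclideanSpace ℝ (Fin p)) (r : DataPoint p → ℝ) (D : Fin n → DataPoint p) :
    Integrable (fun t => pairAvg r (expKernel q t β) D) μ :=
  (integral_pairAvg (k := fun t => expKernel q t β)
    (fun _ _ => integrable_exp_neg_mul hμs _) r D).1

theorem discreteObjective_eq_pairAvg (hμs : ∀ᵐ t ∂μ, t ∈ Set.Icc a b) (q : ℕ)
    (β : EuclideanSpace ℝ (Fin p)) (r : DataPoint p → ℝ) (D : Fin n → DataPoint p) (s : ℝ) :
    discreteObjective μ q (fun i => r (D i) / (n * s)) (fun i => (D i).1) β =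
      -((∫ t, pairAvg r (expKernel q t β) D ∂μ) / s ^ 2) := by
  rw [(integral_pairAvg (k := fun t => expKernel q t β)
    (fun _ _ => integrable_exp_neg_mul hμs _) r D).2, discreteObjective, div_div, ← mul_pow,
    Finset.sum_div]
  congr 1
  refine Finset.sum_congr rfl fun i _ => ?_
  rw [Finset.sum_div]
  refine Finset.sum_congr rfl fun j _ => ?_
  rw [kernelProfile]
  simp only [expKernel]
  ring

theorem integrable_mul_pairAvg_gradKernel (hμs : ∀ᵐ t ∂μ, t ∈ Set.Icc a b) (q : ℕ)
    (β : EuclideanSpace ℝ (Fin p)) (l : Fin p) (r : DataPoint p → ℝ) (D : Fin n → DataPoint p) :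
    Integrable (fun t => t * pairAvg r (gradKernel q t β l) D) μ ∧
    ∫ t, t * pairAvg r (gradKernel q t β l) D ∂μ =
      (∑ i, ∑ j, r (D i) * r (D j) * (|(D i).1 l - (D j).1 l| ^ q *
        profileSlope μ (weightedDist q β (D i).1 (D j).1))) / n ^ 2 := by
  have h1 : ∀ t, t * pairAvg r (gradKernel q t β l) D =
      pairAvg r (fun x x' => |x l - x' l| ^ q * (t * expKernel q t β x x')) D := fun t => by
    rw [pairAvg, pairAvg, ← mul_div_assoc, Finset.mul_sum]
    congr 1
    refine Finset.sum_congr rfl fun i _ => ?_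
    rw [Finset.mul_sum]
    refine Finset.sum_congr rfl fun j _ => ?_
    rw [gradKernel]
    ring
  have h2 := integral_pairAvg (μ := μ)
    (k := fun t x x' => |x l - x' l| ^ q * (t * expKernel q t β x x'))
    (fun x x' => (integrable_mul_exp_neg_mul hμs _).const_mul _) r D
  simp only [h1]
  refine ⟨h2.1, h2.2.trans ?_⟩
  simp only [integral_const_mul, profileSlope, expKernel]

theorem discreteGradient_eq_pairAvg (hμs : ∀ᵐ t ∂μ, t ∈ Set.Icc a b) (q : ℕ)
    (β : EuclideanSpace ℝ (Fin p)) (l : Fin p) (r : DataPoint p → ℝ) (D : Fin n → DataPoint p)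
    (s : ℝ) :
    discreteGradient μ q (fun i => r (D i) / (n * s)) (fun i => (D i).1) β l =
      (∫ t, t * pairAvg r (gradKernel q t β l) D ∂μ) / s ^ 2 := by
  rw [(integrable_mul_pairAvg_gradKernel hμs q β l r D).2, discreteGradient, div_div, ← mul_pow,
    Finset.sum_div, WithLp.ofLp_sum, Finset.sum_apply]
  refine Finset.sum_congr rfl fun i _ => ?_
  rw [Finset.sum_div, WithLp.ofLp_sum, Finset.sum_apply]
  refine Finset.sum_congr rfl fun j _ => ?_
  simp only [distVec, PiLp.smul_apply, smul_eq_mul]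
  ring

variable (Q : Measure (DataPoint p)) [IsProbabilityMeasure Q]

theorem mlObjective_reweightedEmpirical (μ : Measure ℝ) (q : ℕ) (A : Finset (Fin p))
    (D : Fin n → DataPoint p) : mlObjective μ q (reweightedEmpirical Q A D) =
      discreteObjective μ q
        (fun i => flipWeight Q A (D i) / (∑ j, flipWeight Q A (D j)) * (D i).2)
        (fun i => (D i).1) :=
  mlObjective_sum_smul_dirac μ q _
    (fun _ => div_nonneg (flipWeight_nonneg A _) (Finset.sum_nonneg fun _ _ =>
      flipWeight_nonneg A _)) D

theorem sum_abs_flipWeight_div_mul_le (A : Finset (Fin p)) {D : Fin n → DataPoint p}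
    (hD : ∀ i, (D i).2 = 1 ∨ (D i).2 = -1) :
    ∑ i, |flipWeight Q A (D i) / (∑ j, flipWeight Q A (D j)) * (D i).2| ≤ 1 := by
  have hy : ∀ i, |(D i).2| = 1 := fun i => by rcases hD i with h | h <;> simp [h]
  have hs : 0 ≤ ∑ j, flipWeight Q A (D j) := Finset.sum_nonneg fun _ _ => flipWeight_nonneg A _
  have h : ∀ i, |flipWeight Q A (D i) / (∑ j, flipWeight Q A (D j)) * (D i).2| =
      flipWeight Q A (D i) / (∑ j, flipWeight Q A (D j)) := fun i => by
    rw [abs_mul, hy, mul_one, abs_of_nonneg (div_nonneg (flipWeight_nonneg A _) hs)]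
  simp only [h]
  rw [← Finset.sum_div]
  exact div_self_le_one _

end EmpiricalObjective

/-! ### One pass of the loop -/

section Pass

variable {p n : ℕ} {μ : Measure ℝ} [IsFiniteMeasure μ] {a b : ℝ}

theorem integrable_pairMean_expKernel (ha : 0 < a) (hμs : ∀ᵐ t ∂μ, t ∈ Set.Icc a b)
    (Q : Measure (DataPoint p)) [IsProbabilityMeasure Q] (q : ℕ) {M : ℝ}
    {β : EuclideanSpace ℝ (Fin p)} (hβ : β ∈ feasibleBox p M) {r : DataPoint p → ℝ}
    (hr : Measurable r) (hr1 : ∀ z, |r z| ≤ 1) :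
    Integrable (fun t => pairMean Q r (expKernel q t β)) μ := by
  have h1 : Measurable fun w : ℝ × DataPoint p => ∫ z', r z' * expKernel q w.1 β z'.1 w.2.1 ∂Q := by
    refine (StronglyMeasurable.integral_prod_right (ν := Q)
      (f := fun (w : ℝ × DataPoint p) z' => r z' * expKernel q w.1 β z'.1 w.2.1) ?_).measurable
    refine Measurable.stronglyMeasurable ?_
    unfold Function.uncurry expKernel weightedDist
    fun_prop
  have h2 : StronglyMeasurable fun t => pairMean Q r (expKernel q t β) := by
    unfold pairMean
    refine StronglyMeasurable.integral_prod_right (ν := Q)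
      (f := fun t z => r z * ∫ z', r z' * expKernel q t β z'.1 z.1 ∂Q) ?_
    exact ((hr.comp measurable_snd).mul h1).stronglyMeasurable
  refine Integrable.of_bound h2.aestronglyMeasurable 1 ?_
  filter_upwards [hμs] with t ht
  have ht0 : 0 ≤ t := ha.le.trans ht.1
  refine abs_integral_le_of_ae_abs_le (Eventually.of_forall fun z => ?_)
  rw [abs_mul]
  refine mul_le_one₀ (hr1 z) (abs_nonneg _)
    (abs_integral_le_of_ae_abs_le (Eventually.of_forall fun z' => ?_))
  rw [abs_mul]
  exact mul_le_one₀ (hr1 z') (abs_nonneg _) (abs_expKernel_le q ht0 hβ _ _)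

/-- Self-penalization survives perturbations that are small compared with the total of the
quadratic forms. -/
theorem integral_mul_pos_of_selfPenalization (ha : 0 < a) (hμs : ∀ᵐ t ∂μ, t ∈ Set.Icc a b)
    {V W Vn Wn : ℝ → ℝ} (hVn : Integrable Vn μ) (hWn : Integrable (fun t => t * Wn t) μ)
    {c δ : ℝ} (hc : 0 ≤ c) (hδ : 0 ≤ δ) (h : ∀ t ∈ Set.Icc a b, 0 ≤ V t ∧ c * V t ≤ W t ∧
      |Vn t - V t| ≤ δ ∧ |Wn t - W t| ≤ δ)
    (hlow : (a * c + b) * δ * μ.real Set.univ < a * c * ∫ t, Vn t ∂μ) :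
    0 < ∫ t, t * Wn t ∂μ := by
  have h1 : ∫ t, (a * c * Vn t - (a * c + b) * δ) ∂μ =
      a * c * ∫ t, Vn t ∂μ - (a * c + b) * δ * μ.real Set.univ := by
    rw [integral_sub (hVn.const_mul _) (integrable_const _), integral_const_mul, integral_const,
      smul_eq_mul, mul_comm (μ.real Set.univ)]
  refine lt_of_lt_of_le (lt_of_lt_of_eq (sub_pos.2 hlow) h1.symm) (integral_mono_ae
    ((hVn.const_mul (a * c)).sub (integrable_const ((a * c + b) * δ))) hWn ?_)
  filter_upwards [hμs] with t ht
  obtain ⟨hV, hW, h2, h3⟩ := h t ht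
  have h4 := (abs_le.1 h2).2
  have h5 := (abs_le.1 h3).1
  have h6 : t * (c * V t - δ) ≤ t * Wn t :=
    mul_le_mul_of_nonneg_left (by linarith) (ha.le.trans ht.1)
  have h7 : a * (c * V t) ≤ t * (c * V t) :=
    mul_le_mul_of_nonneg_right ht.1 (mul_nonneg hc hV)
  have h8 : t * δ ≤ b * δ := mul_le_mul_of_nonneg_right ht.2 hδ
  have h9 : a * c * (Vn t - δ) ≤ a * c * V t :=
    mul_le_mul_of_nonneg_left (by linarith) (mul_nonneg ha.le hc)
  linarith

/-- On a good sample, let a pass start from a selection `A ⊆ S`. If the point it finds has a value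
below `-ε`, its support consists of signal features and is not contained in `A`. For small `ε`
the value is below `-ε` unless `X_A` is sufficient. -/
theorem exists_pass_constants {q : ℕ} (hq : q = 1 ∨ q = 2) (hμ : μ ≠ 0) (ha : 0 < a)
    (hμs : ∀ᵐ t ∂μ, t ∈ Set.Icc a b) (Q : Measure (DataPoint p)) [IsProbabilityMeasure Q]
    (hY : ∀ᵐ z ∂Q, z.2 = 1 ∨ z.2 = -1) {R : ℝ} (hR : 0 ≤ R) (hQ : ∀ᵐ z ∂Q, ∀ l, |z.1 l| ≤ R)
    (hX_var : ∀ l, 0 < Var[fun z : DataPoint p => z.1 l; Q])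
    (hY_var : 0 < ∫ z, (Var[(Prod.snd : DataPoint p → ℝ); Q | allSigma p]) z ∂Q)
    {S : Finset (Fin p)} (hS : IsSufficient Q S)
    (hind : IndepFun (subfeatures S) (subfeatures Sᶜ) Q) {M : ℝ} (hM : 0 ≤ M)
    {β₀ : EuclideanSpace ℝ (Fin p)} (hβ₀ : β₀ ∈ feasibleBox p M) (hβ₀_pos : ∀ i, 0 < β₀ i) :
    ∃ η ε₀ α₀ : ℝ, 0 < η ∧ 0 < ε₀ ∧ 0 < α₀ ∧ ∀ (n : ℕ) (ε : ℝ) (D : Fin n → DataPoint p),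
      1 ≤ n → 0 < ε → IsGoodSample Q S R (η * ε) D → ∀ A ⊆ S, ∀ βhat,
      IsFoundPoint (mlObjective μ q (reweightedEmpirical Q A D)) (feasibleBox p M) β₀ α₀ βhat →
      (mlObjective μ q (reweightedEmpirical Q A D) βhat < -ε →
        vecSupport βhat ⊆ S ∧ ¬ vecSupport βhat ⊆ A) ∧
      (ε ≤ ε₀ → ¬ IsSufficient Q A →
        mlObjective μ q (reweightedEmpirical Q A D) βhat < -ε) := by
  have hμne : NeZero μ := ⟨hμ⟩
  obtain ⟨t₀, ht₀⟩ := hμs.exists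
  have hb : 0 < b := ha.trans_le (ht₀.1.trans ht₀.2)
  set h0 : ℝ := μ.real Set.univ with hh0
  have hh0_pos : 0 < h0 := measureReal_univ_pos
  obtain ⟨K, hK0, hK⟩ := exists_isOrthantMixture_kernel p hq hR hb.le hM
  obtain ⟨c, hc, hself⟩ :=
    exists_mul_pairMean_le_pairMean_gradKernel hY hQ hX_var hS hind hq M hb.le
  obtain ⟨Z, hZ, hZle⟩ := exists_pos_forall_le_of_finite
    fun A : Finset (Fin p) => integral_halfResidual_mul_clip_pos hY hY_var A
  -- `v` bounds from below, over the insufficient selections, the decrease of the population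
  -- objective at the initializer
  obtain ⟨v, hv, hvle⟩ : ∃ v : ℝ, 0 < v ∧ ∀ A : {A : Finset (Fin p) // ¬ IsSufficient Q A},
      v ≤ ∫ t, pairMean Q (halfResidual Q A) (expKernel q t β₀) ∂μ := by
    refine exists_pos_forall_le_of_finite fun A => ?_
    have hpos : ∀ᵐ t ∂μ, 0 < pairMean Q (halfResidual Q A) (expKernel q t β₀) :=
      hμs.mono fun t ht => pairMean_expKernel_pos hY hq (ha.trans_le ht.1) hβ₀_pos A.2
    refine lt_of_le_of_ne (integral_nonneg_of_ae (hpos.mono fun t ht => ht.le)) fun h => ?_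
    have hzero := (integral_eq_zero_iff_of_nonneg_ae (hpos.mono fun t ht => ht.le)
      (integrable_pairMean_expKernel ha hμs Q q hβ₀ (measurable_halfResidual Q A)
        (abs_halfResidual_le Q A))).1 h.symm
    obtain ⟨t, h1, h2⟩ := (hpos.and hzero).exists
    exact h1.ne' h2
  -- `κ ε` is the admissible deviation of the quadratic forms: it has to be small against the mean
  -- weight, against the value `ε Z² / 4` of a form at an accepted point, against `ε` at the
  -- initializer, and against the self-penalization of an accepted point
  set G : ℝ := (1 + a * c + b) * h0 with hG
  have hac : 0 < a * c := mul_pos ha hc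
  have hGpos : 0 < G := by positivity
  obtain ⟨κ, hκ, hκ1, hκ2, hκ3, hκ4⟩ : ∃ κ : ℝ, 0 < κ ∧ κ * G ≤ Z / 2 ∧ κ * G ≤ Z ^ 2 / 8 ∧
      κ * G ≤ 1 ∧ κ * G ≤ a * c * Z ^ 2 / 8 := by
    refine ⟨min (min (Z / 2) (Z ^ 2 / 8)) (min 1 (a * c * Z ^ 2 / 8)) / G, by positivity, ?_⟩
    rw [div_mul_cancel₀ _ hGpos.ne']
    exact ⟨(min_le_left _ _).trans (min_le_left _ _), (min_le_left _ _).trans (min_le_right _ _),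
      (min_le_right _ _).trans (min_le_left _ _), (min_le_right _ _).trans (min_le_right _ _)⟩
  have hκh0 : κ * h0 ≤ κ * G := by
    refine mul_le_mul_of_nonneg_left ?_ hκ.le
    rw [hG]
    nlinarith
  have hκG' : (a * c + b) * h0 * κ ≤ κ * G := by
    rw [mul_comm]
    refine mul_le_mul_of_nonneg_left ?_ hκ.le
    rw [hG]
    nlinarith
  set L : ℝ := b ^ 2 * h0 * (p * ((2 * R) ^ q) ^ 2) with hL
  have hL0 : 0 ≤ L := by positivity
  have hK1 : 0 < 2 * K + 1 := by positivity
  refine ⟨κ / (2 * K + 1), min (v / 3) h0, 1 / (2 * L + 1), by positivity, by positivity,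
    by positivity, fun n ε D hn hε hD A hA βhat hfound => ?_⟩
  have hη1 : κ / (2 * K + 1) * ε ≤ κ * ε := by
    gcongr
    exact div_le_self hκ.le (by linarith)
  have hη2 : 2 * (K * (κ / (2 * K + 1) * ε)) ≤ κ * ε := by
    have : 2 * (K * (κ / (2 * K + 1) * ε)) = κ * ε * (2 * K / (2 * K + 1)) := by ring
    rw [this]
    refine mul_le_of_le_one_right (by positivity) ((div_le_one hK1).2 (by linarith))
  set r := halfResidual Q A with hr
  have hrm : Measurable r := measurable_halfResidual Q A
  have hr1 : ∀ z, |r z| ≤ 1 := abs_halfResidual_le Q A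
  have hsum := sum_abs_flipWeight_div_mul_le Q A hD.resp
  have hquad := quadUpperBound_discreteObjective ha hμs q hsum hD.box M
  rw [mlObjective_reweightedEmpirical] at hfound ⊢
  obtain ⟨hmem, hle, hst⟩ := hfound.stationary (convex_feasibleBox p M) (isCompact_feasibleBox p M)
    hquad hL0 hβ₀ (by rw [one_div_mul_eq_div, div_le_one (by positivity)]; linarith)
  have hF := abs_discreteObjective_le ha hμs q hsum (fun i => (D i).1) hmem
  -- the objective is at least `-h0`, so thresholds above `h0` are never met
  by_cases hεh : h0 < ε
  · refine ⟨fun h => ?_, fun h => absurd (h.trans (min_le_right _ _)) (not_le.2 hεh)⟩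
    linarith [(abs_le.1 hF).1]
  rw [not_lt] at hεh
  have hn0 : (0 : ℝ) < n := by exact_mod_cast hn
  -- the mean weight stays away from zero
  set s : ℝ := (∑ j, flipWeight Q A (D j)) / n with hs
  have hns : (n : ℝ) * s = ∑ j, flipWeight Q A (D j) := by rw [hs]; field_simp
  have hs_low : Z / 2 < s := by
    have h1 := hD.weight A hA
    have h2 : ∀ i, halfResidual Q A (D i) * clip (D i).2 = flipWeight Q A (D i) := fun i => by
      rw [← hD.flip A hA i, mul_assoc]
      rcases hD.resp i with h | h <;> rw [h, clip_eq_self (by simp)] <;> ring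
    simp only [meanDev, h2, ← hs] at h1
    have h3 : κ * ε ≤ κ * h0 := mul_le_mul_of_nonneg_left hεh hκ.le
    linarith [(abs_lt.1 h1).1, hZle A]
  have hs0 : 0 < s := by linarith
  have hs1 : s ≤ 1 := by
    rw [hs, div_le_one hn0]
    refine (Finset.sum_le_sum fun i _ => flipWeight_le_one A (D i)).trans (by simp)
  have hs2 : Z ^ 2 / 4 < s ^ 2 := by nlinarith
  have he : (fun i => flipWeight Q A (D i) / (∑ j, flipWeight Q A (D j)) * (D i).2) =
      fun i => r (D i) / (n * s) := by
    funext i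
    rw [hns, div_mul_eq_mul_div, hD.flip A hA i]
  rw [he] at hle hst ⊢
  rw [gradient_discreteObjective hμs] at hst
  rw [discreteObjective_eq_pairAvg hμs, discreteObjective_eq_pairAvg hμs, neg_le_neg_iff] at hle
  rw [discreteObjective_eq_pairAvg hμs, neg_lt_neg_iff]
  -- deviations of the quadratic forms
  have hdevE : ∀ t ∈ Set.Icc a b, ∀ β ∈ feasibleBox p M,
      |pairAvg r (expKernel q t β) D - pairMean Q r (expKernel q t β)| ≤ κ * ε := by
    intro t ht β hβ
    have ht0 := ha.le.trans ht.1
    refine (abs_pairAvg_sub_pairMean_le Q hR hQ hrm hr1 hn hD.box (measurable_expKernel q t β)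
      (expKernel_comm q t β) (fun x x' _ _ => abs_expKernel_le q ht0 hβ x x')
      fun x' hx' => (hK t ht0 ht.2 β hβ x' hx').1).trans (le_trans ?_ hη2)
    have := (hD.dev A hA).le
    gcongr
  have hdevG : ∀ t ∈ Set.Icc a b, ∀ β ∈ feasibleBox p M, ∀ l,
      |pairAvg r (gradKernel q t β l) D - pairMean Q r (gradKernel q t β l)| ≤ κ * ε := by
    intro t ht β hβ l
    have ht0 := ha.le.trans ht.1
    refine (abs_pairAvg_sub_pairMean_le Q hR hQ hrm hr1 hn hD.box (measurable_gradKernel q t β l)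
      (gradKernel_comm q t β l) (fun x x' hx hx' => abs_gradKernel_le q ht0 hβ l hx hx')
      fun x' hx' => (hK t ht0 ht.2 β hβ x' hx').2 l).trans (le_trans ?_ hη2)
    have := (hD.dev A hA).le
    gcongr
  refine ⟨fun hlt => ?_, fun hε₀ hAS => ?_⟩
  · rw [lt_div_iff₀ (by positivity)] at hlt
    have hlow : Z ^ 2 / 4 * ε < ∫ t, pairAvg r (expKernel q t βhat) D ∂μ :=
      lt_of_le_of_lt (by nlinarith) hlt
    refine ⟨fun l hl => ?_, fun hsub => ?_⟩
    · -- a positive derivative along a noise coordinate forces the coordinate to vanish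
      by_contra hlS
      have hgrad : 0 < ∫ t, t * pairAvg r (gradKernel q t βhat l) D ∂μ := by
        refine integral_mul_pos_of_selfPenalization ha hμs
          (integrable_pairAvg_expKernel hμs q βhat r D)
          (integrable_mul_pairAvg_gradKernel hμs q βhat l r D).1 hc.le (by positivity : 0 ≤ κ * ε)
          (V := fun t => pairMean Q r (expKernel q t βhat))
          (W := fun t => pairMean Q r (gradKernel q t βhat l)) (fun t ht => ?_) ?_
        · obtain ⟨h1, h2⟩ := hself t (ha.le.trans ht.1) ht.2 βhat hmem A hA
          exact ⟨h1, h2 l hlS, hdevE t ht βhat hmem, hdevG t ht βhat hmem l⟩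
        · have h1 := mul_lt_mul_of_pos_left hlow hac
          have h2 : (a * c + b) * (κ * ε) * h0 ≤ a * c * Z ^ 2 / 8 * ε := by
            calc _ = (a * c + b) * h0 * κ * ε := by ring
              _ ≤ _ := mul_le_mul_of_nonneg_right (hκG'.trans hκ4) hε.le
          have h3 : 0 < a * c * Z ^ 2 * ε := by positivity
          linarith
      have h0l := eq_zero_of_stationary hmem hst (l := l) (by
        rw [discreteGradient_eq_pairAvg hμs]
        positivity)
      simp [vecSupport, h0l] at hl
    · -- a form at a point supported in `A` is pure deviation
      have hbound : ∫ t, pairAvg r (expKernel q t βhat) D ∂μ ≤ κ * ε * h0 := by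
        refine (le_abs_self _).trans (norm_integral_le_of_norm_le_const (μ := μ)
          (f := fun t => pairAvg r (expKernel q t βhat) D) ?_)
        filter_upwards [hμs] with t ht
        have h1 := hdevE t ht βhat hmem
        rwa [pairMean_expKernel_eq_zero hY q (ha.le.trans ht.1) hmem hsub, sub_zero] at h1
      have h2 : κ * h0 * ε ≤ Z ^ 2 / 8 * ε := mul_le_mul_of_nonneg_right (hκh0.trans hκ2) hε.le
      have h3 : 0 < Z ^ 2 * ε := by positivity
      linarith
  · refine lt_of_lt_of_le ?_ hle
    have h1 : ∫ t, (pairMean Q r (expKernel q t β₀) - κ * ε) ∂μ ≤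
        ∫ t, pairAvg r (expKernel q t β₀) D ∂μ := by
      refine integral_mono_ae ((integrable_pairMean_expKernel ha hμs Q q hβ₀ hrm hr1).sub
        (integrable_const _)) (integrable_pairAvg_expKernel hμs q β₀ r D) ?_
      filter_upwards [hμs] with t ht
      linarith [(abs_le.1 (hdevE t ht β₀ hβ₀)).1]
    rw [integral_sub (integrable_pairMean_expKernel ha hμs Q q hβ₀ hrm hr1) (integrable_const _),
      integral_const, smul_eq_mul, ← hh0] at h1
    have h2 : h0 * (κ * ε) ≤ ε := by
      calc h0 * (κ * ε) = κ * h0 * ε := by ring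
        _ ≤ 1 * ε := mul_le_mul_of_nonneg_right (hκh0.trans hκ3) hε.le
        _ = ε := one_mul ε
    have h3 := hvle ⟨A, hAS⟩
    have h4 := hε₀.trans (min_le_left _ _)
    rw [lt_div_iff₀ (by positivity)]
    have h5 : ε * s ^ 2 ≤ ε := mul_le_of_le_one_right hε.le (pow_le_one₀ hs0.le hs1)
    simp only at h3
    linarith

end Pass

/-! ### The loop -/

section Loop

variable {p n : ℕ} {μ : Measure ℝ} {q : ℕ} {Q : Measure (DataPoint p)} [IsFiniteMeasure Q]
  {M : ℝ} {β₀ : EuclideanSpace ℝ (Fin p)} {α₀ ε : ℝ} {D : Fin n → DataPoint p}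
  {S : Finset (Fin p)}

/-- The loop terminates as long as the selection stays inside a fixed set. -/
theorem exists_loopReturns (hβ₀ : β₀ ∈ feasibleBox p M) (hα₀ : 0 < α₀)
    (hpass : ∀ A ⊆ S, ∀ βhat,
      IsFoundPoint (mlObjective μ q (reweightedEmpirical Q A D)) (feasibleBox p M) β₀ α₀ βhat →
      mlObjective μ q (reweightedEmpirical Q A D) βhat < -ε → vecSupport βhat ⊆ S)
    {A : Finset (Fin p)} (hA : A ⊆ S) : ∃ T, LoopReturns μ q Q M β₀ α₀ ε D A T := by
  classical
  induction hk : (S \ A).card using Nat.strong_induction_on generalizing A with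
  | _ k ih =>
    obtain ⟨βhat, hβ⟩ := exists_isFoundPoint
      (F := mlObjective μ q (reweightedEmpirical Q A D)) (isCompact_feasibleBox p M) hβ₀ hα₀
    by_cases hA' : (if mlObjective μ q (reweightedEmpirical Q A D) βhat < -ε
        then A ∪ vecSupport βhat else A) = A
    · exact ⟨A, LoopReturns.halt A ⟨βhat, hβ, by convert hA'.symm⟩⟩
    · have hlt : mlObjective μ q (reweightedEmpirical Q A D) βhat < -ε := by
        by_contra h
        exact hA' (if_neg h)
      rw [if_pos hlt] at hA'
      have hsub : A ∪ vecSupport βhat ⊆ S := Finset.union_subset hA (hpass A hA βhat hβ hlt)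
      have hcard : (S \ (A ∪ vecSupport βhat)).card < k := by
        have h1 := Finset.card_lt_card (Finset.subset_union_left.ssubset_of_ne (Ne.symm hA'))
        have h2 := Finset.card_sdiff_add_card_eq_card hA
        have h3 := Finset.card_sdiff_add_card_eq_card hsub
        omega
      obtain ⟨T, hT⟩ := ih _ hcard hsub rfl
      exact ⟨T, LoopReturns.next A _ T ⟨βhat, hβ, by rw [if_pos hlt]⟩ hA' hT⟩

/-- The selection stays inside `S` because each pass only adds features of `S`, and the loop cannot
stop at an insufficient selection because a pass from there adds a feature. -/
theorem LoopReturns.subset_and_sufficient {P : Prop} (hpass : ∀ A ⊆ S, ∀ βhat,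
      IsFoundPoint (mlObjective μ q (reweightedEmpirical Q A D)) (feasibleBox p M) β₀ α₀ βhat →
      (mlObjective μ q (reweightedEmpirical Q A D) βhat < -ε →
        vecSupport βhat ⊆ S ∧ ¬ vecSupport βhat ⊆ A) ∧
      (P → ¬ IsSufficient Q A → mlObjective μ q (reweightedEmpirical Q A D) βhat < -ε))
    {A T : Finset (Fin p)} (h : LoopReturns μ q Q M β₀ α₀ ε D A T) (hA : A ⊆ S) :
    T ⊆ S ∧ (P → IsSufficient Q T) := by
  classical
  induction h with
  | halt A hbody =>
    refine ⟨hA, fun hP => ?_⟩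
    by_contra hns
    obtain ⟨βhat, hβ, hbody⟩ := hbody
    have hlt := (hpass A hA βhat hβ).2 hP hns
    rw [if_pos hlt] at hbody
    refine ((hpass A hA βhat hβ).1 hlt).2 ?_
    rw [hbody]
    intro i hi
    simp [hi]
  | next A A' T hbody _ _ ih =>
    refine ih ?_
    obtain ⟨βhat, hβ, hbody⟩ := hbody
    rw [hbody]
    split_ifs with hlt
    · intro i hi
      rcases Finset.mem_union.1 hi with h | h
      · exact hA h
      · exact ((hpass A hA βhat hβ).1 hlt).1 h
    · exact hA

end Loop

/-! ### Exact recovery with high probability -/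

theorem mainTheorem5 {p : ℕ}
    -- the kernel
    (q : ℕ) (hq : q = 1 ∨ q = 2)
    (μ : Measure ℝ) [IsFiniteMeasure μ] (hμ : μ ≠ 0)
    (hμ_supp : ∃ a b : ℝ, 0 < a ∧ μ (Set.Icc a b)ᶜ = 0)
    -- the population distribution
    (Q : Measure (DataPoint p)) [IsProbabilityMeasure Q]
    (hY : ∀ᵐ z ∂Q, z.2 = 1 ∨ z.2 = -1)
    (hY_mean : ∫ z, z.2 ∂Q = 0)
    (hX_bdd : ∃ MX : ℝ, ∀ᵐ z ∂Q, ∀ l, |z.1 l| ≤ MX)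
    (hX_var : ∀ l, 0 < Var[fun z : DataPoint p => z.1 l; Q])
    (hY_var : 0 < ∫ z, (Var[(Prod.snd : DataPoint p → ℝ); Q |
      MeasurableSpace.comap (Prod.fst : DataPoint p → (Fin p → ℝ)) inferInstance]) z ∂Q)
    (S : Finset (Fin p)) (hS : IsSignalSet Q S)
    -- the feasible set and the initializer
    (M : ℝ) (hM : 0 < M)
    (β₀ : EuclideanSpace ℝ (Fin p)) (hβ₀ : β₀ ∈ feasibleBox p M)
    (hβ₀_supp : vecSupport β₀ = Finset.univ) :
    ∃ C c ε₀ α₀ : ℝ, 0 < C ∧ 0 < c ∧ 0 < ε₀ ∧ 0 < α₀ ∧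
      ∀ (n : ℕ) (ε : ℝ), 1 ≤ n → C / Real.sqrt n ≤ ε →
        Measure.pi (fun _ : Fin n => Q)
          {D | ¬ ((∃ T, IsAlgorithmOutput μ q Q M β₀ α₀ ε D T) ∧
                  ∀ T, IsAlgorithmOutput μ q Q M β₀ α₀ ε D T →
                    T ⊆ S ∧ (ε ≤ ε₀ → IsSufficient Q T))}
          ≤ ENNReal.ofReal (2 ^ S.card * Real.exp (-(c * n * ε ^ 2))) := by
  obtain ⟨a, b, ha, hab⟩ := hμ_supp
  have hμs : ∀ᵐ t ∂μ, t ∈ Set.Icc a b := mem_ae_iff.2 hab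
  obtain ⟨MX, hMX⟩ := hX_bdd
  have hQ : ∀ᵐ z ∂Q, ∀ l, |z.1 l| ≤ max MX 0 :=
    hMX.mono fun z hz l => (hz l).trans (le_max_left _ _)
  have hβ₀_pos : ∀ i, 0 < β₀ i := fun i => by
    have hi : i ∈ vecSupport β₀ := hβ₀_supp ▸ Finset.mem_univ i
    simp only [vecSupport, Finset.mem_filter] at hi
    exact lt_of_le_of_ne (hβ₀ i).1 (Ne.symm hi.2)
  obtain ⟨η, ε₀, α₀, hη, hε₀, hα₀, hpass⟩ := exists_pass_constants hq hμ ha hμs Q hY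
    (le_max_right MX 0) hQ hX_var hY_var hS.prop.1 hS.prop.2 hM.le hβ₀ hβ₀_pos
  refine ⟨3 / η, η ^ 2 / 4, ε₀, α₀, by positivity, by positivity, hε₀, hα₀,
    fun n ε hn hCε => ?_⟩
  have hn0 : (0 : ℝ) < n := by exact_mod_cast hn
  have hε : 0 < ε := lt_of_lt_of_le (by positivity) hCε
  have hsub : {D : Fin n → DataPoint p |
      ¬ ((∃ T, IsAlgorithmOutput μ q Q M β₀ α₀ ε D T) ∧
        ∀ T, IsAlgorithmOutput μ q Q M β₀ α₀ ε D T → T ⊆ S ∧ (ε ≤ ε₀ → IsSufficient Q T))} ⊆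
      {D | ¬ IsGoodSample Q S (max MX 0) (η * ε) D} := by
    intro D hbad hgood
    have h := hpass n ε D hn hε hgood
    exact hbad ⟨exists_loopReturns hβ₀ hα₀ (fun A hA βhat hβ hlt => ((h A hA βhat hβ).1 hlt).1)
      (Finset.empty_subset S), fun T hT => hT.subset_and_sufficient h (Finset.empty_subset S)⟩
  refine (measure_mono hsub).trans ((measure_not_isGoodSample_le Q hY (le_max_right MX 0) hQ S hn
    (by positivity)).trans (ENNReal.ofReal_le_ofReal ?_))
  gcongr
  -- the factor `4` is absorbed by half of the exponent, which is at least `9 / 4`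
  have h9 : 9 ≤ η ^ 2 * (n * ε ^ 2) := by
    have h1 : 3 ≤ η * (ε * √n) := by
      rw [div_le_iff₀ (Real.sqrt_pos.2 hn0), div_le_iff₀ hη] at hCε
      linarith
    have h2 : (η * (ε * √n)) ^ 2 = η ^ 2 * (n * ε ^ 2) := by
      rw [mul_pow, mul_pow, Real.sq_sqrt hn0.le]; ring
    nlinarith
  have h4 : (4 : ℝ) ≤ Real.exp (η ^ 2 / 4 * n * ε ^ 2) := by
    have h1 : (2 : ℝ) ≤ Real.exp 1 := by linarith [Real.add_one_le_exp (1 : ℝ)]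
    have h2 : Real.exp 2 = Real.exp 1 * Real.exp 1 := by rw [← Real.exp_add]; norm_num
    have h3 : Real.exp 2 ≤ Real.exp (η ^ 2 / 4 * n * ε ^ 2) := Real.exp_le_exp.2 (by linarith)
    nlinarith
  have h5 : Real.exp (-(n * (η * ε) ^ 2 / 2)) =
      Real.exp (-(η ^ 2 / 4 * n * ε ^ 2)) * Real.exp (-(η ^ 2 / 4 * n * ε ^ 2)) := by
    rw [← Real.exp_add]
    congr 1
    ring
  rw [h5, ← mul_assoc]
  refine mul_le_of_le_one_left (Real.exp_pos _).le ?_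
  rw [Real.exp_neg, ← div_eq_mul_inv]
  exact (div_le_one (Real.exp_pos _)).2 h4
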